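/- Identify $\mathbb{R}^2$ with $\mathbb{C}$. Let $F:[0,\infty)\times\mathbb{R}/\mathbb{Z}\to\mathbb{R}^2$ be a smooth global solution, through immersed closed curves $F(t,\cdot)$, of the length-preserving flow \[ \partial_t F=\vec\kappa-\Bigl(\frac1{2\pi}\int_0^{L}\|\vec\kappa\|^2\,ds\Bigr)\nu , \] where $s$ is arc length, $L=L(t)$ the length of $F(t,\cdot)$, $\nu$ the unit tangent $\partial_sF$ rotated by $+\pi/2$, and $\vec\kappa=\partial_s^2F$. Assume that the initial curve has rotation number $\frac1{2\pi}\int\kappa\,ds=1$, where $\kappa=\vec\kappa\cdot\nu$, and that its signed area is positive, where the signed area of $F(t,\cdot)$ is $A(t)=-\frac12\int_0^{L}F\cdot\nu\,ds$. Fix a point $u_0\in\mathbb{R}/\mathbb{Z}$ and let $f(\cdot,t):\mathbb{R}/L(t)\mathbb{Z}\to\mathbb{R}^2$ be the parametrization of $F(t,\cdot)$ by arc length with $f(0,t)=F(t,u_0)$. Put \[ \hat f(k)(t)=\int_0^{L(t)}f(s,t)\,\overline{\varphi_k(s)}\,ds,\qquad \varphi_k(s)=L(t)^{-1/2}e^{2\pi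 i k s/L(t)},\qquad c(t)=L(t)^{-1/2}\hat f(0)(t), \] let $r(t)\ge 0$ and $\sigma(t)\in\mathbb{R}/L(t)\mathbb{Z}$ satisfy \[ \hat f(1)(t)=\sqrt{L(t)}\;r(t)\,e^{2\pi i\sigma(t)/L(t)}, \] and put $\tilde f(\theta,t)=f(L(t)\theta-\sigma(t),t)$ for $\theta\in\mathbb{R}/\mathbb{Z}$. Then $L(t)=L_\infty>0$ is independent of $t$, and, with $r_\infty=L_\infty/2\pi$ and with constants $C,C_k>0$ and $\gamma,\gamma_k>0$ that may depend on the solution and may differ from claim to claim: (1) There is $c_\infty\in\mathbb{R}^2$ such that $\|c(t)-c_\infty\|\le Ce^{-\gamma t}$ for all $t\ge0$. (2) $|r(t)-r_\infty|\le Ce^{-\gamma t}$ for all $t\ge0$. (3) There is $\sigma_\infty\in\mathbb{R}/L_\infty\mathbb{Z}$ such that $|\sigma(t)-\sigma_\infty|\le Ce^{-\gamma t}$ for all $t\ge0$, with the distance of $\mathbb{R}/L_\infty\mathbb{Z}$. (4) For every integer $k\ge0$ we have $\|\tilde f(\cdot,t)-\tilde f_\infty\|_{C^k(\mathbb{R}/\mathbb{Z})}\le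 C_ke^{-\gamma_kt}$ for all $t\ge0$, where $\tilde f_\infty(\theta)=c_\infty+r_\infty(\cos2\pi\theta,\sin2\pi\theta)$. (5) There is $T_0\ge0$ such that for every $t\ge T_0$ the image of $\tilde f(\cdot,t)$ is the boundary of a bounded domain $\Omega(t)$. Furthermore there is $T_*\ge T_0$ such that for every $t\ge T_*$ the domain $\Omega(t)$ is strictly convex (its closure is a strictly convex set, and $\kappa>0$ everywhere on the boundary curve). (6) $d_H\bigl(\overline{\Omega(t)},D_{r_\infty}(c_\infty)\bigr)\le Ce^{-\gamma t}$ for all $t\ge T_0$, where $d_H$ is the Hausdorff distance and $D_{r_\infty}(c_\infty)$ is the closed disk with center $c_\infty$ and radius $r_\infty$. (7) With the barycenter $b(t)=\frac1{A(t)}\iint_{\Omega(t)}x\,dx$ of $\Omega(t)$, we have $\|A(t)(b(t)-c(t))\|\le Ce^{-\gamma t}$ for all $t\ge T_0$. -/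

import Mathlib

open Set Filter Topology MeasureTheory

open scoped ContDiff

noncomputable section

namespace LengthPreservingFlow

/-! The plane `ℝ²` is identified with `ℂ`; rotation by `+π/2` is multiplication by `I`.
A closed curve is a `1`-periodic map `ℝ → ℂ`; the parameter `u` need not be arc length. -/

/-- The derivative `∂ₛ g` of `g` with respect to the arc length of the curve `γ`. -/
def arcDeriv (γ g : ℝ → ℂ) (u : ℝ) : ℂ := (‖deriv γ u‖)⁻¹ • deriv g u

/-- The integral `∫₀ᴸ g ds` over the closed curve `γ` with respect to arc length. -/
def arcIntegral (γ : ℝ → ℂ) (g : ℝ → ℝ) : ℝ := ∫ u in (0 : ℝ)..1, g u * ‖deriv γ u‖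

/-- The length `L` of the closed curve. -/
def length (γ : ℝ → ℂ) : ℝ := ∫ u in (0 : ℝ)..1, ‖deriv γ u‖

/-- The unit tangent vector `∂ₛ γ`. -/
def tangent (γ : ℝ → ℂ) : ℝ → ℂ := arcDeriv γ γ

/-- The unit normal vector `ν`, the tangent rotated by `+π/2`. -/
def normal (γ : ℝ → ℂ) (u : ℝ) : ℂ := Complex.I * tangent γ u

/-- The curvature vector `∂ₛ² γ`. -/
def curvatureVec (γ : ℝ → ℂ) : ℝ → ℂ := arcDeriv γ (tangent γ)

/-- The signed curvature `κ`. -/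
def curvature (γ : ℝ → ℂ) (u : ℝ) : ℝ := inner ℝ (curvatureVec γ u) (normal γ u)

/-- The rotation number `(1 / 2π) ∫ κ ds`. -/
def rotationNumber (γ : ℝ → ℂ) : ℝ := (2 * Real.pi)⁻¹ * arcIntegral γ (curvature γ)

/-- The signed area `A = -(1/2) ∫ γ · ν ds`. -/
def signedArea (γ : ℝ → ℂ) : ℝ :=
  -(1 / 2) * arcIntegral γ (fun u => inner ℝ (γ u) (normal γ u))

/-- A global smooth solution `F t u` of the length-preserving flow
`∂ₜ F = κ⃗ - ((1 / 2π) ∫ ‖κ⃗‖² ds) ν`, through immersed closed curves `F t`, `t ≥ 0`. -/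
structure IsGlobalSolution (F : ℝ → ℝ → ℂ) : Prop where
  smooth : ContDiffOn ℝ ∞ (fun p : ℝ × ℝ => F p.1 p.2) (Ici (0 : ℝ) ×ˢ univ)
  periodic : ∀ t, 0 ≤ t → Function.Periodic (F t) 1
  immersed : ∀ t, 0 ≤ t → ∀ u, deriv (F t) u ≠ 0
  flow : ∀ t, 0 ≤ t → ∀ u,
    HasDerivWithinAt (fun τ => F τ u)
      (curvatureVec (F t) u -
        ((2 * Real.pi)⁻¹ * arcIntegral (F t) (fun v => ‖curvatureVec (F t) v‖ ^ 2)) •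
          normal (F t) u)
      (Ici 0) t

/-- The (signed) arc length of `γ` measured from the base point `u₀`; for a closed immersed curve
it is a bijection of `ℝ`. -/
def arcLength (γ : ℝ → ℂ) (u₀ u : ℝ) : ℝ := ∫ v in u₀..u, ‖deriv γ v‖

/-- The parametrization of `γ` by arc length `s`, with `s = 0` at the base point `u₀`. -/
def arcParam (γ : ℝ → ℂ) (u₀ s : ℝ) : ℂ := γ (Function.invFun (arcLength γ u₀) s)

/-- The orthonormal Fourier basis `φₖ(s) = L^{-1/2} exp(2πiks/L)` of `L²(ℝ/Lℤ)`. -/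
def fourierBasis (L : ℝ) (k : ℤ) (s : ℝ) : ℂ :=
  (Real.sqrt L : ℂ)⁻¹ * Complex.exp (2 * Real.pi * Complex.I * k * s / L)

/-- The Fourier coefficient `∫₀ᴸ f(s) conj(φₖ(s)) ds` of the arc-length parametrization `f`. -/
def fourierHat (γ : ℝ → ℂ) (u₀ : ℝ) (k : ℤ) : ℂ :=
  ∫ s in (0 : ℝ)..length γ, arcParam γ u₀ s * (starRingEnd ℂ) (fourierBasis (length γ) k s)

/-- The Fourier center `L^{-1/2} f̂(0)`. -/
def center (γ : ℝ → ℂ) (u₀ : ℝ) : ℂ := (Real.sqrt (length γ) : ℂ)⁻¹ * fourierHat γ u₀ 0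

/-- The reparametrized curve `θ ↦ f(L θ - σ)`. -/
def reparam (γ : ℝ → ℂ) (u₀ σ θ : ℝ) : ℂ := arcParam γ u₀ (length γ * θ - σ)

/-- The round circle `θ ↦ c + R (cos 2πθ, sin 2πθ)`. -/
def roundCircle (c : ℂ) (R θ : ℝ) : ℂ :=
  c + R * (Real.cos (2 * Real.pi * θ) + Real.sin (2 * Real.pi * θ) * Complex.I)

/-- `g` is a function of class `C^k` on `ℝ/ℤ` with `‖g‖_{C^k(ℝ/ℤ)} ≤ M`, where the norm is
the maximum over `j ≤ k` of the sup norms of the `j`-th derivatives. -/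
def CkNormLE (k : ℕ) (g : ℝ → ℂ) (M : ℝ) : Prop :=
  Function.Periodic g 1 ∧ ContDiff ℝ k g ∧ ∀ j ≤ k, ∀ θ, ‖iteratedDeriv j g θ‖ ≤ M

/-- `g t ≤ C e^{-λt}` for all `t ≥ T`, with some constants `C, λ > 0`. -/
def ExpDecayFrom (T : ℝ) (g : ℝ → ℝ) : Prop :=
  ∃ C > 0, ∃ lam > 0, ∀ t, T ≤ t → g t ≤ C * Real.exp (-lam * t)

/-- `Ω` is a bounded domain (nonempty, open, connected). -/
def IsBoundedDomain (Ω : Set ℂ) : Prop :=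
  IsOpen Ω ∧ IsConnected Ω ∧ Bornology.IsBounded Ω

/-- The barycenter `(1/A) ∬_Ω x dx` of the domain `Ω` bounded by `γ`, with `A` the signed area
of `γ`. -/
def barycenter (γ : ℝ → ℂ) (Ω : Set ℂ) : ℂ := (signedArea γ)⁻¹ • ∫ x in Ω, x

end LengthPreservingFlow

end

/-! Write `k = 2π/L`, `w = κ - k`, `V` for the normal velocity and `E_m = ∫ (∂ₛᵐ w)² ds`. Rotation
number one makes the length constant and gives `V = w - E₀/2π` (`length_eq`, `normalVel_eq`).

The decay starts from the isoperimetric deficit `D = L² - 4πA`. It satisfies `D' = -2L E₀`, and a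
reverse isoperimetric inequality `|D| ≤ (L³/2π) E₀` (`abs_deficit_le`) holds for immersed curves.
Nonnegativity of `D` comes from the flow itself: a negative deficit would force `E₀` to stay bounded
below, so `D` would tend to `-∞`, whereas `A ≤ L²/2` (`deficit_nonneg`). Thus `D`, and with it `∫ E₀
dτ` over `[t, t+1]`, decays exponentially, without any smallness assumption.

The passage to pointwise decay in time is an induction on the order. Each energy satisfies an
inequality `y' ≤ -z + C(1+y)^N (y + K e^{-λt})` with `y = E_m` and dissipation `z = E_{m+1}`. By
`expDecay_of_window`, decay of the means of `y` over unit windows implies decay of `y` and of the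
window means of `z`, which is the input for the next order (`energy_zero_step`, `energy_succ_step`,
`expDecay_energy`). The polynomial structure of the reaction terms is recorded by `PolyDev` and
`LinDev`. Sobolev inequalities on the circle then give uniform decay of every `∂ₛᵐ w`
(`exists_curvDev_bound`).

Since the motion is normal with decaying velocity, the point `F(t,u₀)` and its tangent converge
exponentially (`exists_asymptotics`). What remains is mostly estimates at a fixed time: a unit speed
loop with `|κ - k| ≤ ε` is `O(ε)`-close to an explicit circle (`norm_sub_circle_le`), from which the
zeroth and first Fourier modes are read off, that is, center, radius and phase. The tangent
satisfies a linear ODE with coefficient `κ`, so closeness passes to all derivatives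
(`unifDecay_iteratedDeriv`).

The domain is the intersection of the half planes to the left of the tangent lines. Its support
function about the limit center is within `O(ε)` of `1/k`, so it lies between two concentric disks,
which gives the Hausdorff and barycenter estimates. Positive curvature with total turning `2π`
identifies its frontier with the curve. -/

open Set Filter Topology MeasureTheory

open scoped ContDiff

noncomputable section

namespace LengthPreservingFlow

/-! ### Smooth functions on the slab `[0, ∞) × ℝ` -/

section Slab

variable {E : Type*} [NormedAddCommGroup E] [NormedSpace ℝ E]

/-- `G t u` is smooth on `[0, ∞) × ℝ`. -/
def SmoothSlab (G : ℝ → ℝ → E) : Prop :=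
  ContDiffOn ℝ ∞ (fun p : ℝ × ℝ => G p.1 p.2) (Ici (0 : ℝ) ×ˢ univ)

lemma uniqueDiffOn_slab : UniqueDiffOn ℝ (Ici (0 : ℝ) ×ˢ (univ : Set ℝ)) :=
  (uniqueDiffOn_Ici 0).prod uniqueDiffOn_univ

lemma slab_mem_nhds {t : ℝ} (ht : 0 < t) (u : ℝ) :
    Ici (0 : ℝ) ×ˢ (univ : Set ℝ) ∈ 𝓝 (t, u) :=
  prod_mem_nhds (Ici_mem_nhds ht) univ_mem

namespace SmoothSlab

variable {G : ℝ → ℝ → E}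

lemma slice (hG : SmoothSlab G) {t : ℝ} (ht : 0 ≤ t) : ContDiff ℝ ∞ (G t) := by
  rw [← contDiffOn_univ]
  exact ContDiffOn.comp (g := fun p : ℝ × ℝ => G p.1 p.2) (f := fun u : ℝ => (t, u)) hG
    (by fun_prop) (fun u _ => ⟨ht, mem_univ _⟩)

lemma continuous (hG : SmoothSlab G) {t : ℝ} (ht : 0 ≤ t) : Continuous (G t) :=
  (hG.slice ht).continuous

lemma deriv_eq_fderivWithin (hG : SmoothSlab G) {t : ℝ} (ht : 0 ≤ t) (u : ℝ) :
    deriv (G t) u =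
      fderivWithin ℝ (fun p : ℝ × ℝ => G p.1 p.2) (Ici (0 : ℝ) ×ˢ univ) (t, u) (0, 1) := by
  have h1 : HasFDerivWithinAt (fun p : ℝ × ℝ => G p.1 p.2) _ (Ici (0 : ℝ) ×ˢ univ) (t, u) :=
    ((hG.differentiableOn (by simp)) (t, u) ⟨ht, mem_univ _⟩).hasFDerivWithinAt
  have h2 : HasDerivWithinAt (fun u : ℝ => (t, u)) ((0 : ℝ), (1 : ℝ)) univ u :=
    ((hasDerivAt_const u t).prodMk (hasDerivAt_id u)).hasDerivWithinAt
  have h3 := h1.comp_hasDerivWithinAt u h2 (fun u _ => ⟨ht, mem_univ _⟩)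
  rw [hasDerivWithinAt_univ] at h3
  exact h3.deriv

lemma deriv (hG : SmoothSlab G) : SmoothSlab (fun t => deriv (G t)) := by
  have h1 : ContDiffOn ℝ ∞ (fun p : ℝ × ℝ => fderivWithin ℝ (fun p : ℝ × ℝ => G p.1 p.2)
      (Ici (0 : ℝ) ×ˢ univ) p (0, 1)) (Ici (0 : ℝ) ×ˢ univ) :=
    (ContDiffOn.fderivWithin hG uniqueDiffOn_slab (m := ∞) (by simp)).clm_apply contDiffOn_const
  exact h1.congr fun p hp => hG.deriv_eq_fderivWithin hp.1 p.2

lemma contDiffAt (hG : SmoothSlab G) {t : ℝ} (ht : 0 < t) (u : ℝ) :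
    ContDiffAt ℝ ∞ (fun p : ℝ × ℝ => G p.1 p.2) (t, u) :=
  ContDiffOn.contDiffAt hG (slab_mem_nhds ht u)

lemma hasDerivAt_time (hG : SmoothSlab G) {t : ℝ} (ht : 0 < t) (u : ℝ) :
    HasDerivAt (fun τ => G τ u) (fderiv ℝ (fun p : ℝ × ℝ => G p.1 p.2) (t, u) (1, 0)) t := by
  have h1 := ((hG.contDiffAt ht u).differentiableAt (by simp)).hasFDerivAt
  have h2 : HasDerivAt (fun τ : ℝ => (τ, u)) ((1 : ℝ), (0 : ℝ)) t :=
    (hasDerivAt_id t).prodMk (hasDerivAt_const t u)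
  exact h1.comp_hasDerivAt t h2

lemma hasDerivAt_space (hG : SmoothSlab G) {t : ℝ} (ht : 0 < t) (u : ℝ) :
    HasDerivAt (G t) (fderiv ℝ (fun p : ℝ × ℝ => G p.1 p.2) (t, u) (0, 1)) u := by
  have h1 := ((hG.contDiffAt ht u).differentiableAt (by simp)).hasFDerivAt
  have h2 : HasDerivAt (fun u : ℝ => (t, u)) ((0 : ℝ), (1 : ℝ)) u :=
    (hasDerivAt_const u t).prodMk (hasDerivAt_id u)
  exact h1.comp_hasDerivAt u h2

/-- The time derivative commutes with the space derivative. -/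
lemma hasDerivAt_time_deriv (hG : SmoothSlab G) {t : ℝ} (ht : 0 < t) {H : ℝ → E}
    (hH : ∀ u, HasDerivAt (fun τ => G τ u) (H u) t) {H' : E} {u : ℝ} (hH' : HasDerivAt H H' u) :
    HasDerivAt (fun τ => _root_.deriv (G τ) u) H' t := by
  set g : ℝ × ℝ → E := fun p => G p.1 p.2 with hg
  have hsymm : IsSymmSndFDerivAt ℝ g (t, u) :=
    (hG.contDiffAt ht u).isSymmSndFDerivAt (by
      simpa using (WithTop.coe_le_coe.2 le_top : ((2 : ℕ∞) : WithTop ℕ∞) ≤ ∞))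
  have hd : HasFDerivAt (fderiv ℝ g) (fderiv ℝ (fderiv ℝ g) (t, u)) (t, u) :=
    (((hG.contDiffAt ht u).fderiv_right (m := ∞) (by simp)).differentiableAt
      (by simp)).hasFDerivAt
  have hHeq : H = fun u => fderiv ℝ g (t, u) (1, 0) := by
    ext v
    exact (hH v).unique (hG.hasDerivAt_time ht v)
  have h1 : HasDerivAt (fun τ => fderiv ℝ g (τ, u) (0, 1))
      (fderiv ℝ (fderiv ℝ g) (t, u) (1, 0) (0, 1)) t := by
    have h2 : HasDerivAt (fun τ : ℝ => (τ, u)) ((1 : ℝ), (0 : ℝ)) t :=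
      (hasDerivAt_id t).prodMk (hasDerivAt_const t u)
    exact ((ContinuousLinearMap.apply ℝ E ((0 : ℝ), (1 : ℝ))).hasFDerivAt).comp_hasDerivAt t
      (hd.comp_hasDerivAt t h2)
  have h4 : HasDerivAt (fun v => fderiv ℝ g (t, v) (1, 0))
      (fderiv ℝ (fderiv ℝ g) (t, u) (0, 1) (1, 0)) u := by
    have h2 : HasDerivAt (fun v : ℝ => (t, v)) ((0 : ℝ), (1 : ℝ)) u :=
      (hasDerivAt_const u t).prodMk (hasDerivAt_id u)
    exact ((ContinuousLinearMap.apply ℝ E ((1 : ℝ), (0 : ℝ))).hasFDerivAt).comp_hasDerivAt u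
      (hd.comp_hasDerivAt u h2)
  rw [hHeq] at hH'
  rw [hH'.unique h4, ← hsymm (1, 0) (0, 1)]
  refine h1.congr_of_eventuallyEq ?_
  filter_upwards [Ioi_mem_nhds ht] with τ hτ
  exact (hG.hasDerivAt_space hτ u).deriv

lemma continuousOn_time_deriv (hG : SmoothSlab G) :
    ContinuousOn (fun p : ℝ × ℝ => fderiv ℝ (fun p : ℝ × ℝ => G p.1 p.2) p (1, 0))
      (Ioi (0 : ℝ) ×ˢ univ) := by
  have h1 : ContDiffOn ℝ ∞ (fun p : ℝ × ℝ => G p.1 p.2) (Ioi (0 : ℝ) ×ˢ univ) :=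
    ContDiffOn.mono hG (prod_mono Ioi_subset_Ici_self subset_rfl)
  exact (h1.continuousOn_fderiv_of_isOpen (isOpen_Ioi.prod isOpen_univ) (by simp)).clm_apply
    continuousOn_const

/-- Differentiation under the integral sign. -/
lemma hasDerivAt_integral (hG : SmoothSlab G) {t : ℝ} (ht : 0 < t) {H : ℝ → E}
    (hH : ∀ u, HasDerivAt (fun τ => G τ u) (H u) t) :
    HasDerivAt (fun τ => ∫ u in (0 : ℝ)..1, G τ u) (∫ u in (0 : ℝ)..1, H u) t := by
  have hHeq : H = fun u => fderiv ℝ (fun p : ℝ × ℝ => G p.1 p.2) (t, u) (1, 0) := by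
    ext v
    exact (hH v).unique (hG.hasDerivAt_time ht v)
  have hcont : ContinuousOn (fun p : ℝ × ℝ => fderiv ℝ (fun p : ℝ × ℝ => G p.1 p.2) p (1, 0))
      (Icc (t / 2) (2 * t) ×ˢ Icc (0 : ℝ) 1) :=
    hG.continuousOn_time_deriv.mono
      (prod_mono (fun x hx => lt_of_lt_of_le (by positivity) hx.1) (subset_univ _))
  obtain ⟨M, hM⟩ := (isCompact_Icc.prod isCompact_Icc).exists_bound_of_continuousOn hcont
  have hHc : Continuous H := by
    rw [hHeq, ← continuousOn_univ]
    exact hG.continuousOn_time_deriv.comp (by fun_prop) (fun u _ => ⟨ht, mem_univ _⟩)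
  refine (intervalIntegral.hasDerivAt_integral_of_dominated_loc_of_deriv_le
    (F' := fun τ u => fderiv ℝ (fun p : ℝ × ℝ => G p.1 p.2) (τ, u) (1, 0))
    (bound := fun _ => M) (s := Icc (t / 2) (2 * t)) (Icc_mem_nhds (by linarith) (by linarith))
    ?_ ?_ ?_ ?_ ?_ ?_).2.congr_deriv (by rw [hHeq])
  · filter_upwards [Ioi_mem_nhds ht] with τ hτ
    exact (hG.continuous (le_of_lt hτ)).aestronglyMeasurable
  · exact (hG.continuous ht.le).intervalIntegrable _ _
  · rw [hHeq] at hHc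
    exact hHc.aestronglyMeasurable
  · refine Eventually.of_forall fun u hu τ hτ => hM (τ, u) ⟨hτ, ?_⟩
    rw [uIoc_of_le zero_le_one] at hu
    exact ⟨hu.1.le, hu.2⟩
  · exact continuous_const.intervalIntegrable _ _
  · refine Eventually.of_forall fun u _ τ hτ => hG.hasDerivAt_time ?_ u
    exact lt_of_lt_of_le (by positivity) hτ.1

/-- Clamping time at `0` gives a continuous function on the whole plane, to which theorems on
parametric integrals apply; nothing changes for `t ≥ 0`. -/
lemma continuous_max (hG : SmoothSlab G) :
    Continuous (fun p : ℝ × ℝ => G (max p.1 0) p.2) := by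
  rw [← continuousOn_univ]
  exact ContinuousOn.comp (g := fun p : ℝ × ℝ => G p.1 p.2)
    (f := fun p : ℝ × ℝ => (max p.1 0, p.2)) (ContDiffOn.continuousOn hG) (by fun_prop)
    (fun p _ => ⟨le_max_right p.1 0, mem_univ _⟩)

lemma continuousOn_integral (hG : SmoothSlab G) :
    ContinuousOn (fun t => ∫ u in (0 : ℝ)..1, G t u) (Ici 0) := by
  have h : Continuous (fun t => ∫ u in (0 : ℝ)..1, G (max t 0) u) :=
    intervalIntegral.continuous_parametric_intervalIntegral_of_continuous' hG.continuous_max 0 1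
  refine h.continuousOn.congr fun t ht => ?_
  simp only [max_eq_left (mem_Ici.1 ht)]

lemma continuousOn_time (hG : SmoothSlab G) (u : ℝ) :
    ContinuousOn (fun t => G t u) (Ici 0) := by
  have h : Continuous (fun t => G (max t 0) u) :=
    hG.continuous_max.comp (Continuous.prodMk_left u)
  refine h.continuousOn.congr fun t ht => ?_
  simp only [max_eq_left (mem_Ici.1 ht)]

lemma sub {G₁ G₂ : ℝ → ℝ → E} (h₁ : SmoothSlab G₁) (h₂ : SmoothSlab G₂) :
    SmoothSlab (fun t u => G₁ t u - G₂ t u) := ContDiffOn.sub h₁ h₂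

lemma smul {g : ℝ → ℝ → ℝ} (h₁ : SmoothSlab g) (h₂ : SmoothSlab G) :
    SmoothSlab (fun t u => g t u • G t u) := ContDiffOn.smul h₁ h₂

lemma mul {g₁ g₂ : ℝ → ℝ → ℝ} (h₁ : SmoothSlab g₁) (h₂ : SmoothSlab g₂) :
    SmoothSlab (fun t u => g₁ t u * g₂ t u) := ContDiffOn.mul h₁ h₂

lemma pow {g : ℝ → ℝ → ℝ} (h : SmoothSlab g) (n : ℕ) :
    SmoothSlab (fun t u => g t u ^ n) := ContDiffOn.pow h n

lemma const (c : E) : SmoothSlab (fun _ _ => c) := contDiffOn_const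

lemma inv {g : ℝ → ℝ → ℝ} (h : SmoothSlab g) (h0 : ∀ t, 0 ≤ t → ∀ u, g t u ≠ 0) :
    SmoothSlab (fun t u => (g t u)⁻¹) :=
  ContDiffOn.inv h fun p hp => h0 p.1 hp.1 p.2

lemma norm {G : ℝ → ℝ → ℂ} (h : SmoothSlab G) (h0 : ∀ t, 0 ≤ t → ∀ u, G t u ≠ 0) :
    SmoothSlab (fun t u => ‖G t u‖) :=
  ContDiffOn.norm ℝ h fun p hp => h0 p.1 hp.1 p.2

lemma inner {G₁ G₂ : ℝ → ℝ → ℂ} (h₁ : SmoothSlab G₁) (h₂ : SmoothSlab G₂) :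
    SmoothSlab (fun t u => inner ℝ (G₁ t u) (G₂ t u)) := ContDiffOn.inner ℝ h₁ h₂

lemma const_mul {G : ℝ → ℝ → ℂ} (h : SmoothSlab G) (c : ℂ) :
    SmoothSlab (fun t u => c * G t u) := ContDiffOn.mul contDiffOn_const h

end SmoothSlab

lemma periodic_deriv {g : ℝ → E} (hg : Function.Periodic g 1) :
    Function.Periodic (deriv g) 1 := fun x => by
  rw [← deriv_comp_add_const, funext hg]

/-- The integral of the derivative of a periodic function over a period vanishes. -/
lemma integral_deriv_periodic [CompleteSpace E] {g g' : ℝ → E}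
    (hg : ∀ u, HasDerivAt g (g' u) u) (hg' : Continuous g') (hper : Function.Periodic g 1) :
    ∫ u in (0 : ℝ)..1, g' u = 0 := by
  rw [intervalIntegral.integral_eq_sub_of_hasDerivAt (fun u _ => hg u)
    (hg'.intervalIntegrable _ _), sub_eq_zero]
  simpa using hper 0

end Slab

/-! ### Exponential decay -/

namespace ExpDecayFrom

variable {T : ℝ} {g h : ℝ → ℝ}

lemma mono (hh : ExpDecayFrom T h) (hle : ∀ t, T ≤ t → g t ≤ h t) : ExpDecayFrom T g := by
  obtain ⟨C, hC, lam, hlam, H⟩ := hh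
  exact ⟨C, hC, lam, hlam, fun t ht => (hle t ht).trans (H t ht)⟩

lemma mono_left {T' : ℝ} (hh : ExpDecayFrom T h) (hT : T ≤ T') : ExpDecayFrom T' h := by
  obtain ⟨C, hC, lam, hlam, H⟩ := hh
  exact ⟨C, hC, lam, hlam, fun t ht => H t (hT.trans ht)⟩

lemma of_exp {C lam : ℝ} (hC : 0 ≤ C) (hlam : 0 < lam) :
    ExpDecayFrom T (fun t => C * Real.exp (-lam * t)) := by
  refine ⟨C + 1, by positivity, lam, hlam, fun t _ => ?_⟩
  dsimp only
  gcongr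
  linarith

lemma add (hg : ExpDecayFrom 0 g) (hh : ExpDecayFrom 0 h) :
    ExpDecayFrom 0 (fun t => g t + h t) := by
  obtain ⟨C, hC, lam, hlam, H⟩ := hg
  obtain ⟨C', hC', lam', hlam', H'⟩ := hh
  refine ⟨C + C', by positivity, min lam lam', lt_min hlam hlam', fun t ht => ?_⟩
  have h1 : Real.exp (-lam * t) ≤ Real.exp (-min lam lam' * t) := by
    apply Real.exp_le_exp.2
    nlinarith [min_le_left lam lam']
  have h2 : Real.exp (-lam' * t) ≤ Real.exp (-min lam lam' * t) := by
    apply Real.exp_le_exp.2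
    nlinarith [min_le_right lam lam']
  nlinarith [H t ht, H' t ht, mul_le_mul_of_nonneg_left h1 hC.le,
    mul_le_mul_of_nonneg_left h2 hC'.le]

lemma const_mul (hg : ExpDecayFrom T g) {c : ℝ} (hc : 0 ≤ c) :
    ExpDecayFrom T (fun t => c * g t) := by
  obtain ⟨C, hC, lam, hlam, H⟩ := hg
  refine ⟨(c + 1) * C, by positivity, lam, hlam, fun t ht => ?_⟩
  nlinarith [mul_le_mul_of_nonneg_left (H t ht) hc, mul_pos hC (Real.exp_pos (-lam * t))]

lemma zero : ExpDecayFrom T (fun _ => 0) :=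
  ⟨1, one_pos, 1, one_pos, fun t _ => by positivity⟩

lemma sum {ι : Type*} (s : Finset ι) {G : ι → ℝ → ℝ} (hG : ∀ i ∈ s, ExpDecayFrom 0 (G i)) :
    ExpDecayFrom 0 (fun t => ∑ i ∈ s, G i t) := by
  classical
  induction s using Finset.induction_on with
  | empty => simpa using zero
  | insert a s ha ih =>
    simp only [Finset.sum_insert ha]
    exact (hG a (Finset.mem_insert_self a s)).add
      (ih fun i hi => hG i (Finset.mem_insert_of_mem hi))

lemma sqrt (hg : ExpDecayFrom T g) : ExpDecayFrom T (fun t => Real.sqrt (g t)) := by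
  obtain ⟨C, hC, lam, hlam, H⟩ := hg
  refine ⟨Real.sqrt C, by positivity, lam / 2, by positivity, fun t ht => ?_⟩
  refine (Real.sqrt_le_sqrt (H t ht)).trans ?_
  rw [Real.sqrt_mul hC.le, ← Real.exp_half]
  refine le_of_eq ?_
  congr 2
  ring

/-- A bound on an initial time interval is absorbed into the constant, at the same rate. -/
lemma extend {T' M : ℝ} (hg : ExpDecayFrom T g) (hM : ∀ t, T' ≤ t → t ≤ T → g t ≤ M) :
    ExpDecayFrom T' g := by
  obtain ⟨C, hC, lam, hlam, H⟩ := hg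
  refine ⟨max C (|M| * Real.exp (lam * T)), lt_max_of_lt_left hC, lam, hlam, fun t ht => ?_⟩
  rcases le_total t T with h1 | h1
  · calc g t ≤ |M| * 1 := by linarith [hM t ht h1, le_abs_self M]
      _ ≤ |M| * (Real.exp (lam * T) * Real.exp (-lam * t)) := by
        rw [← Real.exp_add]
        gcongr
        apply Real.one_le_exp
        nlinarith
      _ = (|M| * Real.exp (lam * T)) * Real.exp (-lam * t) := by ring
      _ ≤ _ := by
        gcongr
        exact le_max_right _ _
  · refine (H t h1).trans ?_
    gcongr
    exact le_max_left _ _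

lemma extend_of_continuousOn (hg : ExpDecayFrom T g) (hc : ContinuousOn g (Ici 0)) :
    ExpDecayFrom 0 g := by
  obtain ⟨M, hM⟩ := isCompact_Icc.exists_bound_of_continuousOn
    (hc.mono (Icc_subset_Ici_self : Icc 0 T ⊆ _))
  exact hg.extend fun t h0 hT => (le_abs_self _).trans (hM t ⟨h0, hT⟩)

lemma comp_sub_one (hg : ExpDecayFrom 0 g) : ExpDecayFrom 1 (fun t => g (t - 1)) := by
  obtain ⟨C, hC, lam, hlam, H⟩ := hg
  refine ⟨C * Real.exp lam, by positivity, lam, hlam, fun t ht => ?_⟩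
  refine (H (t - 1) (by linarith)).trans (le_of_eq ?_)
  rw [mul_assoc, ← Real.exp_add]
  congr 2
  ring

lemma exists_le (hg : ExpDecayFrom T g) {ε : ℝ} (hε : 0 < ε) :
    ∃ T₁, T ≤ T₁ ∧ ∀ t, T₁ ≤ t → g t ≤ ε := by
  obtain ⟨C, hC, lam, hlam, H⟩ := hg
  have h1 : Tendsto (fun t : ℝ => C * Real.exp (-lam * t)) atTop (𝓝 (C * 0)) := by
    refine Tendsto.const_mul _ (Real.tendsto_exp_atBot.comp ?_)
    exact tendsto_id.const_mul_atTop_of_neg (by linarith)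
  rw [mul_zero] at h1
  obtain ⟨T₁, hT₁⟩ := eventually_atTop.1 (h1.eventually (Iio_mem_nhds hε))
  exact ⟨max T T₁, le_max_left _ _, fun t ht => (H t ((le_max_left _ _).trans ht)).trans
    (hT₁ t ((le_max_right _ _).trans ht)).le⟩

lemma exists_bound (hg : ExpDecayFrom 0 g) : ∃ M > 0, ∀ t, 0 ≤ t → g t ≤ M := by
  obtain ⟨C, hC, lam, hlam, H⟩ := hg
  refine ⟨C, hC, fun t ht => (H t ht).trans ?_⟩
  have : Real.exp (-lam * t) ≤ 1 := Real.exp_le_one_iff.2 (by nlinarith)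
  nlinarith

end ExpDecayFrom

/-- Bernoulli's inequality for `(1 - y/(1+y))ⁿ`. -/
lemma one_sub_inv_pow_le {y : ℝ} (hy : 0 ≤ y) (n : ℕ) : 1 - ((1 + y) ^ n)⁻¹ ≤ n * y := by
  have h1 : (1 + -y / (1 + y)) ^ n = ((1 + y) ^ n)⁻¹ := by
    rw [← inv_pow]
    congr 1
    field_simp
    ring
  have h0 : y / (1 + y) ≤ 1 := by
    rw [div_le_one (by positivity)]
    linarith
  have h2 := one_add_mul_le_pow (a := -y / (1 + y)) (by rw [neg_div]; linarith) n
  have h3 : y / (1 + y) ≤ y := div_le_self hy (by linarith)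
  rw [h1, neg_div] at h2
  nlinarith [mul_le_mul_of_nonneg_left h3 (Nat.cast_nonneg (α := ℝ) n)]

/-- If `y ≥ 0` has exponentially small mean over windows of length one, and grows at most
polynomially, then it decays exponentially; the dissipation `z` inherits the window bound. -/
lemma expDecay_of_window {y z y' : ℝ → ℝ} {C K lam : ℝ} {N : ℕ}
    (hyc : ContinuousOn y (Ici 0)) (hzc : ContinuousOn z (Ici 0))
    (hy0 : ∀ t, 0 ≤ t → 0 ≤ y t) (hz0 : ∀ t, 0 ≤ t → 0 ≤ z t)
    (hd : ∀ t, 0 < t → HasDerivAt y (y' t) t) (hC : 0 ≤ C) (hK : 0 ≤ K) (hlam : 0 < lam)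
    (hle : ∀ t, 0 < t → y' t ≤ -z t + C * (1 + y t) ^ N * (y t + K * Real.exp (-lam * t)))
    (hw : ExpDecayFrom 0 (fun t => ∫ τ in t..t + 1, y τ)) :
    ExpDecayFrom 0 y ∧ ExpDecayFrom 0 (fun t => ∫ τ in t..t + 1, z τ) := by
  have hec : Continuous (fun t => K * Real.exp (-lam * t)) := by fun_prop
  have hexp_le : ∀ t τ : ℝ, t ≤ τ → Real.exp (-lam * τ) ≤ Real.exp (-lam * t) := fun t τ h =>
    Real.exp_le_exp.2 (by nlinarith)
  have hsub : ∀ t : ℝ, 0 ≤ t → Icc t (t + 1) ⊆ Ici 0 := fun t ht =>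
    Icc_subset_Ici_self.trans (Ici_subset_Ici.2 ht)
  have key : ExpDecayFrom 0 y := by
    set n := N + 1 with hn
    -- A bounded monotone function of `y`. The factor `(1+y)^(-n-1)` in its derivative cancels the
    -- growth `(1+y)^N`, so the differential inequality becomes linear in `y` and can be integrated
    -- over a window with only the mean of `y` known.
    set Φ : ℝ → ℝ := fun t => 1 - ((1 + y t) ^ n)⁻¹ with hΦ
    have hpos : ∀ t, 0 ≤ t → 0 < 1 + y t := fun t ht => by linarith [hy0 t ht]
    have hΦc : ContinuousOn Φ (Ici 0) :=
      continuousOn_const.sub (((continuousOn_const.add hyc).pow n).inv₀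
        fun t ht => (pow_pos (hpos t ht) n).ne')
    have hΦd : ∀ t, 0 < t → HasDerivAt Φ (n * (1 + y t) ^ N * y' t / ((1 + y t) ^ n) ^ 2) t := by
      intro t ht
      have h1 := (((hd t ht).const_add 1).pow n).inv (pow_pos (hpos t ht.le) n).ne'
      refine (h1.const_sub 1).congr_deriv ?_
      simp [hn, neg_div]
    have hΦle : ∀ t, 0 < t → n * (1 + y t) ^ N * y' t / ((1 + y t) ^ n) ^ 2 ≤
        n * C * (y t + K * Real.exp (-lam * t)) := by
      intro t ht
      have hp := hpos t ht.le
      have hy := hy0 t ht.le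
      have hz := hz0 t ht.le
      rw [div_le_iff₀ (by positivity)]
      have h1 : y' t ≤ C * (1 + y t) ^ N * (y t + K * Real.exp (-lam * t)) := by
        linarith [hle t ht]
      have h2 : (1 + y t) ^ N * (1 + y t) ^ N ≤ ((1 + y t) ^ n) ^ 2 := by
        rw [← pow_add, ← pow_mul]
        exact pow_le_pow_right₀ (by linarith) (by omega)
      calc n * (1 + y t) ^ N * y' t
          ≤ n * (1 + y t) ^ N * (C * (1 + y t) ^ N * (y t + K * Real.exp (-lam * t))) := by
            gcongr
        _ = n * C * (y t + K * Real.exp (-lam * t)) * ((1 + y t) ^ N * (1 + y t) ^ N) := by ring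
        _ ≤ _ := by gcongr
    have hstep : ∀ t, 0 ≤ t → Φ (t + 1) ≤ (n + n * C) * (∫ τ in t..t + 1, y τ) +
        n * C * K * Real.exp (-lam * t) := by
      intro t ht
      have hyi : IntervalIntegrable y volume t (t + 1) :=
        (hyc.mono (by rw [uIcc_of_le (by linarith)]; exact hsub t ht)).intervalIntegrable
      -- The minimum of `y` over the window is at most its mean, so `s` is a good time from which to
      -- propagate to `t + 1`.
      obtain ⟨s, hs, hmin⟩ := isCompact_Icc.exists_isMinOn
        (nonempty_Icc.2 (by linarith : t ≤ t + 1)) (hyc.mono (hsub t ht))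
      have hs0 : 0 ≤ s := ht.trans hs.1
      have hys : y s ≤ ∫ τ in t..t + 1, y τ := by
        have h1 : ∫ _ in t..t + 1, y s ≤ ∫ τ in t..t + 1, y τ :=
          intervalIntegral.integral_mono_on (by linarith) (by simp) hyi fun x hx => hmin hx
        simpa using h1
      have hφc : ContinuousOn (fun τ => n * C * (y τ + K * Real.exp (-lam * τ))) (Ici 0) :=
        continuousOn_const.mul (hyc.add hec.continuousOn)
      have hIcc : Icc s (t + 1) ⊆ Ici 0 := Icc_subset_Ici_self.trans (Ici_subset_Ici.2 hs0)
      have h1 : Φ (t + 1) - Φ s ≤ ∫ τ in s..t + 1, n * C * (y τ + K * Real.exp (-lam * τ)) :=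
        intervalIntegral.sub_le_integral_of_hasDeriv_right_of_le hs.2 (hΦc.mono hIcc)
          (fun x hx => (hΦd x (hs0.trans_lt hx.1)).hasDerivWithinAt)
          (hφc.mono hIcc).integrableOn_Icc (fun x hx => hΦle x (hs0.trans_lt hx.1))
      have h2 : ∫ τ in s..t + 1, n * C * (y τ + K * Real.exp (-lam * τ)) ≤
          ∫ τ in t..t + 1, n * C * (y τ + K * Real.exp (-lam * τ)) := by
        refine intervalIntegral.integral_mono_interval hs.1 hs.2 le_rfl ?_
          ((hφc.mono (by rw [uIcc_of_le (by linarith)]; exact hsub t ht)).intervalIntegrable)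
        refine (ae_restrict_mem measurableSet_Ioc).mono fun x hx => ?_
        have := hy0 x (ht.trans hx.1.le)
        simp only [Pi.zero_apply]
        positivity
      have h3 : ∫ τ in t..t + 1, n * C * (y τ + K * Real.exp (-lam * τ)) ≤
          ∫ τ in t..t + 1, n * C * (y τ + K * Real.exp (-lam * t)) := by
        refine intervalIntegral.integral_mono_on (by linarith)
          ((hφc.mono (by rw [uIcc_of_le (by linarith)]; exact hsub t ht)).intervalIntegrable)
          ((hyi.add (by simp)).const_mul _) fun x hx => ?_
        have := hexp_le t x hx.1
        gcongr
      have h4 : ∫ τ in t..t + 1, n * C * (y τ + K * Real.exp (-lam * t)) =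
          n * C * ((∫ τ in t..t + 1, y τ) + K * Real.exp (-lam * t)) := by
        rw [intervalIntegral.integral_const_mul, intervalIntegral.integral_add hyi (by simp)]
        simp
      have h5 : Φ s ≤ n * y s := one_sub_inv_pow_le (hy0 s hs0) n
      have h6 : (n : ℝ) * y s ≤ n * ∫ τ in t..t + 1, y τ := by gcongr
      rw [h4] at h3
      nlinarith
    -- Here `y/(1+y) = 1 - (1+y)⁻¹ ≤ Φ` since `n ≥ 1`. The bound at `t` uses the window before it,
    -- hence the start at time `1`.
    have hq : ExpDecayFrom 1 (fun t => y t / (1 + y t)) := by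
      refine (((hw.const_mul (c := n + n * C) (by positivity)).add
        (ExpDecayFrom.of_exp (C := n * C * K) (by positivity) hlam)).comp_sub_one).mono ?_
      intro t ht
      have h1 := hstep (t - 1) (by linarith)
      rw [sub_add_cancel] at h1
      simp only [sub_add_cancel]
      refine le_trans ?_ h1
      have hp := hpos t (by linarith)
      have h2 : ((1 + y t) ^ n)⁻¹ ≤ (1 + y t)⁻¹ := by
        apply inv_anti₀ hp
        exact le_self_pow₀ (by linarith [hy0 t (by linarith)]) (by omega)
      have h3 : y t / (1 + y t) = 1 - (1 + y t)⁻¹ := by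
        field_simp
        ring
      simp only [hΦ]
      linarith
    -- Once `y/(1+y) ≤ 1/2` we have `y ≤ 1`, hence `y ≤ 2 · y/(1+y)`; earlier times are covered by
    -- continuity.
    obtain ⟨T, hT, hT'⟩ := hq.exists_le (ε := 1 / 2) (by norm_num)
    refine ((hq.mono_left hT).const_mul (c := 2) (by norm_num)).mono (g := y)
      (fun t ht => ?_) |>.extend_of_continuousOn hyc
    have hp := hpos t (by linarith)
    have h1 := hT' t ht
    rw [div_le_iff₀ hp] at h1
    rw [← mul_div_assoc, le_div_iff₀ hp]
    nlinarith [hy0 t (by linarith)]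
  refine ⟨key, ?_⟩
  obtain ⟨Y, hY, lam', hlam', hyle⟩ := key
  have hyY : ∀ t, 0 ≤ t → y t ≤ Y := fun t ht => (hyle t ht).trans (by
    have : Real.exp (-lam' * t) ≤ 1 := Real.exp_le_one_iff.2 (by nlinarith)
    nlinarith)
  have hdec : ExpDecayFrom 0 (fun t => Y * Real.exp (-lam' * t) +
      C * (1 + Y) ^ N * (Y * Real.exp (-lam' * t) + K * Real.exp (-lam * t))) :=
    (ExpDecayFrom.of_exp hY.le hlam').add (((ExpDecayFrom.of_exp hY.le hlam').add
      (ExpDecayFrom.of_exp hK hlam)).const_mul (by positivity))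
  refine hdec.mono fun t ht => ?_
  have hzi : IntervalIntegrable z volume t (t + 1) :=
    (hzc.mono (by rw [uIcc_of_le (by linarith)]; exact hsub t ht)).intervalIntegrable
  set B := C * (1 + Y) ^ N * (Y * Real.exp (-lam' * t) + K * Real.exp (-lam * t)) with hB
  -- With `y` decaying, the growth term is at most the exponentially small `B`. Integrating the
  -- inequality and dropping `y (t + 1) ≥ 0` bounds the window integral of `z`.
  have h1 : y (t + 1) - y t ≤ ∫ τ in t..t + 1, (-z τ + B) := by
    refine intervalIntegral.sub_le_integral_of_hasDeriv_right_of_le (by linarith)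
      (hyc.mono (hsub t ht)) (fun x hx => (hd x (ht.trans_lt hx.1)).hasDerivWithinAt) ?_ ?_
    · exact ((hzc.neg.add continuousOn_const).mono (hsub t ht)).integrableOn_Icc
    · intro x hx
      have hx0 : 0 < x := ht.trans_lt hx.1
      refine (hle x hx0).trans ?_
      have h2 : Real.exp (-lam' * x) ≤ Real.exp (-lam' * t) :=
        Real.exp_le_exp.2 (by nlinarith [hx.1])
      have h3 := hexp_le t x hx.1.le
      have h4 := hyY x hx0.le
      have h5 := hy0 x hx0.le
      have h6 : y x ≤ Y * Real.exp (-lam' * t) := (hyle x hx0.le).trans (by gcongr)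
      rw [hB]
      gcongr
  have h2 : ∫ τ in t..t + 1, (-z τ + B) = ∫ τ in t..t + 1, (B - z τ) := by
    simp only [neg_add_eq_sub]
  rw [h2, intervalIntegral.integral_sub (by simp) hzi] at h1
  simp only [intervalIntegral.integral_const, add_sub_cancel_left, one_smul] at h1
  linarith [hyle t ht, hy0 (t + 1) (by linarith)]

/-! ### Integral inequalities on the circle -/

/-- Weighted Cauchy–Schwarz inequality. -/
lemma sq_integral_mul_le {f g v : ℝ → ℝ} (hf : Continuous f) (hg : Continuous g)
    (hv : Continuous v) (hv0 : ∀ u, 0 ≤ v u) :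
    (∫ u in (0 : ℝ)..1, f u * g u * v u) ^ 2 ≤
      (∫ u in (0 : ℝ)..1, f u ^ 2 * v u) * ∫ u in (0 : ℝ)..1, g u ^ 2 * v u := by
  -- The quadratic `∫ (x f + g)² v` in `x` is nonnegative, so its discriminant is nonpositive.
  have h : ∀ x : ℝ, 0 ≤ (∫ u in (0 : ℝ)..1, f u ^ 2 * v u) * (x * x) +
      (2 * ∫ u in (0 : ℝ)..1, f u * g u * v u) * x + ∫ u in (0 : ℝ)..1, g u ^ 2 * v u := by
    intro x
    have h1 : 0 ≤ ∫ u in (0 : ℝ)..1, (x * f u + g u) ^ 2 * v u :=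
      intervalIntegral.integral_nonneg zero_le_one fun u _ => mul_nonneg (sq_nonneg _) (hv0 u)
    have h2 : ∀ u, (x * f u + g u) ^ 2 * v u = (x * x) * (f u ^ 2 * v u) +
        (2 * x) * (f u * g u * v u) + g u ^ 2 * v u := fun u => by ring
    simp_rw [h2] at h1
    rw [intervalIntegral.integral_add (Continuous.intervalIntegrable (by fun_prop) _ _)
      (Continuous.intervalIntegrable (by fun_prop) _ _),
      intervalIntegral.integral_add (Continuous.intervalIntegrable (by fun_prop) _ _)
      (Continuous.intervalIntegrable (by fun_prop) _ _), intervalIntegral.integral_const_mul,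
      intervalIntegral.integral_const_mul] at h1
    linarith
  have := discrim_le_zero h
  rw [discrim] at this
  linarith

/-- The oscillation of a periodic function is bounded by the integral of its derivative. -/
lemma norm_sub_le_integral_of_periodic {E : Type*} [NormedAddCommGroup E] [NormedSpace ℝ E]
    [CompleteSpace E] {g g' : ℝ → E} (hg : ∀ u, HasDerivAt g (g' u) u) (hg' : Continuous g')
    (hper : Function.Periodic g 1) (u v : ℝ) : ‖g u - g v‖ ≤ ∫ x in (0 : ℝ)..1, ‖g' x‖ := by
  obtain ⟨a, ha, hua⟩ := hper.exists_mem_Ico₀ one_pos u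
  obtain ⟨b, hb, hvb⟩ := hper.exists_mem_Ico₀ one_pos v
  rw [hua, hvb]
  wlog hab : b ≤ a generalizing a b u v
  · rw [norm_sub_rev]
    exact this v u b hb hvb a ha hua (le_of_not_ge hab)
  rw [← intervalIntegral.integral_eq_sub_of_hasDerivAt (fun x _ => hg x)
    (hg'.intervalIntegrable _ _)]
  refine (intervalIntegral.norm_integral_le_integral_norm hab).trans ?_
  exact intervalIntegral.integral_mono_interval hb.1 hab ha.2.le
    (Eventually.of_forall fun _ => norm_nonneg _) (hg'.norm.intervalIntegrable _ _)

lemma exists_eq_zero_of_integral_eq_zero {g v : ℝ → ℝ} (hg : Continuous g) (hv : Continuous v)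
    (hv0 : ∀ u, 0 < v u) (h0 : ∫ u in (0 : ℝ)..1, g u * v u = 0) : ∃ u, g u = 0 := by
  by_contra! hne
  have hcont : Continuous fun u => g u * v u := hg.mul hv
  by_cases hex : ∃ a, 0 < g a
  · obtain ⟨a, ha⟩ := hex
    have hall : ∀ b, 0 < g b := by
      intro b
      by_contra! hb
      obtain ⟨c, hc⟩ := mem_range_of_exists_le_of_exists_ge hg ⟨b, hb⟩ ⟨a, ha.le⟩
      exact hne c hc
    exact (intervalIntegral.intervalIntegral_pos_of_pos (hcont.intervalIntegrable 0 1)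
      (fun u => mul_pos (hall u) (hv0 u)) one_pos).ne' h0
  · push Not at hex
    have h1 : 0 < ∫ u in (0 : ℝ)..1, -(g u * v u) :=
      intervalIntegral.intervalIntegral_pos_of_pos (hcont.neg.intervalIntegrable 0 1)
        (fun u => neg_pos.2 (mul_neg_of_neg_of_pos (lt_of_le_of_ne (hex u) (hne u)) (hv0 u)))
        one_pos
    rw [intervalIntegral.integral_neg, h0, neg_zero] at h1
    exact h1.false

section MeanZero

variable {g h v : ℝ → ℝ} (hg : ∀ u, HasDerivAt g (v u * h u) u) (hh : Continuous h)
  (hv : Continuous v) (hv0 : ∀ u, 0 < v u) (hper : Function.Periodic g 1)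
  (h0 : ∫ u in (0 : ℝ)..1, g u * v u = 0)

include hg hh hv hv0 hper h0

/-- A function of mean zero vanishes somewhere, so it is bounded by its oscillation, that is by `∫
|h| v`; Cauchy–Schwarz against `1` finishes. -/
lemma sq_le_of_mean_zero (u : ℝ) :
    g u ^ 2 ≤ (∫ u in (0 : ℝ)..1, v u) * ∫ u in (0 : ℝ)..1, h u ^ 2 * v u := by
  have hgc : Continuous g := continuous_iff_continuousAt.2 fun u => (hg u).continuousAt
  obtain ⟨u₁, hu₁⟩ := exists_eq_zero_of_integral_eq_zero hgc hv hv0 h0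
  have h1 := norm_sub_le_integral_of_periodic hg (hv.mul hh) hper u u₁
  rw [hu₁, sub_zero, Real.norm_eq_abs] at h1
  have h2 : ∀ x, ‖v x * h x‖ = 1 * |h x| * v x := fun x => by
    rw [norm_mul, Real.norm_of_nonneg (hv0 x).le, Real.norm_eq_abs]
    ring
  simp_rw [h2] at h1
  have h3 := sq_integral_mul_le (continuous_const (y := (1 : ℝ))) hh.abs hv fun u => (hv0 u).le
  simp only [one_pow, one_mul, sq_abs] at h3 h1
  calc g u ^ 2 = |g u| ^ 2 := (sq_abs _).symm
    _ ≤ _ := pow_le_pow_left₀ (abs_nonneg _) h1 2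
    _ ≤ _ := h3

/-- The same oscillation argument applied to `g²`, whose derivative is `2 g h v`. It interpolates:
only half a power of the higher energy enters the bound for `g²`, which leaves room to absorb it. -/
lemma pow_four_le_of_mean_zero (u : ℝ) :
    g u ^ 4 ≤ 4 * ((∫ u in (0 : ℝ)..1, g u ^ 2 * v u) * ∫ u in (0 : ℝ)..1, h u ^ 2 * v u) := by
  have hgc : Continuous g := continuous_iff_continuousAt.2 fun u => (hg u).continuousAt
  obtain ⟨u₁, hu₁⟩ := exists_eq_zero_of_integral_eq_zero hgc hv hv0 h0
  have hg2 : ∀ u, HasDerivAt (fun u => g u ^ 2) (2 * (g u * h u * v u)) u := fun u =>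
    ((hg u).pow 2).congr_deriv (by push_cast; ring)
  have h1 := norm_sub_le_integral_of_periodic hg2 (by fun_prop)
    (fun x => by simp only [hper x]) u u₁
  rw [hu₁] at h1
  have h2 : ∀ x, ‖2 * (g x * h x * v x)‖ = 2 * (|g x| * |h x| * v x) := fun x => by
    simp only [norm_mul, Real.norm_of_nonneg (hv0 x).le, Real.norm_eq_abs, abs_two]
  simp_rw [h2] at h1
  rw [intervalIntegral.integral_const_mul] at h1
  have h3 := sq_integral_mul_le hgc.abs hh.abs hv fun u => (hv0 u).le
  simp only [sq_abs] at h3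
  have h4 : g u ^ 2 ≤ 2 * ∫ x in (0 : ℝ)..1, |g x| * |h x| * v x := by
    refine le_trans ?_ h1
    rw [zero_pow two_ne_zero, sub_zero]
    exact le_abs_self _
  calc g u ^ 4 = (g u ^ 2) ^ 2 := by ring
    _ ≤ (2 * ∫ x in (0 : ℝ)..1, |g x| * |h x| * v x) ^ 2 := pow_le_pow_left₀ (sq_nonneg _) h4 2
    _ ≤ _ := by rw [mul_pow]; linarith

end MeanZero

/-! ### Immersed closed curves -/

section Curve

variable {γ : ℝ → ℂ} (hγ : ContDiff ℝ ∞ γ) (hne : ∀ u, deriv γ u ≠ 0)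

lemma inner_I_mul_self (z : ℂ) : inner ℝ z (Complex.I * z) = 0 := by
  simp only [Complex.inner, Complex.mul_re, Complex.mul_im, Complex.conj_re, Complex.conj_im,
    Complex.I_re, Complex.I_im]
  ring

lemma norm_I_mul (z : ℂ) : ‖Complex.I * z‖ = ‖z‖ := by simp

lemma eq_inner_smul_add {T : ℂ} (hT : ‖T‖ = 1) (z : ℂ) :
    z = inner ℝ T z • T + inner ℝ z (Complex.I * T) • (Complex.I * T) := by
  have h1 : T.re * T.re + T.im * T.im = 1 := by
    rw [← Complex.normSq_apply, Complex.normSq_eq_norm_sq, hT, one_pow]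
  apply Complex.ext
  · simp only [Complex.inner, Complex.mul_re, Complex.mul_im, Complex.conj_re, Complex.conj_im,
      Complex.I_re, Complex.I_im, Complex.add_re, Complex.real_smul, Complex.ofReal_re,
      Complex.ofReal_im]
    linear_combination -z.re * h1
  · simp only [Complex.inner, Complex.mul_re, Complex.mul_im, Complex.conj_re, Complex.conj_im,
      Complex.I_re, Complex.I_im, Complex.add_im, Complex.real_smul, Complex.ofReal_re,
      Complex.ofReal_im]
    linear_combination -z.im * h1

include hne in
lemma norm_tangent (u : ℝ) : ‖tangent γ u‖ = 1 := by
  have := norm_ne_zero_iff.2 (hne u)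
  rw [tangent, arcDeriv, norm_smul, norm_inv, norm_norm, inv_mul_cancel₀ this]

include hne in
lemma speed_smul_tangent (u : ℝ) : ‖deriv γ u‖ • tangent γ u = deriv γ u := by
  rw [tangent, arcDeriv, smul_inv_smul₀ (norm_ne_zero_iff.2 (hne u))]

include hγ hne

lemma contDiff_speed : ContDiff ℝ ∞ (fun u => ‖deriv γ u‖) :=
  (contDiff_infty_iff_deriv.1 hγ).2.norm ℝ hne

lemma contDiff_arcDeriv {g : ℝ → ℂ} (hg : ContDiff ℝ ∞ g) : ContDiff ℝ ∞ (arcDeriv γ g) :=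
  ((contDiff_speed hγ hne).inv fun u => norm_ne_zero_iff.2 (hne u)).smul (contDiff_infty_iff_deriv.1 hg).2

lemma contDiff_tangent : ContDiff ℝ ∞ (tangent γ) := contDiff_arcDeriv hγ hne hγ

lemma contDiff_curvature : ContDiff ℝ ∞ (curvature γ) :=
  (contDiff_arcDeriv hγ hne (contDiff_tangent hγ hne)).inner ℝ
    (contDiff_const.mul (contDiff_tangent hγ hne))

lemma hasDerivAt_tangent_aux (u : ℝ) :
    HasDerivAt (tangent γ) (deriv (tangent γ) u) u :=
  ((contDiff_tangent hγ hne).differentiable (by simp) u).hasDerivAt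

lemma inner_tangent_deriv (u : ℝ) : inner ℝ (tangent γ u) (deriv (tangent γ) u) = 0 := by
  have h1 := (hasDerivAt_tangent_aux hγ hne u).norm_sq
  have h2 : (fun u => ‖tangent γ u‖ ^ 2) = fun _ => 1 := by
    ext x
    rw [norm_tangent hne, one_pow]
  rw [h2] at h1
  have := h1.unique (hasDerivAt_const u 1)
  linarith

/-- Frenet equation: `∂ₛ² γ = κ ν`. -/
lemma curvatureVec_eq (u : ℝ) : curvatureVec γ u = curvature γ u • normal γ u := by
  have h1 := eq_inner_smul_add (norm_tangent hne u) (curvatureVec γ u)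
  have h2 : inner ℝ (tangent γ u) (curvatureVec γ u) = 0 := by
    rw [curvatureVec, arcDeriv, inner_smul_right, inner_tangent_deriv hγ hne, mul_zero]
  rw [h2, zero_smul, zero_add] at h1
  exact h1

omit hγ in
lemma norm_normal (u : ℝ) : ‖normal γ u‖ = 1 := by
  rw [normal, norm_I_mul, norm_tangent hne]

lemma norm_curvatureVec_sq (u : ℝ) : ‖curvatureVec γ u‖ ^ 2 = curvature γ u ^ 2 := by
  rw [curvatureVec_eq hγ hne, norm_smul, norm_normal hne, mul_one, Real.norm_eq_abs, sq_abs]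

lemma hasDerivAt_tangent (u : ℝ) :
    HasDerivAt (tangent γ) ((‖deriv γ u‖ * curvature γ u) • normal γ u) u := by
  refine (hasDerivAt_tangent_aux hγ hne u).congr_deriv ?_
  rw [mul_smul, ← curvatureVec_eq hγ hne, curvatureVec, arcDeriv,
    smul_inv_smul₀ (norm_ne_zero_iff.2 (hne u))]

lemma hasDerivAt_normal (u : ℝ) :
    HasDerivAt (normal γ) (-(‖deriv γ u‖ * curvature γ u) • tangent γ u) u := by
  refine ((hasDerivAt_tangent hγ hne u).const_mul Complex.I).congr_deriv ?_
  rw [normal, mul_smul_comm, ← mul_assoc, Complex.I_mul_I, neg_one_mul, smul_neg, neg_smul]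

lemma hasDerivAt_curve (u : ℝ) : HasDerivAt γ (‖deriv γ u‖ • tangent γ u) u := by
  rw [speed_smul_tangent hne]
  exact (hγ.differentiable (by simp) u).hasDerivAt

end Curve

lemma periodic_speed {γ : ℝ → ℂ} (hper : Function.Periodic γ 1) :
    Function.Periodic (fun u => ‖deriv γ u‖) 1 := fun u => by
  simp only [periodic_deriv hper u]

lemma periodic_arcDeriv {γ g : ℝ → ℂ} (hper : Function.Periodic γ 1)
    (hg : Function.Periodic g 1) : Function.Periodic (arcDeriv γ g) 1 := fun u => by
  simp only [arcDeriv, periodic_deriv hper u, periodic_deriv hg u]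

lemma periodic_tangent {γ : ℝ → ℂ} (hper : Function.Periodic γ 1) :
    Function.Periodic (tangent γ) 1 := periodic_arcDeriv hper hper

lemma periodic_curvature {γ : ℝ → ℂ} (hper : Function.Periodic γ 1) :
    Function.Periodic (curvature γ) 1 := fun u => by
  simp only [curvature, curvatureVec, normal, periodic_tangent hper u,
    periodic_arcDeriv hper (periodic_tangent hper) u]

/-- The iterated arc length derivatives `∂ₛᵐ (κ - k₀)` of the curvature deviation. -/
def curvDev (k₀ : ℝ) (γ : ℝ → ℂ) : ℕ → ℝ → ℝ
  | 0 => fun u => curvature γ u - k₀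
  | m + 1 => fun u => ‖deriv γ u‖⁻¹ * deriv (curvDev k₀ γ m) u

lemma periodic_curvDev (k₀ : ℝ) {γ : ℝ → ℂ} (hper : Function.Periodic γ 1) (m : ℕ) :
    Function.Periodic (curvDev k₀ γ m) 1 := by
  induction m with
  | zero => exact fun u => by simp only [curvDev, periodic_curvature hper u]
  | succ m ih =>
    exact fun u => by simp only [curvDev, periodic_deriv hper u, periodic_deriv ih u]

lemma contDiff_curvDev (k₀ : ℝ) {γ : ℝ → ℂ} (hγ : ContDiff ℝ ∞ γ) (hne : ∀ u, deriv γ u ≠ 0)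
    (m : ℕ) : ContDiff ℝ ∞ (curvDev k₀ γ m) := by
  induction m with
  | zero => exact (contDiff_curvature hγ hne).sub contDiff_const
  | succ m ih =>
    exact ((contDiff_speed hγ hne).inv fun u => norm_ne_zero_iff.2 (hne u)).mul
      (contDiff_infty_iff_deriv.1 ih).2

lemma hasDerivAt_curvDev (k₀ : ℝ) {γ : ℝ → ℂ} (hγ : ContDiff ℝ ∞ γ) (hne : ∀ u, deriv γ u ≠ 0)
    (m : ℕ) (u : ℝ) :
    HasDerivAt (curvDev k₀ γ m) (‖deriv γ u‖ * curvDev k₀ γ (m + 1) u) u := by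
  rw [curvDev, mul_inv_cancel_left₀ (norm_ne_zero_iff.2 (hne u))]
  exact ((contDiff_curvDev k₀ hγ hne m).differentiable (by simp) u).hasDerivAt

/-! ### Evolution equations -/

/-- The multiplier `λ = (1 / 2π) ∫ ‖κ⃗‖² ds`. -/
def multiplier (γ : ℝ → ℂ) : ℝ :=
  (2 * Real.pi)⁻¹ * arcIntegral γ (fun u => ‖curvatureVec γ u‖ ^ 2)

/-- The normal velocity `κ - λ`. -/
def normalVel (γ : ℝ → ℂ) (u : ℝ) : ℝ := curvature γ u - multiplier γ

/-- The lower order terms in the evolution equation of `∂ₛᵐ κ`. -/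
def lowerOrder (k₀ : ℝ) (γ : ℝ → ℂ) : ℕ → ℝ → ℝ
  | 0 => fun u => curvature γ u ^ 2 * normalVel γ u
  | m + 1 => fun u => ‖deriv γ u‖⁻¹ * deriv (lowerOrder k₀ γ m) u +
      curvature γ u * normalVel γ u * curvDev k₀ γ (m + 1) u

lemma contDiff_normalVel {γ : ℝ → ℂ} (hγ : ContDiff ℝ ∞ γ) (hne : ∀ u, deriv γ u ≠ 0) :
    ContDiff ℝ ∞ (normalVel γ) := (contDiff_curvature hγ hne).sub contDiff_const

lemma contDiff_lowerOrder (k₀ : ℝ) {γ : ℝ → ℂ} (hγ : ContDiff ℝ ∞ γ)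
    (hne : ∀ u, deriv γ u ≠ 0) (m : ℕ) : ContDiff ℝ ∞ (lowerOrder k₀ γ m) := by
  have hκ := contDiff_curvature hγ hne
  have hV := contDiff_normalVel hγ hne
  induction m with
  | zero => exact (hκ.pow 2).mul hV
  | succ m ih =>
    exact (((contDiff_speed hγ hne).inv fun u => norm_ne_zero_iff.2 (hne u)).mul
      (contDiff_infty_iff_deriv.1 ih).2).add ((hκ.mul hV).mul (contDiff_curvDev k₀ hγ hne (m + 1)))

namespace IsGlobalSolution

variable {F : ℝ → ℝ → ℂ} (hF : IsGlobalSolution F)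

include hF

lemma slab : SmoothSlab F := hF.smooth

lemma slab_deriv : SmoothSlab (fun t => deriv (F t)) := hF.slab.deriv

lemma contDiff {t : ℝ} (ht : 0 ≤ t) : ContDiff ℝ ∞ (F t) := hF.slab.slice ht

lemma slab_speed : SmoothSlab (fun t u => ‖deriv (F t) u‖) := hF.slab_deriv.norm hF.immersed

lemma speed_pos {t : ℝ} (ht : 0 ≤ t) (u : ℝ) : 0 < ‖deriv (F t) u‖ :=
  norm_pos_iff.2 (hF.immersed t ht u)

lemma slab_speed_inv : SmoothSlab (fun t u => ‖deriv (F t) u‖⁻¹) :=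
  hF.slab_speed.inv fun _ ht u => (hF.speed_pos ht u).ne'

lemma slab_tangent : SmoothSlab (fun t => tangent (F t)) :=
  hF.slab_speed_inv.smul hF.slab_deriv

lemma slab_normal : SmoothSlab (fun t => normal (F t)) := hF.slab_tangent.const_mul _

lemma slab_curvature : SmoothSlab (fun t => curvature (F t)) :=
  (hF.slab_speed_inv.smul hF.slab_tangent.deriv).inner hF.slab_normal

lemma slab_curvDev (k₀ : ℝ) (m : ℕ) : SmoothSlab (fun t => curvDev k₀ (F t) m) := by
  induction m with
  | zero => exact hF.slab_curvature.sub (SmoothSlab.const k₀)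
  | succ m ih => exact hF.slab_speed_inv.mul ih.deriv

section Evolution

variable {t : ℝ} (ht : 0 < t) (k₀ : ℝ)

include ht

lemma hasDerivAt_flow (u : ℝ) :
    HasDerivAt (fun τ => F τ u) (normalVel (F t) u • normal (F t) u) t := by
  refine ((hF.flow t ht.le u).hasDerivAt (Ici_mem_nhds ht)).congr_deriv ?_
  rw [curvatureVec_eq (hF.contDiff ht.le) (hF.immersed t ht.le), normalVel, sub_smul]
  rfl

lemma hasDerivAt_normalVel (u : ℝ) :
    HasDerivAt (normalVel (F t)) (‖deriv (F t) u‖ * curvDev k₀ (F t) 1 u) u :=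
  ((hasDerivAt_curvDev k₀ (hF.contDiff ht.le) (hF.immersed t ht.le) 0 u).add_const
    (k₀ - multiplier (F t))).congr_of_eventuallyEq
    (Eventually.of_forall fun x => by simp only [normalVel, curvDev]; ring)

lemma hasDerivAt_time_deriv_curve (u : ℝ) :
    HasDerivAt (fun τ => deriv (F τ) u)
      ((‖deriv (F t) u‖ * curvDev k₀ (F t) 1 u) • normal (F t) u -
        (normalVel (F t) u * ‖deriv (F t) u‖ * curvature (F t) u) • tangent (F t) u) t := by
  refine hF.slab.hasDerivAt_time_deriv ht (hF.hasDerivAt_flow ht) ?_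
  refine ((hF.hasDerivAt_normalVel ht k₀ u).smul
    (hasDerivAt_normal (hF.contDiff ht.le) (hF.immersed t ht.le) u)).congr_deriv ?_
  module

/-- Differentiate `‖F_u‖²` in time: only the tangential component `-κ V ‖F_u‖` of `∂ₜ F_u`
contributes. -/
lemma hasDerivAt_speed (u : ℝ) :
    HasDerivAt (fun τ => ‖deriv (F τ) u‖)
      (-(curvature (F t) u * normalVel (F t) u * ‖deriv (F t) u‖)) t := by
  have h1 := hF.slab_speed.hasDerivAt_time ht u
  refine h1.congr_deriv ?_
  have h2 := (hF.hasDerivAt_time_deriv_curve ht 0 u).norm_sq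
  have h3 := h2.unique (h1.pow 2)
  have hne := hF.immersed t ht.le
  have hT : inner ℝ (deriv (F t) u) (tangent (F t) u) = ‖deriv (F t) u‖ := by
    rw [← speed_smul_tangent hne u, inner_smul_left, real_inner_self_eq_norm_sq,
      norm_tangent hne, norm_smul, norm_tangent hne]
    simp
  have hN : inner ℝ (deriv (F t) u) (normal (F t) u) = 0 := by
    rw [← speed_smul_tangent hne u, inner_smul_left, normal, inner_I_mul_self, mul_zero]
  rw [inner_sub_right, inner_smul_right, inner_smul_right, hT, hN] at h3
  have hv := hF.speed_pos ht.le u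
  have h4 : (2 * ‖deriv (F t) u‖) * (fderiv ℝ (fun p : ℝ × ℝ => ‖deriv (F p.1) p.2‖) (t, u) (1, 0))
      = (2 * ‖deriv (F t) u‖) * (-(curvature (F t) u * normalVel (F t) u * ‖deriv (F t) u‖)) := by
    push_cast at h3
    linear_combination -h3
  exact mul_left_cancel₀ (by positivity) h4

lemma hasDerivAt_speed_inv (u : ℝ) :
    HasDerivAt (fun τ => ‖deriv (F τ) u‖⁻¹)
      (curvature (F t) u * normalVel (F t) u * ‖deriv (F t) u‖⁻¹) t := by
  have hv := (hF.speed_pos ht.le u).ne'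
  refine ((hF.hasDerivAt_speed ht u).inv hv).congr_deriv ?_
  field_simp

lemma hasDerivAt_time_tangent (u : ℝ) :
    HasDerivAt (fun τ => tangent (F τ) u) (curvDev k₀ (F t) 1 u • normal (F t) u) t := by
  have hne := hF.immersed t ht.le
  have hv := (hF.speed_pos ht.le u).ne'
  refine ((hF.hasDerivAt_speed_inv ht u).smul
    (hF.hasDerivAt_time_deriv_curve ht k₀ u)).congr_deriv ?_
  nth_rewrite 5 [← speed_smul_tangent hne u]
  rw [smul_sub, smul_smul, smul_smul, smul_smul, inv_mul_cancel_left₀ hv,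
    mul_assoc _ (‖deriv (F t) u‖⁻¹), inv_mul_cancel₀ hv]
  have : ‖deriv (F t) u‖⁻¹ * (normalVel (F t) u * ‖deriv (F t) u‖ * curvature (F t) u) =
      curvature (F t) u * normalVel (F t) u * 1 := by
    field_simp
  rw [this, sub_add_cancel]

/-- Obtained by differentiating the identity `⟨∂ᵤ T, ν⟩ = ‖F_u‖ κ` in time and solving for `∂ₜ κ`.
-/
lemma hasDerivAt_time_curvature (u : ℝ) :
    HasDerivAt (fun τ => curvature (F τ) u)
      (curvDev k₀ (F t) 2 u + curvature (F t) u ^ 2 * normalVel (F t) u) t := by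
  have hne := hF.immersed t ht.le
  have hc := hF.contDiff ht.le
  have hv := hF.speed_pos ht.le u
  have h1 := hF.slab_curvature.hasDerivAt_time ht u
  refine h1.congr_deriv ?_
  have hTu : HasDerivAt (fun τ => deriv (tangent (F τ)) u)
      ((‖deriv (F t) u‖ * curvDev k₀ (F t) 2 u) • normal (F t) u -
        (curvDev k₀ (F t) 1 u * ‖deriv (F t) u‖ * curvature (F t) u) • tangent (F t) u) t := by
    refine hF.slab_tangent.hasDerivAt_time_deriv ht (hF.hasDerivAt_time_tangent ht k₀) ?_
    refine ((hasDerivAt_curvDev k₀ hc hne 1 u).smul (hasDerivAt_normal hc hne u)).congr_deriv ?_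
    module
  have hN : HasDerivAt (fun τ => normal (F τ) u)
      (-(curvDev k₀ (F t) 1 u) • tangent (F t) u) t := by
    refine ((hF.hasDerivAt_time_tangent ht k₀ u).const_mul Complex.I).congr_deriv ?_
    rw [normal, mul_smul_comm, ← mul_assoc, Complex.I_mul_I, neg_one_mul, smul_neg, neg_smul]
  have h2 := hTu.inner ℝ hN
  have h3 : (fun τ => inner ℝ (deriv (tangent (F τ)) u) (normal (F τ) u)) =ᶠ[𝓝 t]
      fun τ => ‖deriv (F τ) u‖ * curvature (F τ) u := by
    filter_upwards [Ioi_mem_nhds ht] with τ hτ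
    have hne' := hF.immersed τ (le_of_lt hτ)
    rw [(hasDerivAt_tangent (hF.contDiff (le_of_lt hτ)) hne' u).deriv, inner_smul_left,
      real_inner_self_eq_norm_sq, norm_normal hne']
    simp
  have h4 := (h2.congr_of_eventuallyEq h3.symm).unique ((hF.hasDerivAt_speed ht u).mul h1)
  have e1 : inner ℝ (normal (F t) u) (normal (F t) u) = (1 : ℝ) := by
    rw [real_inner_self_eq_norm_sq, norm_normal hne, one_pow]
  have e2 : inner ℝ (tangent (F t) u) (normal (F t) u) = (0 : ℝ) := inner_I_mul_self _
  have e3 : inner ℝ (normal (F t) u) (tangent (F t) u) = (0 : ℝ) := by rw [real_inner_comm, e2]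
  rw [(hasDerivAt_tangent hc hne u).deriv, inner_smul_left, inner_smul_right, inner_sub_left,
    inner_smul_left, inner_smul_left, e1, e2, e3] at h4
  simp only [conj_trivial] at h4
  refine mul_left_cancel₀ hv.ne' ?_
  linear_combination -h4

/-- Evolution equation of the derivatives of the curvature. -/
lemma hasDerivAt_time_curvDev (m : ℕ) (u : ℝ) :
    HasDerivAt (fun τ => curvDev k₀ (F τ) m u)
      (curvDev k₀ (F t) (m + 2) u + lowerOrder k₀ (F t) m u) t := by
  induction m generalizing u with
  | zero => exact (hF.hasDerivAt_time_curvature ht k₀ u).sub_const k₀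
  | succ m ih =>
    have hne := hF.immersed t ht.le
    have hc := hF.contDiff ht.le
    have hv := (hF.speed_pos ht.le u).ne'
    have h1 := (hF.slab_curvDev k₀ m).hasDerivAt_time_deriv ht ih
      ((hasDerivAt_curvDev k₀ hc hne (m + 2) u).add
        ((contDiff_lowerOrder k₀ hc hne m).differentiable (by simp) u).hasDerivAt)
    -- The time derivative of `1/‖F_u‖` is the commutator `[∂ₜ, ∂ₛ] = κ V ∂ₛ`, the source of the
    -- second summand of `lowerOrder`.
    refine ((hF.hasDerivAt_speed_inv ht u).mul h1).congr_deriv ?_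
    simp only [lowerOrder]
    rw [show curvDev k₀ (F t) (m + 1) u = ‖deriv (F t) u‖⁻¹ * deriv (curvDev k₀ (F t) m) u from rfl]
    field_simp
    ring

end Evolution

end IsGlobalSolution

/-! ### Conserved quantities, area and energies -/

/-- The mean curvature `2π / L` of the initial curve. -/
def meanCurv (F : ℝ → ℝ → ℂ) : ℝ := 2 * Real.pi / length (F 0)

/-- The energies `∫ (∂ₛᵐ (κ - k₀))² ds`. -/
def energy (F : ℝ → ℝ → ℂ) (m : ℕ) (t : ℝ) : ℝ :=
  ∫ u in (0 : ℝ)..1, curvDev (meanCurv F) (F t) m u ^ 2 * ‖deriv (F t) u‖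

lemma eq_of_hasDerivAt_zero {g : ℝ → ℝ} (hc : ContinuousOn g (Ici 0))
    (hd : ∀ t, 0 < t → HasDerivAt g 0 t) {t : ℝ} (ht : 0 ≤ t) : g t = g 0 := by
  have hd' : ∀ x ∈ interior (Ici (0 : ℝ)), deriv g x = 0 := fun x hx => by
    rw [interior_Ici] at hx
    exact (hd x hx).deriv
  have hdiff : DifferentiableOn ℝ g (interior (Ici 0)) := fun x hx => by
    rw [interior_Ici] at hx
    exact (hd x hx).differentiableAt.differentiableWithinAt
  exact le_antisymm
    (antitoneOn_of_deriv_nonpos (convex_Ici 0) hc hdiff (fun x hx => (hd' x hx).le)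
      self_mem_Ici ht ht)
    (monotoneOn_of_deriv_nonneg (convex_Ici 0) hc hdiff (fun x hx => (hd' x hx).ge)
      self_mem_Ici ht ht)

namespace IsGlobalSolution

variable {F : ℝ → ℝ → ℂ} (hF : IsGlobalSolution F)

include hF

lemma continuous_speed {t : ℝ} (ht : 0 ≤ t) : Continuous (fun u => ‖deriv (F t) u‖) :=
  hF.slab_speed.continuous ht

lemma continuous_curvature {t : ℝ} (ht : 0 ≤ t) : Continuous (curvature (F t)) :=
  hF.slab_curvature.continuous ht

lemma continuous_tangent {t : ℝ} (ht : 0 ≤ t) : Continuous (tangent (F t)) :=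
  hF.slab_tangent.continuous ht

lemma continuous_normal {t : ℝ} (ht : 0 ≤ t) : Continuous (normal (F t)) :=
  hF.slab_normal.continuous ht

lemma continuous_curvDev (k₀ : ℝ) (m : ℕ) {t : ℝ} (ht : 0 ≤ t) :
    Continuous (curvDev k₀ (F t) m) := (hF.slab_curvDev k₀ m).continuous ht

lemma continuous_normalVel {t : ℝ} (ht : 0 ≤ t) : Continuous (normalVel (F t)) :=
  (hF.continuous_curvature ht).sub continuous_const

lemma length_pos {t : ℝ} (ht : 0 ≤ t) : 0 < length (F t) :=
  intervalIntegral.intervalIntegral_pos_of_pos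
    ((hF.continuous_speed ht).intervalIntegrable 0 1) (hF.speed_pos ht) one_pos

lemma meanCurv_pos : 0 < meanCurv F := by
  have := hF.length_pos le_rfl
  have := Real.pi_pos
  unfold meanCurv
  positivity

/-- The integral of an arc length derivative vanishes. -/
lemma integral_curvDev_succ (k₀ : ℝ) (m : ℕ) {t : ℝ} (ht : 0 ≤ t) :
    ∫ u in (0 : ℝ)..1, curvDev k₀ (F t) (m + 1) u * ‖deriv (F t) u‖ = 0 := by
  have h : ∀ u, curvDev k₀ (F t) (m + 1) u * ‖deriv (F t) u‖ =
      ‖deriv (F t) u‖ * curvDev k₀ (F t) (m + 1) u := fun u => mul_comm _ _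
  simp_rw [h]
  exact integral_deriv_periodic (hasDerivAt_curvDev k₀ (hF.contDiff ht) (hF.immersed t ht) m)
    ((hF.continuous_speed ht).mul (hF.continuous_curvDev k₀ (m + 1) ht))
    (periodic_curvDev k₀ (hF.periodic t ht) m)

/-- The reaction term of `∂ₜ κ` cancels against the change of `ds`, so `∂ₜ (κ ds) = κ_ss ds` is
exact. -/
lemma integral_curvature_eq_zero_time {t : ℝ} (ht : 0 ≤ t) :
    ∫ u in (0 : ℝ)..1, curvature (F t) u * ‖deriv (F t) u‖ =
      ∫ u in (0 : ℝ)..1, curvature (F 0) u * ‖deriv (F 0) u‖ := by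
  have hs : SmoothSlab (fun t u => curvature (F t) u * ‖deriv (F t) u‖) :=
    hF.slab_curvature.mul hF.slab_speed
  refine eq_of_hasDerivAt_zero hs.continuousOn_integral (fun t ht => ?_) ht
  refine (hs.hasDerivAt_integral ht fun u =>
    (hF.hasDerivAt_time_curvature ht 0 u).mul (hF.hasDerivAt_speed ht u)).congr_deriv ?_
  refine Eq.trans ?_ (hF.integral_curvDev_succ 0 1 ht.le)
  congr 1
  ext u
  ring

variable (hrot : rotationNumber (F 0) = 1)

include hrot

lemma integral_curvature {t : ℝ} (ht : 0 ≤ t) :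
    ∫ u in (0 : ℝ)..1, curvature (F t) u * ‖deriv (F t) u‖ = 2 * Real.pi := by
  have := Real.pi_pos
  rw [hF.integral_curvature_eq_zero_time ht]
  rw [rotationNumber, arcIntegral, inv_mul_eq_one₀ (by positivity)] at hrot
  exact hrot.symm

omit hrot in
lemma integral_curvature_sq {t : ℝ} (ht : 0 ≤ t) :
    ∫ u in (0 : ℝ)..1, curvature (F t) u ^ 2 * ‖deriv (F t) u‖ =
      2 * Real.pi * multiplier (F t) := by
  have := Real.pi_pos
  rw [multiplier, arcIntegral, mul_inv_cancel_left₀ (by positivity)]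
  simp_rw [norm_curvatureVec_sq (hF.contDiff ht) (hF.immersed t ht)]

/-- `L' = -∫ κ V ds = λ ∫ κ ds - ∫ κ² ds`, and with `∫ κ ds = 2π` the multiplier `λ` is exactly what
makes this vanish. -/
lemma length_eq {t : ℝ} (ht : 0 ≤ t) : length (F t) = length (F 0) := by
  refine eq_of_hasDerivAt_zero hF.slab_speed.continuousOn_integral (fun t ht => ?_) ht
  refine (hF.slab_speed.hasDerivAt_integral ht fun u => hF.hasDerivAt_speed ht u).congr_deriv ?_
  have hκ := hF.continuous_curvature ht.le
  have hv := hF.continuous_speed ht.le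
  have h1 : ∀ u, -(curvature (F t) u * normalVel (F t) u * ‖deriv (F t) u‖) =
      multiplier (F t) * (curvature (F t) u * ‖deriv (F t) u‖) -
      curvature (F t) u ^ 2 * ‖deriv (F t) u‖ := fun u => by rw [normalVel]; ring
  simp_rw [h1]
  rw [intervalIntegral.integral_sub (Continuous.intervalIntegrable (by fun_prop) _ _)
    (Continuous.intervalIntegrable (by fun_prop) _ _), intervalIntegral.integral_const_mul,
    hF.integral_curvature hrot ht.le, hF.integral_curvature_sq ht.le]
  ring

lemma meanCurv_mul_length {t : ℝ} (ht : 0 ≤ t) : meanCurv F * length (F t) = 2 * Real.pi := by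
  rw [hF.length_eq hrot ht, meanCurv, div_mul_cancel₀ _ (hF.length_pos le_rfl).ne']

lemma integral_curvDev (m : ℕ) {t : ℝ} (ht : 0 ≤ t) :
    ∫ u in (0 : ℝ)..1, curvDev (meanCurv F) (F t) m u * ‖deriv (F t) u‖ = 0 := by
  cases m with
  | succ m => exact hF.integral_curvDev_succ _ m ht
  | zero =>
    have hκ := hF.continuous_curvature ht
    have hv := hF.continuous_speed ht
    simp only [curvDev, sub_mul]
    rw [intervalIntegral.integral_sub (Continuous.intervalIntegrable (by fun_prop) _ _)
      (Continuous.intervalIntegrable (by fun_prop) _ _), intervalIntegral.integral_const_mul,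
      hF.integral_curvature hrot ht, ← hF.meanCurv_mul_length hrot ht, length, sub_self]

/-- Expand `∫ (κ - k)² ds` using `∫ κ ds = 2π = kL`. The excess of the multiplier over `k` is
therefore quadratic in the curvature deviation. -/
lemma multiplier_eq {t : ℝ} (ht : 0 ≤ t) :
    multiplier (F t) = meanCurv F + energy F 0 t / (2 * Real.pi) := by
  have hκ := hF.continuous_curvature ht
  have hv := hF.continuous_speed ht
  have hpi := Real.pi_pos
  have h1 : energy F 0 t = 2 * Real.pi * multiplier (F t) -
      2 * meanCurv F * (2 * Real.pi) + meanCurv F ^ 2 * length (F t) := by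
    rw [← hF.integral_curvature_sq ht, ← hF.integral_curvature hrot ht, length, energy,
      ← intervalIntegral.integral_const_mul, ← intervalIntegral.integral_const_mul,
      ← intervalIntegral.integral_sub (Continuous.intervalIntegrable (by fun_prop) _ _)
      (Continuous.intervalIntegrable (by fun_prop) _ _),
      ← intervalIntegral.integral_add (Continuous.intervalIntegrable (by fun_prop) _ _)
      (Continuous.intervalIntegrable (by fun_prop) _ _)]
    refine intervalIntegral.integral_congr fun u _ => ?_
    simp only [curvDev]
    ring
  rw [h1, ← sub_eq_iff_eq_add', eq_div_iff (by positivity)]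
  linear_combination -meanCurv F * hF.meanCurv_mul_length hrot ht

lemma normalVel_eq {t : ℝ} (ht : 0 ≤ t) (u : ℝ) :
    normalVel (F t) u = curvDev (meanCurv F) (F t) 0 u - energy F 0 t / (2 * Real.pi) := by
  rw [normalVel, hF.multiplier_eq hrot ht, curvDev]
  ring

omit hrot in
lemma energy_nonneg (m : ℕ) {t : ℝ} (ht : 0 ≤ t) : 0 ≤ energy F m t :=
  intervalIntegral.integral_nonneg zero_le_one fun u _ =>
    mul_nonneg (sq_nonneg _) (hF.speed_pos ht u).le

omit hrot in
lemma slab_energy (m : ℕ) :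
    SmoothSlab (fun t u => curvDev (meanCurv F) (F t) m u ^ 2 * ‖deriv (F t) u‖) :=
  ((hF.slab_curvDev _ m).pow 2).mul hF.slab_speed

omit hrot in
lemma continuousOn_energy (m : ℕ) : ContinuousOn (energy F m) (Ici 0) :=
  (hF.slab_energy m).continuousOn_integral

omit hrot in
/-- Energy identity. -/
lemma hasDerivAt_energy (m : ℕ) {t : ℝ} (ht : 0 < t) :
    HasDerivAt (energy F m) (-(2 * energy F (m + 1) t) +
      ∫ u in (0 : ℝ)..1, (2 * curvDev (meanCurv F) (F t) m u * lowerOrder (meanCurv F) (F t) m u -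
        curvature (F t) u * normalVel (F t) u * curvDev (meanCurv F) (F t) m u ^ 2) *
        ‖deriv (F t) u‖) t := by
  have hne := hF.immersed t ht.le
  have hc := hF.contDiff ht.le
  set k := meanCurv F with hk
  have hκ := hF.continuous_curvature ht.le
  have hv := hF.continuous_speed ht.le
  have hV := hF.continuous_normalVel ht.le
  have hw := fun m => hF.continuous_curvDev k m ht.le
  have hQ : Continuous (lowerOrder k (F t) m) := (contDiff_lowerOrder k hc hne m).continuous
  have h1 := (hF.slab_energy m).hasDerivAt_integral ht fun u =>
    ((hF.hasDerivAt_time_curvDev ht k m u).pow 2).mul (hF.hasDerivAt_speed ht u)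
  refine h1.congr_deriv ?_
  -- Integration by parts: the integrand is the derivative of `2 w_m w_{m+1}`, where `w_m = ∂ₛᵐ w`.
  -- Subtracting it trades `2 w_m w_{m+2}` for the dissipation `-2 w_{m+1}²`.
  have h2 : ∫ u in (0 : ℝ)..1, (2 * (curvDev k (F t) (m + 1) u * curvDev k (F t) (m + 1) u *
      ‖deriv (F t) u‖) + 2 * (curvDev k (F t) m u * curvDev k (F t) (m + 2) u *
      ‖deriv (F t) u‖)) = 0 := by
    refine integral_deriv_periodic (g := fun u => 2 * (curvDev k (F t) m u *
      curvDev k (F t) (m + 1) u)) (fun u => ?_) (by fun_prop) (fun u => ?_)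
    · refine (((hasDerivAt_curvDev k hc hne m u).mul
        (hasDerivAt_curvDev k hc hne (m + 1) u)).const_mul 2).congr_deriv ?_
      ring
    · simp only [periodic_curvDev k (hF.periodic t ht.le) _ u]
  have h3 : ∀ f g : ℝ → ℝ, Continuous f → Continuous g →
      ∫ u in (0 : ℝ)..1, f u = (∫ u in (0 : ℝ)..1, g u) + ∫ u in (0 : ℝ)..1, (f u - g u) :=
    fun f g hf hg => by
      rw [intervalIntegral.integral_sub (hf.intervalIntegrable _ _) (hg.intervalIntegrable _ _)]
      ring
  rw [h3 _ _ ?_ (show Continuous (fun u => 2 * (curvDev k (F t) (m + 1) u *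
    curvDev k (F t) (m + 1) u * ‖deriv (F t) u‖) + 2 * (curvDev k (F t) m u *
    curvDev k (F t) (m + 2) u * ‖deriv (F t) u‖)) by fun_prop), h2, zero_add, energy,
    ← intervalIntegral.integral_const_mul, ← intervalIntegral.integral_neg,
    ← intervalIntegral.integral_add (Continuous.intervalIntegrable (by fun_prop) _ _)
      (Continuous.intervalIntegrable (by fun_prop) _ _)]
  · refine intervalIntegral.integral_congr fun u _ => ?_
    simp only [Pi.pow_apply]
    push_cast
    ring
  · simp only [Pi.pow_apply]
    fun_prop

lemma sq_curvDev_le (m : ℕ) {t : ℝ} (ht : 0 ≤ t) (u : ℝ) :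
    curvDev (meanCurv F) (F t) m u ^ 2 ≤ length (F 0) * energy F (m + 1) t := by
  rw [← hF.length_eq hrot ht]
  exact sq_le_of_mean_zero (hasDerivAt_curvDev _ (hF.contDiff ht) (hF.immersed t ht) m)
    (hF.continuous_curvDev _ (m + 1) ht) (hF.continuous_speed ht) (hF.speed_pos ht)
    (periodic_curvDev _ (hF.periodic t ht) m) (hF.integral_curvDev hrot m ht) u

lemma pow_four_curvDev_le (m : ℕ) {t : ℝ} (ht : 0 ≤ t) (u : ℝ) :
    curvDev (meanCurv F) (F t) m u ^ 4 ≤ 4 * (energy F m t * energy F (m + 1) t) :=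
  pow_four_le_of_mean_zero (hasDerivAt_curvDev _ (hF.contDiff ht) (hF.immersed t ht) m)
    (hF.continuous_curvDev _ (m + 1) ht) (hF.continuous_speed ht) (hF.speed_pos ht)
    (periodic_curvDev _ (hF.periodic t ht) m) (hF.integral_curvDev hrot m ht) u

/-! ### The isoperimetric deficit -/

omit hrot in
lemma slab_support : SmoothSlab (fun t u => inner ℝ (F t u) (normal (F t) u) * ‖deriv (F t) u‖) :=
  (hF.slab.inner hF.slab_normal).mul hF.slab_speed

omit hrot in
lemma continuousOn_signedArea : ContinuousOn (fun t => signedArea (F t)) (Ici 0) :=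
  continuousOn_const.mul hF.slab_support.continuousOn_integral

/-- First variation `A' = -∫ V ds = λL - 2π`, which is `L E₀ / 2π` by `multiplier_eq`. -/
lemma hasDerivAt_signedArea {t : ℝ} (ht : 0 < t) :
    HasDerivAt (fun τ => signedArea (F τ)) (length (F 0) * energy F 0 t / (2 * Real.pi)) t := by
  have hne := hF.immersed t ht.le
  have hc := hF.contDiff ht.le
  have hκ := hF.continuous_curvature ht.le
  have hv := hF.continuous_speed ht.le
  have hV := hF.continuous_normalVel ht.le
  have hw := fun m => hF.continuous_curvDev 0 m ht.le
  have hT := hF.continuous_tangent ht.le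
  have hN := hF.continuous_normal ht.le
  have hFc := hc.continuous
  have hNt : ∀ u, HasDerivAt (fun τ => normal (F τ) u)
      (-(curvDev 0 (F t) 1 u) • tangent (F t) u) t := by
    intro u
    refine ((hF.hasDerivAt_time_tangent ht 0 u).const_mul Complex.I).congr_deriv ?_
    rw [normal, mul_smul_comm, ← mul_assoc, Complex.I_mul_I, neg_one_mul, smul_neg, neg_smul]
  have h1 := (hF.slab_support.hasDerivAt_integral ht fun u =>
    ((hF.hasDerivAt_flow ht u).inner ℝ (hNt u)).mul (hF.hasDerivAt_speed ht u)).const_mul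
    (-(1 / 2 : ℝ))
  refine h1.congr_deriv ?_
  -- The derivative of `V ⟨F, T⟩`; it removes the terms of the first variation that depend on the
  -- position `F`.
  have h2 : ∫ u in (0 : ℝ)..1, (‖deriv (F t) u‖ * curvDev 0 (F t) 1 u *
      inner ℝ (F t u) (tangent (F t) u) + normalVel (F t) u *
      (‖deriv (F t) u‖ + ‖deriv (F t) u‖ * curvature (F t) u *
        inner ℝ (F t u) (normal (F t) u))) = 0 := by
    refine integral_deriv_periodic (g := fun u => normalVel (F t) u *
      inner ℝ (F t u) (tangent (F t) u)) (fun u => ?_) (by fun_prop) (fun u => ?_)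
    · refine ((hF.hasDerivAt_normalVel ht 0 u).mul ((hasDerivAt_curve hc hne u).inner ℝ
        (hasDerivAt_tangent hc hne u))).congr_deriv ?_
      rw [inner_smul_left, inner_smul_right, real_inner_self_eq_norm_sq, norm_tangent hne]
      simp only [conj_trivial]
      ring
    · simp only [normalVel, periodic_curvature (hF.periodic t ht.le) u, hF.periodic t ht.le u,
        periodic_tangent (hF.periodic t ht.le) u]
  have h3 : ∫ u in (0 : ℝ)..1, normalVel (F t) u * ‖deriv (F t) u‖ =
      2 * Real.pi - multiplier (F t) * length (F t) := by
    simp only [normalVel, sub_mul]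
    rw [intervalIntegral.integral_sub (Continuous.intervalIntegrable (by fun_prop) _ _)
      (Continuous.intervalIntegrable (by fun_prop) _ _), intervalIntegral.integral_const_mul,
      hF.integral_curvature hrot ht.le, length]
  have h4 : ∫ u in (0 : ℝ)..1, ((inner ℝ (F t u) (-(curvDev 0 (F t) 1 u) • tangent (F t) u) +
      inner ℝ (normalVel (F t) u • normal (F t) u) (normal (F t) u)) * ‖deriv (F t) u‖ +
      inner ℝ (F t u) (normal (F t) u) *
        -(curvature (F t) u * normalVel (F t) u * ‖deriv (F t) u‖)) =
      2 * (2 * Real.pi - multiplier (F t) * length (F t)) := by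
    have h5 := congrArg (fun x => 2 * (∫ u in (0 : ℝ)..1, normalVel (F t) u *
      ‖deriv (F t) u‖) - x) h2
    simp only [sub_zero] at h5
    rw [← h3, ← h5, ← intervalIntegral.integral_const_mul,
      ← intervalIntegral.integral_sub (Continuous.intervalIntegrable (by fun_prop) _ _)
      (Continuous.intervalIntegrable (by fun_prop) _ _)]
    refine intervalIntegral.integral_congr fun u _ => ?_
    simp only [inner_smul_left, inner_smul_right, real_inner_self_eq_norm_sq, norm_normal hne,
      conj_trivial]
    ring
  rw [h4, hF.multiplier_eq hrot ht.le, ← hF.meanCurv_mul_length hrot ht.le,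
    hF.length_eq hrot ht.le]
  have := hF.length_pos le_rfl
  have := Real.pi_pos
  rw [meanCurv]
  field_simp
  ring

omit hrot in
lemma integral_speed_smul_normal {t : ℝ} (ht : 0 ≤ t) (c : ℂ) :
    ∫ u in (0 : ℝ)..1, inner ℝ c (normal (F t) u) * ‖deriv (F t) u‖ = 0 := by
  have hc := hF.contDiff ht
  have hne := hF.immersed t ht
  have hN := hF.continuous_normal ht
  have hv := hF.continuous_speed ht
  refine integral_deriv_periodic (g := fun u => inner ℝ c (Complex.I * F t u)) (fun u => ?_)
    (by fun_prop) (fun u => by simp only [hF.periodic t ht u])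
  refine ((hasDerivAt_const u c).inner ℝ ((hasDerivAt_curve hc hne u).const_mul
    Complex.I)).congr_deriv ?_
  rw [inner_zero_left, add_zero, mul_smul_comm, inner_smul_right, mul_comm, normal]

/-- Since `∫ ν ds = 0`, the origin may be moved to a point of the curve, and then the position has
norm at most `L`. This crude bound needs no isoperimetric inequality. -/
lemma signedArea_le {t : ℝ} (ht : 0 ≤ t) : signedArea (F t) ≤ length (F 0) ^ 2 / 2 := by
  have hc := hF.contDiff ht
  have hne := hF.immersed t ht
  have hN := hF.continuous_normal ht
  have hv := hF.continuous_speed ht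
  have hT := hF.continuous_tangent ht
  have hFc := hc.continuous
  have hosc : ∀ u, ‖F t u - F t 0‖ ≤ length (F 0) := by
    intro u
    have h1 := norm_sub_le_integral_of_periodic (hasDerivAt_curve hc hne) (by fun_prop)
      (hF.periodic t ht) u 0
    simp_rw [norm_smul, norm_norm, norm_tangent hne, mul_one] at h1
    rwa [← hF.length_eq hrot ht]
  have h2 : ∫ u in (0 : ℝ)..1, (-length (F 0)) * ‖deriv (F t) u‖ ≤
      ∫ u in (0 : ℝ)..1, (inner ℝ (F t u) (normal (F t) u) * ‖deriv (F t) u‖ -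
        inner ℝ (F t 0) (normal (F t) u) * ‖deriv (F t) u‖) := by
    refine intervalIntegral.integral_mono_on zero_le_one
      (Continuous.intervalIntegrable (by fun_prop) _ _)
      (Continuous.intervalIntegrable (by fun_prop) _ _) fun u _ => ?_
    rw [← sub_mul, ← inner_sub_left]
    refine mul_le_mul_of_nonneg_right ?_ (norm_nonneg _)
    have h3 := abs_real_inner_le_norm (F t u - F t 0) (normal (F t) u)
    rw [norm_normal hne, mul_one] at h3
    linarith [neg_abs_le (inner ℝ (F t u - F t 0) (normal (F t) u)), hosc u]
  rw [intervalIntegral.integral_sub (Continuous.intervalIntegrable (by fun_prop) _ _)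
    (Continuous.intervalIntegrable (by fun_prop) _ _), hF.integral_speed_smul_normal ht,
    sub_zero, intervalIntegral.integral_const_mul] at h2
  have h4 : ∫ u in (0 : ℝ)..1, ‖deriv (F t) u‖ = length (F 0) := hF.length_eq hrot ht
  rw [h4] at h2
  rw [signedArea, arcIntegral]
  nlinarith

/-- The isoperimetric deficit is controlled by the `L²` deviation of the curvature. -/
lemma abs_deficit_le {t : ℝ} (ht : 0 ≤ t) :
    |length (F 0) ^ 2 - 4 * Real.pi * signedArea (F t)| ≤
      length (F 0) ^ 3 / (2 * Real.pi) * energy F 0 t := by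
  have hne := hF.immersed t ht
  have hc := hF.contDiff ht
  set k := meanCurv F with hk
  have hk0 : 0 < k := hF.meanCurv_pos
  have hκ := hF.continuous_curvature ht
  have hv := hF.continuous_speed ht
  have hw := hF.continuous_curvDev k 0 ht
  have hT := hF.continuous_tangent ht
  have hN := hF.continuous_normal ht
  have hFc := hc.continuous
  have hper := hF.periodic t ht
  -- The approximate center of curvature: constant on a circle of radius `1/k`, and in general `∂ₛ P
  -- = -(w/k) T`, so its oscillation is at most `k⁻¹ ∫ |w| ds`.
  set P : ℝ → ℂ := fun u => F t u + k⁻¹ • normal (F t) u with hP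
  have hPd : ∀ u, HasDerivAt P (-(‖deriv (F t) u‖ * curvDev k (F t) 0 u / k) •
      tangent (F t) u) u := by
    intro u
    refine ((hasDerivAt_curve hc hne u).add
      ((hasDerivAt_normal hc hne u).const_smul k⁻¹)).congr_deriv ?_
    rw [smul_smul, ← add_smul]
    congr 1
    simp only [curvDev]
    field_simp
    ring
  have hPper : Function.Periodic P 1 := fun u => by
    simp only [hP, normal, hper u, periodic_tangent hper u]
  have hPc : Continuous P := by fun_prop
  set S := ∫ u in (0 : ℝ)..1, |curvDev k (F t) 0 u| * ‖deriv (F t) u‖ with hS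
  have hosc : ∀ u, ‖P u - P 0‖ ≤ k⁻¹ * S := by
    intro u
    have h1 := norm_sub_le_integral_of_periodic hPd (by fun_prop) hPper u 0
    refine h1.trans (le_of_eq ?_)
    rw [hS, ← intervalIntegral.integral_const_mul]
    refine intervalIntegral.integral_congr fun u _ => ?_
    simp only [norm_smul, norm_neg, norm_div, norm_mul, norm_tangent hne,
      Real.norm_eq_abs, abs_of_pos hk0, abs_norm]
    ring
  have hS2 : S ^ 2 ≤ length (F 0) * energy F 0 t := by
    have h1 := sq_integral_mul_le (continuous_const (y := (1 : ℝ))) hw.abs hv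
      fun u => norm_nonneg _
    simp only [one_pow, one_mul, sq_abs] at h1
    rw [← hF.length_eq hrot ht]
    exact h1
  -- As `w` has mean zero, this says `L - 2kA = ∫ w ⟨T, i(P - P(0))⟩ ds`. Subtracting `P(0)` leaves
  -- only the oscillation of `P`, which makes the right side quadratic in `w`.
  have hid : ∫ u in (0 : ℝ)..1, (‖deriv (F t) u‖ +
      k * (inner ℝ (F t u) (normal (F t) u) * ‖deriv (F t) u‖) -
      ‖deriv (F t) u‖ * curvDev k (F t) 0 u *
        inner ℝ (tangent (F t) u) (Complex.I * (P u - P 0)) -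
      k⁻¹ * (curvDev k (F t) 0 u * ‖deriv (F t) u‖)) = 0 := by
    refine integral_deriv_periodic (g := fun u => k * (inner ℝ (P u - P 0) (Complex.I * F t u) -
      inner ℝ (P u) (Complex.I * P 0) + inner ℝ (P 0) (Complex.I * F t u))) (fun u => ?_)
      (by fun_prop) (fun u => by simp only [hPper u, hper u])
    have hIF : HasDerivAt (fun u => Complex.I * F t u) (‖deriv (F t) u‖ • normal (F t) u) u :=
      ((hasDerivAt_curve hc hne u).const_mul Complex.I).congr_deriv (by
        rw [mul_smul_comm, normal])
    refine (((((hPd u).sub_const (P 0)).inner ℝ hIF).sub ((hPd u).inner ℝ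
      (hasDerivAt_const u (Complex.I * P 0)))).add
      ((hasDerivAt_const u (P 0)).inner ℝ hIF)).const_mul k |>.congr_deriv ?_
    have hT1 : (tangent (F t) u).re ^ 2 + (tangent (F t) u).im ^ 2 = 1 := by
      rw [sq, sq, ← Complex.normSq_apply, Complex.normSq_eq_norm_sq, norm_tangent hne, one_pow]
    have hFP : F t u = P u - k⁻¹ • normal (F t) u := by simp [hP]
    rw [hFP]
    simp only [inner_smul_left, inner_smul_right, conj_trivial, inner_zero_right, inner_zero_left]
    simp only [normal, Complex.inner, Complex.mul_re, Complex.mul_im, Complex.conj_re,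
      Complex.conj_im, Complex.I_re, Complex.I_im, Complex.sub_re, Complex.sub_im,
      Complex.smul_re, Complex.smul_im, smul_eq_mul]
    field_simp
    linear_combination (‖deriv (F t) u‖ * (k - curvDev k (F t) 0 u)) * hT1
  rw [intervalIntegral.integral_sub (Continuous.intervalIntegrable (by fun_prop) _ _)
      (Continuous.intervalIntegrable (by fun_prop) _ _),
    intervalIntegral.integral_sub (Continuous.intervalIntegrable (by fun_prop) _ _)
      (Continuous.intervalIntegrable (by fun_prop) _ _),
    intervalIntegral.integral_add (Continuous.intervalIntegrable (by fun_prop) _ _)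
      (Continuous.intervalIntegrable (by fun_prop) _ _),
    intervalIntegral.integral_const_mul, intervalIntegral.integral_const_mul,
    hF.integral_curvDev hrot 0 ht, mul_zero, sub_zero, sub_eq_zero] at hid
  have hbound : ‖∫ u in (0 : ℝ)..1, ‖deriv (F t) u‖ * curvDev k (F t) 0 u *
      inner ℝ (tangent (F t) u) (Complex.I * (P u - P 0))‖ ≤
      ∫ u in (0 : ℝ)..1, k⁻¹ * S * (|curvDev k (F t) 0 u| * ‖deriv (F t) u‖) := by
    refine intervalIntegral.norm_integral_le_of_norm_le zero_le_one
      (Eventually.of_forall fun u _ => ?_) (Continuous.intervalIntegrable (by fun_prop) _ _)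
    have h1 := norm_inner_le_norm (𝕜 := ℝ) (tangent (F t) u) (Complex.I * (P u - P 0))
    rw [norm_tangent hne, norm_I_mul, one_mul] at h1
    rw [norm_mul, norm_mul, norm_norm, Real.norm_eq_abs (curvDev k (F t) 0 u), mul_comm (k⁻¹ * S),
      mul_comm ‖deriv (F t) u‖]
    gcongr
    exact h1.trans (hosc u)
  rw [intervalIntegral.integral_const_mul, ← hid, ← hS, Real.norm_eq_abs] at hbound
  have hL : ∫ u in (0 : ℝ)..1, ‖deriv (F t) u‖ = length (F 0) := hF.length_eq hrot ht
  have hA : ∫ u in (0 : ℝ)..1, inner ℝ (F t u) (normal (F t) u) * ‖deriv (F t) u‖ =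
      -2 * signedArea (F t) := by
    rw [signedArea, arcIntegral]
    ring
  rw [hL, hA] at hbound
  have hL0 := hF.length_pos le_rfl
  have hpi := Real.pi_pos
  have h5 : length (F 0) ^ 2 - 4 * Real.pi * signedArea (F t) =
      length (F 0) * (length (F 0) + k * (-2 * signedArea (F t))) := by
    rw [hk, meanCurv]
    field_simp
    ring
  rw [h5, abs_mul, abs_of_pos hL0]
  calc length (F 0) * |length (F 0) + k * (-2 * signedArea (F t))|
      ≤ length (F 0) * (k⁻¹ * S * S) := by gcongr
    _ = length (F 0) * k⁻¹ * S ^ 2 := by ring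
    _ ≤ length (F 0) * k⁻¹ * (length (F 0) * energy F 0 t) := by gcongr
    _ = _ := by
      rw [hk, meanCurv]
      field_simp

end IsGlobalSolution

/-! ### Polynomial structure of the lower order terms -/

/-- Polynomials in the first `m` derivatives of the curvature deviation, with coefficients that
are bounded functions of time. -/
inductive PolyDev (k₀ : ℝ) (F : ℝ → ℝ → ℂ) (m : ℕ) : (ℝ → ℝ → ℝ) → Prop
  | coeff (c : ℝ → ℝ) (M : ℝ) (hc : ∀ t, 0 < t → |c t| ≤ M) : PolyDev k₀ F m (fun t _ => c t)
  | dev (j : ℕ) (hj : j < m) : PolyDev k₀ F m (fun t u => curvDev k₀ (F t) j u)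
  | add {G H : ℝ → ℝ → ℝ} : PolyDev k₀ F m G → PolyDev k₀ F m H →
      PolyDev k₀ F m (fun t u => G t u + H t u)
  | mul {G H : ℝ → ℝ → ℝ} : PolyDev k₀ F m G → PolyDev k₀ F m H →
      PolyDev k₀ F m (fun t u => G t u * H t u)

/-- Linear combinations of the derivatives of order at most `m` of the curvature deviation, with
coefficients in `PolyDev k₀ F m`. -/
inductive LinDev (k₀ : ℝ) (F : ℝ → ℝ → ℂ) (m : ℕ) : (ℝ → ℝ → ℝ) → Prop
  | term {G : ℝ → ℝ → ℝ} (j : ℕ) (hj : j ≤ m) : PolyDev k₀ F m G →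
      LinDev k₀ F m (fun t u => G t u * curvDev k₀ (F t) j u)
  | add {G H : ℝ → ℝ → ℝ} : LinDev k₀ F m G → LinDev k₀ F m H →
      LinDev k₀ F m (fun t u => G t u + H t u)

section PolyDev

variable {k₀ : ℝ} {F : ℝ → ℝ → ℂ} {m : ℕ} {G H : ℝ → ℝ → ℝ}

lemma PolyDev.const (c : ℝ) : PolyDev k₀ F m (fun _ _ => c) :=
  .coeff (fun _ => c) |c| fun _ _ => le_rfl

lemma PolyDev.succ (hG : PolyDev k₀ F m G) : PolyDev k₀ F (m + 1) G := by
  induction hG with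
  | coeff c M hc => exact .coeff c M hc
  | dev j hj => exact .dev j (by omega)
  | add _ _ h1 h2 => exact .add h1 h2
  | mul _ _ h1 h2 => exact .mul h1 h2

lemma LinDev.polyDev (hG : LinDev k₀ F m G) : PolyDev k₀ F (m + 1) G := by
  induction hG with
  | term j hj h => exact .mul h.succ (.dev j (by omega))
  | add _ _ h1 h2 => exact .add h1 h2

lemma LinDev.mul (hG : LinDev k₀ F m G) (hH : PolyDev k₀ F m H) :
    LinDev k₀ F m (fun t u => H t u * G t u) := by
  induction hG with
  | term j hj h =>
    simp_rw [← mul_assoc]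
    exact .term j hj (.mul hH h)
  | add _ _ h1 h2 =>
    simp_rw [mul_add]
    exact .add h1 h2

/-- The constants `C` and `N` do not depend on time; all growth is carried by the sup bound `X` of
the derivatives of order below `m`. -/
lemma PolyDev.exists_bound (hG : PolyDev k₀ F m G) :
    ∃ C : ℝ, 0 ≤ C ∧ ∃ N : ℕ, ∀ t, 0 < t → ∀ X : ℝ, 0 ≤ X →
      (∀ j < m, ∀ u, |curvDev k₀ (F t) j u| ≤ X) → ∀ u, |G t u| ≤ C * (1 + X) ^ N := by
  induction hG with
  | coeff c M hc =>
    refine ⟨|M|, abs_nonneg _, 0, fun t ht X hX _ u => ?_⟩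
    rw [pow_zero, mul_one]
    exact (hc t ht).trans (le_abs_self M)
  | dev j hj =>
    refine ⟨1, zero_le_one, 1, fun t ht X hX h u => ?_⟩
    linarith [h j hj u]
  | add _ _ h1 h2 =>
    obtain ⟨C₁, hC₁, N₁, h1⟩ := h1
    obtain ⟨C₂, hC₂, N₂, h2⟩ := h2
    refine ⟨C₁ + C₂, by positivity, N₁ + N₂, fun t ht X hX h u => (abs_add_le _ _).trans ?_⟩
    have e1 : (1 + X) ^ N₁ ≤ (1 + X) ^ (N₁ + N₂) := pow_le_pow_right₀ (by linarith) (by omega)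
    have e2 : (1 + X) ^ N₂ ≤ (1 + X) ^ (N₁ + N₂) := pow_le_pow_right₀ (by linarith) (by omega)
    rw [add_mul]
    exact add_le_add ((h1 t ht X hX h u).trans (by gcongr)) ((h2 t ht X hX h u).trans (by gcongr))
  | mul _ _ h1 h2 =>
    obtain ⟨C₁, hC₁, N₁, h1⟩ := h1
    obtain ⟨C₂, hC₂, N₂, h2⟩ := h2
    refine ⟨C₁ * C₂, by positivity, N₁ + N₂, fun t ht X hX h u => ?_⟩
    rw [abs_mul, pow_add, mul_mul_mul_comm]
    exact mul_le_mul (h1 t ht X hX h u) (h2 t ht X hX h u) (abs_nonneg _) (by positivity)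

lemma LinDev.exists_bound (hG : LinDev k₀ F m G) :
    ∃ C : ℝ, 0 ≤ C ∧ ∃ N : ℕ, ∀ t, 0 < t → ∀ X : ℝ, 0 ≤ X →
      (∀ j < m, ∀ u, |curvDev k₀ (F t) j u| ≤ X) → ∀ u,
        |G t u| ≤ C * (1 + X) ^ N * ∑ j ∈ Finset.range (m + 1), |curvDev k₀ (F t) j u| := by
  induction hG with
  | term j hj h =>
    obtain ⟨C, hC, N, h⟩ := h.exists_bound
    refine ⟨C, hC, N, fun t ht X hX hX' u => ?_⟩
    rw [abs_mul]
    refine mul_le_mul (h t ht X hX hX' u) ?_ (abs_nonneg _) (by positivity)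
    exact Finset.single_le_sum (f := fun j => |curvDev k₀ (F t) j u|) (fun _ _ => abs_nonneg _)
      (Finset.mem_range.2 (by omega))
  | add _ _ h1 h2 =>
    obtain ⟨C₁, hC₁, N₁, h1⟩ := h1
    obtain ⟨C₂, hC₂, N₂, h2⟩ := h2
    refine ⟨C₁ + C₂, by positivity, N₁ + N₂, fun t ht X hX h u => (abs_add_le _ _).trans ?_⟩
    have e1 : (1 + X) ^ N₁ ≤ (1 + X) ^ (N₁ + N₂) := pow_le_pow_right₀ (by linarith) (by omega)
    have e2 : (1 + X) ^ N₂ ≤ (1 + X) ^ (N₁ + N₂) := pow_le_pow_right₀ (by linarith) (by omega)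
    have e3 : 0 ≤ ∑ j ∈ Finset.range (m + 1), |curvDev k₀ (F t) j u| :=
      Finset.sum_nonneg fun _ _ => abs_nonneg _
    rw [add_mul, add_mul]
    exact add_le_add ((h1 t ht X hX h u).trans (by gcongr)) ((h2 t ht X hX h u).trans (by gcongr))

variable (hF : IsGlobalSolution F)

include hF

/-- Differentiation in space kills the terms that depend on time only, so every surviving term has a
factor `∂ₛʲ w` with `j ≤ m`: a polynomial becomes a linear form. -/
lemma PolyDev.exists_hasDerivAt (hG : PolyDev k₀ F m G) :
    ∃ G', LinDev k₀ F m G' ∧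
      ∀ t, 0 < t → ∀ u, HasDerivAt (G t) (‖deriv (F t) u‖ * G' t u) u := by
  induction hG with
  | coeff c M hc =>
    refine ⟨_, .term 0 (Nat.zero_le _) (.const 0), fun t ht u => ?_⟩
    simpa using hasDerivAt_const u (c t)
  | dev j hj =>
    refine ⟨_, .term (j + 1) hj (.const 1), fun t ht u => ?_⟩
    rw [one_mul]
    exact hasDerivAt_curvDev k₀ (hF.contDiff ht.le) (hF.immersed t ht.le) j u
  | add _ _ h1 h2 =>
    obtain ⟨G', hG', h1⟩ := h1
    obtain ⟨H', hH', h2⟩ := h2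
    refine ⟨_, .add hG' hH', fun t ht u => ?_⟩
    exact ((h1 t ht u).add (h2 t ht u)).congr_deriv (by ring)
  | mul hG hH h1 h2 =>
    obtain ⟨G', hG', h1⟩ := h1
    obtain ⟨H', hH', h2⟩ := h2
    refine ⟨_, .add (hG'.mul hH) (hH'.mul hG), fun t ht u => ?_⟩
    exact ((h1 t ht u).mul (h2 t ht u)).congr_deriv (by ring)

lemma LinDev.exists_hasDerivAt (hG : LinDev k₀ F m G) :
    ∃ G', LinDev k₀ F (m + 1) G' ∧
      ∀ t, 0 < t → ∀ u, HasDerivAt (G t) (‖deriv (F t) u‖ * G' t u) u := by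
  induction hG with
  | term j hj h =>
    obtain ⟨G', hG', h1⟩ := h.exists_hasDerivAt hF
    refine ⟨_, .add (.term j (by omega) hG'.polyDev) (.term (j + 1) (by omega) h.succ),
      fun t ht u => ?_⟩
    exact ((h1 t ht u).mul (hasDerivAt_curvDev k₀ (hF.contDiff ht.le) (hF.immersed t ht.le)
      j u)).congr_deriv (by ring)
  | add _ _ h1 h2 =>
    obtain ⟨G', hG', h1⟩ := h1
    obtain ⟨H', hH', h2⟩ := h2
    refine ⟨_, .add hG' hH', fun t ht u => ?_⟩
    exact ((h1 t ht u).add (h2 t ht u)).congr_deriv (by ring)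

end PolyDev

/-! ### Decay of the energies -/

/-- The isoperimetric deficit `L² - 4πA`. -/
def deficit (F : ℝ → ℝ → ℂ) (t : ℝ) : ℝ := length (F 0) ^ 2 - 4 * Real.pi * signedArea (F t)

lemma antitoneOn_Ici_of_hasDerivAt {g g' : ℝ → ℝ} {a : ℝ} (hc : ContinuousOn g (Ici a))
    (hd : ∀ t, a < t → HasDerivAt g (g' t) t) (hle : ∀ t, a < t → g' t ≤ 0) :
    AntitoneOn g (Ici a) := by
  refine antitoneOn_of_deriv_nonpos (convex_Ici a) hc (fun x hx => ?_) (fun x hx => ?_)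
  · rw [interior_Ici] at hx
    exact (hd x hx).differentiableAt.differentiableWithinAt
  · rw [interior_Ici] at hx
    rw [(hd x hx).deriv]
    exact hle x hx

/-- The reaction integrand of `E₀` with `κ = w + k` and `V = w - μ`. Cubic terms are split by
Young's inequality and one factor `w²` of the quartic ones is replaced by `S`. The term `-2k²μ w` is
kept exactly, because it integrates to zero. -/
lemma reaction_le {k J μ S w : ℝ} (hk0 : 0 < k) (hJ0 : 0 ≤ J) (hμ0 : 0 ≤ μ) (hμJ : μ ≤ J)
    (hs : w ^ 2 ≤ S) :
    2 * w * ((w + k) ^ 2 * (w - μ)) - (w + k) * (w - μ) * w ^ 2 ≤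
      ((1 + 3 * k + 2 * k ^ 2) * (1 + J) * S + (1 + 3 * k + 2 * k ^ 2) * (1 + J)) * w ^ 2 -
        2 * k ^ 2 * μ * w := by
  have h3 : w ^ 3 ≤ (w ^ 4 + w ^ 2) / 2 := by nlinarith [sq_nonneg (w ^ 2 - w)]
  have h3' : -w ^ 3 ≤ (w ^ 4 + w ^ 2) / 2 := by nlinarith [sq_nonneg (w ^ 2 + w)]
  have h4 : (3 * k - μ) * w ^ 3 ≤ (3 * k + μ) * ((w ^ 4 + w ^ 2) / 2) := by
    linarith [mul_le_mul_of_nonneg_left h3 (by positivity : 0 ≤ 3 * k),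
      mul_le_mul_of_nonneg_left h3' hμ0]
  have h5 : w ^ 4 ≤ S * w ^ 2 := by linarith [mul_le_mul_of_nonneg_right hs (sq_nonneg w)]
  have h6 : 0 ≤ k * μ * w ^ 2 := by positivity
  have hkJ : 0 ≤ k * J := by positivity
  have hkJ' : 0 ≤ k ^ 2 * J := by positivity
  have h7 : 1 + (3 * k + μ) / 2 ≤ (1 + 3 * k + 2 * k ^ 2) * (1 + J) := by
    linarith [sq_nonneg k]
  have h8 : (3 * k + μ) / 2 + 2 * k ^ 2 ≤ (1 + 3 * k + 2 * k ^ 2) * (1 + J) := by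
    linarith [sq_nonneg k]
  have h9 : (1 + (3 * k + μ) / 2) * w ^ 4 ≤ (1 + 3 * k + 2 * k ^ 2) * (1 + J) * (S * w ^ 2) :=
    mul_le_mul h7 h5 (by positivity) (by positivity)
  have h10 := mul_le_mul_of_nonneg_right h8 (sq_nonneg w)
  linarith

/-- Young's inequality on `√J₁` costs one copy of `J₁`, half of the available dissipation `2J₁`; the
rest is polynomial in `J` with a factor `J`. -/
lemma absorb_le {A J J₁ : ℝ} (hA0 : 0 ≤ A) (hJ0 : 0 ≤ J) (hJ₁0 : 0 ≤ J₁) :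
    (A * (1 + J) * (2 * (Real.sqrt J * Real.sqrt J₁)) + A * (1 + J)) * J ≤
      J₁ + (A ^ 2 + A) * (1 + J) ^ 4 * J := by
  have hJ1 : 1 ≤ (1 + J) ^ 3 := one_le_pow₀ (by linarith)
  have h1 : A * (1 + J) * (2 * (Real.sqrt J * Real.sqrt J₁)) * J ≤
      J₁ + A ^ 2 * ((1 + J) ^ 2 * J ^ 2) * J := by
    have h := two_mul_le_add_sq (A * (1 + J) * J * Real.sqrt J) (Real.sqrt J₁)
    rw [mul_pow _ (Real.sqrt J), Real.sq_sqrt hJ0, Real.sq_sqrt hJ₁0] at h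
    linarith
  have h2 : A * (1 + J) ≤ A * (1 + J) ^ 4 := by
    have e : (1 + J) ^ 4 = (1 + J) * (1 + J) ^ 3 := by ring
    have := mul_le_mul_of_nonneg_left hJ1 (by linarith : 0 ≤ 1 + J)
    rw [e]
    gcongr
    linarith
  have h3 : (1 + J) ^ 2 * J ^ 2 ≤ (1 + J) ^ 4 := by
    have e : (1 + J) ^ 4 = (1 + J) ^ 2 * (1 + J) ^ 2 := by ring
    rw [e]
    gcongr
    linarith
  have h4 := mul_le_mul_of_nonneg_right h2 hJ0
  have h5 := mul_le_mul_of_nonneg_right (mul_le_mul_of_nonneg_left h3 (sq_nonneg A)) hJ0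
  linarith

namespace IsGlobalSolution

variable {F : ℝ → ℝ → ℂ} (hF : IsGlobalSolution F)

include hF

lemma continuousOn_deficit : ContinuousOn (deficit F) (Ici 0) :=
  continuousOn_const.sub (continuousOn_const.mul hF.continuousOn_signedArea)

variable (hrot : rotationNumber (F 0) = 1)

include hrot

lemma hasDerivAt_deficit {t : ℝ} (ht : 0 < t) :
    HasDerivAt (deficit F) (-(2 * length (F 0) * energy F 0 t)) t := by
  refine (((hF.hasDerivAt_signedArea hrot ht).const_mul (4 * Real.pi)).const_sub
    (length (F 0) ^ 2)).congr_deriv ?_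
  have := Real.pi_pos
  field_simp
  ring

lemma deficit_nonneg {t₁ : ℝ} (ht₁ : 0 ≤ t₁) : 0 ≤ deficit F t₁ := by
  by_contra! hneg
  have hL := hF.length_pos le_rfl
  have hpi := Real.pi_pos
  set c := length (F 0) ^ 3 / (2 * Real.pi) with hc
  have hc0 : 0 < c := by positivity
  have hanti : AntitoneOn (deficit F) (Ici 0) :=
    antitoneOn_Ici_of_hasDerivAt hF.continuousOn_deficit (fun t => hF.hasDerivAt_deficit hrot)
      fun t ht => by
        have := hF.energy_nonneg 0 ht.le
        rw [neg_nonpos]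
        positivity
  -- After `t₁` the deficit stays below its negative value there, so `abs_deficit_le` bounds `E₀`
  -- below and `D` falls at least at rate `b`.
  set b := 2 * length (F 0) * (-deficit F t₁ / c) with hb
  have hb0 : 0 < b := mul_pos (by positivity) (div_pos (by linarith) hc0)
  have hanti2 : AntitoneOn (fun t => deficit F t + b * t) (Ici t₁) := by
    refine antitoneOn_Ici_of_hasDerivAt
      ((hF.continuousOn_deficit.mono (Ici_subset_Ici.2 ht₁)).add (by fun_prop))
      (fun t ht => (hF.hasDerivAt_deficit hrot (ht₁.trans_lt ht)).add
        ((hasDerivAt_id t).const_mul b)) fun t ht => ?_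
    have ht0 : 0 ≤ t := (ht₁.trans_lt ht).le
    have h1 := hanti ht₁ ht0 ht.le
    have h2 := hF.abs_deficit_le hrot ht0
    have h3 : -deficit F t₁ / c ≤ energy F 0 t := by
      rw [div_le_iff₀ hc0]
      have := neg_le_abs (deficit F t)
      change |deficit F t| ≤ c * energy F 0 t at h2
      linarith
    rw [hb]
    nlinarith [mul_le_mul_of_nonneg_left h3 (by positivity : 0 ≤ 2 * length (F 0))]
  -- By this time `D` has fallen by `2πL²`, below the value `L² - 2πL²` allowed by `A ≤ L²/2`.
  set t := t₁ + 2 * Real.pi * length (F 0) ^ 2 / b with ht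
  have htt : t₁ ≤ t := by
    rw [ht]
    have : 0 < 2 * Real.pi * length (F 0) ^ 2 / b := by positivity
    linarith
  have h1 := hanti2 (self_mem_Ici) htt htt
  have h2 := hF.signedArea_le hrot (ht₁.trans htt)
  have h3 : b * t = b * t₁ + 2 * Real.pi * length (F 0) ^ 2 := by
    rw [ht]
    field_simp
  simp only [h3] at h1
  have h4 : deficit F t = length (F 0) ^ 2 - 4 * Real.pi * signedArea (F t) := rfl
  nlinarith [mul_le_mul_of_nonneg_left h2 hpi.le, sq_pos_of_pos hL]

/-- `D' = -2L E₀ ≤ -(2L/c) D` by the reverse isoperimetric inequality, so `D e^{bt}` is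
nonincreasing. -/
lemma expDecay_deficit : ExpDecayFrom 0 (deficit F) := by
  have hL := hF.length_pos le_rfl
  have hpi := Real.pi_pos
  set c := length (F 0) ^ 3 / (2 * Real.pi) with hc
  have hc0 : 0 < c := by positivity
  set b := 2 * length (F 0) / c with hb
  have hanti : AntitoneOn (fun t => deficit F t * Real.exp (b * t)) (Ici 0) := by
    refine antitoneOn_Ici_of_hasDerivAt (hF.continuousOn_deficit.mul (by fun_prop))
      (fun t ht => (hF.hasDerivAt_deficit hrot ht).mul
        (((hasDerivAt_id t).const_mul b).exp)) fun t ht => ?_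
    have h2 := (le_abs_self _).trans (hF.abs_deficit_le hrot ht.le)
    rw [← hc] at h2
    have h3 : b * deficit F t ≤ 2 * length (F 0) * energy F 0 t := by
      rw [hb, div_mul_eq_mul_div, div_le_iff₀ hc0, deficit]
      nlinarith
    have h4 := Real.exp_pos (b * t)
    simp only [id, mul_one]
    nlinarith [mul_le_mul_of_nonneg_left h3 h4.le]
  refine (ExpDecayFrom.of_exp (hF.deficit_nonneg hrot le_rfl)
    (show 0 < b by positivity)).mono fun t ht => ?_
  have h1 := hanti self_mem_Ici ht ht
  simp only [mul_zero, Real.exp_zero, mul_one] at h1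
  rw [neg_mul, Real.exp_neg, ← div_eq_mul_inv, le_div_iff₀ (Real.exp_pos _)]
  exact h1

/-- The window integral of `2L E₀` is the drop of `D`, hence at most `D(t)`. -/
lemma expDecay_window_energy_zero :
    ExpDecayFrom 0 (fun t => ∫ τ in t..t + 1, energy F 0 τ) := by
  have hL := hF.length_pos le_rfl
  refine ((hF.expDecay_deficit hrot).const_mul
    (c := (2 * length (F 0))⁻¹) (by positivity)).mono fun t ht => ?_
  have hsub : Icc t (t + 1) ⊆ Ici 0 := Icc_subset_Ici_self.trans (Ici_subset_Ici.2 ht)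
  have h1 : ∫ τ in t..t + 1, -(2 * length (F 0) * energy F 0 τ) =
      deficit F (t + 1) - deficit F t := by
    refine intervalIntegral.integral_eq_sub_of_hasDerivAt_of_le (by linarith)
      (hF.continuousOn_deficit.mono hsub)
      (fun x hx => hF.hasDerivAt_deficit hrot (ht.trans_lt hx.1)) ?_
    refine ContinuousOn.intervalIntegrable ?_
    rw [uIcc_of_le (by linarith)]
    exact (continuousOn_const.mul ((hF.continuousOn_energy 0).mono hsub)).neg
  rw [intervalIntegral.integral_neg, intervalIntegral.integral_const_mul] at h1
  rw [inv_mul_eq_div, le_div_iff₀ (by positivity)]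
  linarith [hF.deficit_nonneg hrot (by linarith : 0 ≤ t + 1)]

lemma energy_zero_step :
    ExpDecayFrom 0 (energy F 0) ∧ ExpDecayFrom 0 (fun t => ∫ τ in t..t + 1, energy F 1 τ) := by
  set k := meanCurv F with hk
  have hk0 : 0 < k := hF.meanCurv_pos
  have hpi := Real.pi_gt_three
  set A := 1 + 3 * k + 2 * k ^ 2 with hA
  have hA0 : 0 < A := by positivity
  refine expDecay_of_window (hF.continuousOn_energy 0) (hF.continuousOn_energy 1)
    (fun t => hF.energy_nonneg 0) (fun t => hF.energy_nonneg 1) (fun t => hF.hasDerivAt_energy 0)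
    (C := A ^ 2 + A) (K := 0) (lam := 1) (N := 4) (by positivity) le_rfl one_pos
    (fun t ht => ?_) (hF.expDecay_window_energy_zero hrot)
  have hv := hF.continuous_speed ht.le
  have hw := hF.continuous_curvDev k 0 ht.le
  have hκ := hF.continuous_curvature ht.le
  have hV := hF.continuous_normalVel ht.le
  set J := energy F 0 t with hJ
  set J₁ := energy F 1 t with hJ₁
  have hJ0 : 0 ≤ J := hF.energy_nonneg 0 ht.le
  have hJ₁0 : 0 ≤ J₁ := hF.energy_nonneg 1 ht.le
  set μ := J / (2 * Real.pi) with hμ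
  have hμ0 : 0 ≤ μ := by positivity
  have hμJ : μ ≤ J := div_le_self hJ0 (by linarith)
  set S := 2 * (Real.sqrt J * Real.sqrt J₁) with hS
  have hwS : ∀ u, curvDev k (F t) 0 u ^ 2 ≤ S := by
    intro u
    refine le_of_sq_le_sq ?_ (by positivity)
    have h1 := hF.pow_four_curvDev_le hrot 0 ht.le u
    rw [hS, mul_pow, mul_pow, Real.sq_sqrt hJ0, Real.sq_sqrt hJ₁0]
    calc (curvDev k (F t) 0 u ^ 2) ^ 2 = curvDev k (F t) 0 u ^ 4 := by ring
      _ ≤ _ := h1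
      _ = _ := by norm_num [hJ, hJ₁]
  have hint : ∫ u in (0 : ℝ)..1, (2 * curvDev k (F t) 0 u * lowerOrder k (F t) 0 u -
      curvature (F t) u * normalVel (F t) u * curvDev k (F t) 0 u ^ 2) * ‖deriv (F t) u‖ ≤
      ∫ u in (0 : ℝ)..1, ((A * (1 + J) * S + A * (1 + J)) * (curvDev k (F t) 0 u ^ 2 *
        ‖deriv (F t) u‖) - 2 * k ^ 2 * μ * (curvDev k (F t) 0 u * ‖deriv (F t) u‖)) := by
    refine intervalIntegral.integral_mono_on zero_le_one
      (Continuous.intervalIntegrable (by simp only [lowerOrder]; fun_prop) _ _)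
      (Continuous.intervalIntegrable (by fun_prop) _ _) fun u _ => ?_
    have e1 : curvature (F t) u = curvDev k (F t) 0 u + k := by simp only [curvDev]; ring
    have e2 : normalVel (F t) u = curvDev k (F t) 0 u - μ := hF.normalVel_eq hrot ht.le u
    simp only [lowerOrder]
    rw [e1, e2]
    have hs := hwS u
    set w := curvDev k (F t) 0 u with hwdef
    have key := reaction_le hk0 hJ0 hμ0 hμJ hs
    rw [← hA] at key
    calc _ = (2 * w * ((w + k) ^ 2 * (w - μ)) - (w + k) * (w - μ) * w ^ 2) * ‖deriv (F t) u‖ := rfl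
      _ ≤ ((A * (1 + J) * S + A * (1 + J)) * w ^ 2 - 2 * k ^ 2 * μ * w) * ‖deriv (F t) u‖ := by
        gcongr
      _ = _ := by ring
  -- The term linear in `w` disappears because `w` has mean zero.
  rw [intervalIntegral.integral_sub (Continuous.intervalIntegrable (by fun_prop) _ _)
    (Continuous.intervalIntegrable (by fun_prop) _ _), intervalIntegral.integral_const_mul,
    intervalIntegral.integral_const_mul, hF.integral_curvDev hrot 0 ht.le, mul_zero,
    sub_zero] at hint
  have hJdef : ∫ u in (0 : ℝ)..1, curvDev k (F t) 0 u ^ 2 * ‖deriv (F t) u‖ = J := rfl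
  rw [hJdef] at hint
  have hfin := absorb_le hA0.le hJ0 hJ₁0
  rw [← hS] at hfin
  rw [zero_mul, add_zero]
  linarith

omit hrot in
-- At order zero `κ² V` contains a term depending on time only, through the multiplier. One
-- differentiation removes it, so the linear structure is available from order `m + 1` on and
-- survives each further step of the recursion.
lemma exists_linDev_lowerOrder (k₀ : ℝ)
    (hV : ∃ (c : ℝ → ℝ) (M : ℝ), (∀ t, 0 < t → |c t| ≤ M) ∧
      ∀ t, 0 < t → ∀ u, normalVel (F t) u = curvDev k₀ (F t) 0 u + c t) (m : ℕ) :
    (∃ H, PolyDev k₀ F (m + 1) H ∧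
      ∀ t, 0 < t → ∀ u, curvature (F t) u * normalVel (F t) u = H t u) ∧
    ∃ Q, LinDev k₀ F (m + 1) Q ∧
      ∀ t, 0 < t → ∀ u, lowerOrder k₀ (F t) (m + 1) u = Q t u := by
  obtain ⟨c, M, hc, hV⟩ := hV
  have hκp : ∀ m, PolyDev k₀ F (m + 1) (fun t u => curvDev k₀ (F t) 0 u + k₀) := fun m =>
    .add (.dev 0 (by omega)) (.const k₀)
  have hVp : ∀ m, PolyDev k₀ F (m + 1) (fun t u => curvDev k₀ (F t) 0 u + c t) := fun m =>
    .add (.dev 0 (by omega)) (.coeff c M hc)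
  have hκ : ∀ t u, curvature (F t) u = curvDev k₀ (F t) 0 u + k₀ := fun t u => by
    simp only [curvDev]
    ring
  have hκV : ∀ t, 0 < t → ∀ u, curvature (F t) u * normalVel (F t) u =
      (curvDev k₀ (F t) 0 u + k₀) * (curvDev k₀ (F t) 0 u + c t) := fun t ht u => by
    rw [hV t ht u, hκ]
  have main : ∀ {m : ℕ} {G G' : ℝ → ℝ → ℝ}, LinDev k₀ F (m + 1) G' →
      (∀ t, 0 < t → ∀ u, lowerOrder k₀ (F t) m u = G t u) →
      (∀ t, 0 < t → ∀ u, HasDerivAt (G t) (‖deriv (F t) u‖ * G' t u) u) →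
      ∃ Q, LinDev k₀ F (m + 1) Q ∧
        ∀ t, 0 < t → ∀ u, lowerOrder k₀ (F t) (m + 1) u = Q t u := by
    intro m G G' hG' hG hd
    refine ⟨_, .add hG' (.term (m + 1) le_rfl (.mul (hκp m) (hVp m))), fun t ht u => ?_⟩
    have h1 : lowerOrder k₀ (F t) m = G t := funext (hG t ht)
    simp only [lowerOrder]
    rw [h1, (hd t ht u).deriv, inv_mul_cancel_left₀ (hF.speed_pos ht.le u).ne', hκV t ht u]
  refine ⟨⟨_, .mul (hκp m) (hVp m), hκV⟩, ?_⟩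
  induction m with
  | zero =>
    obtain ⟨G', hG', hd⟩ := (PolyDev.mul (hκp 0) (.mul (hκp 0) (hVp 0))).exists_hasDerivAt hF
    refine main hG' (fun t ht u => ?_) hd
    simp only [lowerOrder]
    rw [sq, mul_assoc, hκV t ht u, hκ]
  | succ m ih =>
    obtain ⟨Q, hQ, h⟩ := ih
    obtain ⟨G', hG', hd⟩ := hQ.exists_hasDerivAt hF
    exact main hG' h hd

/-- The coefficients of the reaction term involve derivatives of order at most `m` only, whose sup
norms are controlled by energies up to `E_{m+1}` itself. So the growth is polynomial in `y =
E_{m+1}` and nothing has to be absorbed into `E_{m+2}`. -/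
lemma energy_succ_step (m : ℕ) (hE : ∀ j ≤ m, ExpDecayFrom 0 (energy F j))
    (hW : ExpDecayFrom 0 (fun t => ∫ τ in t..t + 1, energy F (m + 1) τ)) :
    ExpDecayFrom 0 (energy F (m + 1)) ∧
      ExpDecayFrom 0 (fun t => ∫ τ in t..t + 1, energy F (m + 2) τ) := by
  set k := meanCurv F with hk
  have hpi := Real.pi_gt_three
  have hL := hF.length_pos le_rfl
  obtain ⟨K, hK, lam, hlam, he⟩ := ExpDecayFrom.sum (Finset.range (m + 1))
    (fun j hj => hE j (by have := Finset.mem_range.1 hj; omega))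
  obtain ⟨M, hM, hMle⟩ := (hE 0 (Nat.zero_le _)).exists_bound
  obtain ⟨⟨H, hH, hHeq⟩, Q, hQ, hQeq⟩ := hF.exists_linDev_lowerOrder k
    ⟨fun t => -(energy F 0 t / (2 * Real.pi)), M, fun t ht => by
      rw [abs_neg, abs_of_nonneg (div_nonneg (hF.energy_nonneg 0 ht.le) (by linarith))]
      exact (div_le_self (hF.energy_nonneg 0 ht.le) (by linarith)).trans (hMle t ht.le),
      fun t ht u => hF.normalVel_eq hrot ht.le u⟩ m
  obtain ⟨C₁, hC₁, N₁, hHb⟩ := hH.exists_bound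
  obtain ⟨C₂, hC₂, N₂, hQb⟩ := hQ.exists_bound
  set B := 2 + length (F 0) * K + length (F 0) with hB
  refine expDecay_of_window (hF.continuousOn_energy _) (hF.continuousOn_energy _)
    (fun t => hF.energy_nonneg _) (fun t => hF.energy_nonneg _)
    (fun t => hF.hasDerivAt_energy (m + 1))
    (C := (m + 4) * (C₁ + C₂) * B ^ (N₁ + N₂)) (K := K) (lam := lam) (N := N₁ + N₂)
    (by positivity) hK.le hlam (fun t ht => ?_) hW
  have hv := hF.continuous_speed ht.le
  have hw := fun j => hF.continuous_curvDev k j ht.le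
  have hκ := hF.continuous_curvature ht.le
  have hV := hF.continuous_normalVel ht.le
  have hQc : Continuous (lowerOrder k (F t) (m + 1)) :=
    (contDiff_lowerOrder k (hF.contDiff ht.le) (hF.immersed t ht.le) (m + 1)).continuous
  set y := energy F (m + 1) t with hy
  have hy0 : 0 ≤ y := hF.energy_nonneg _ ht.le
  have hexp : Real.exp (-lam * t) ≤ 1 := Real.exp_le_one_iff.2 (by nlinarith)
  have hEj : ∀ j ≤ m + 1, energy F j t ≤ K + y := by
    intro j hj
    rcases hj.lt_or_eq with hj | rfl
    · have h1 := Finset.single_le_sum (f := fun j => energy F j t)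
        (fun j _ => hF.energy_nonneg j ht.le) (Finset.mem_range.2 hj)
      have h2 := he t ht.le
      nlinarith
    · linarith
  -- From `w_j² ≤ L E_{j+1} ≤ L(K + y)` and `|a| ≤ 1 + a²`.
  set X := 1 + length (F 0) * (K + y) with hX
  have hX0 : 0 ≤ X := by positivity
  have hXle : ∀ j < m + 1, ∀ u, |curvDev k (F t) j u| ≤ X := by
    intro j hj u
    have h1 := hF.sq_curvDev_le hrot j ht.le u
    have h2 := hEj (j + 1) hj
    have h3 := mul_le_mul_of_nonneg_left h2 hL.le
    rw [hX]
    nlinarith [sq_nonneg (|curvDev k (F t) j u| - 1), sq_abs (curvDev k (F t) j u),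
      abs_nonneg (curvDev k (F t) j u)]
  have hXB : 1 + X ≤ B * (1 + y) := by
    rw [hX, hB]
    nlinarith [mul_nonneg hL.le hy0, mul_nonneg (mul_nonneg hL.le hK.le) hy0]
  set D := (C₁ + C₂) * (1 + X) ^ (N₁ + N₂) with hD
  have hD0 : 0 ≤ D := by positivity
  have hpt : ∀ u, 2 * curvDev k (F t) (m + 1) u * lowerOrder k (F t) (m + 1) u -
      curvature (F t) u * normalVel (F t) u * curvDev k (F t) (m + 1) u ^ 2 ≤
      (m + 4) * D * ∑ j ∈ Finset.range (m + 2), curvDev k (F t) j u ^ 2 := by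
    intro u
    have h1 : |lowerOrder k (F t) (m + 1) u| ≤
        D * ∑ j ∈ Finset.range (m + 2), |curvDev k (F t) j u| := by
      rw [hQeq t ht u]
      refine (hQb t ht X hX0 hXle u).trans ?_
      have e3 : 0 ≤ ∑ j ∈ Finset.range (m + 2), |curvDev k (F t) j u| :=
        Finset.sum_nonneg fun _ _ => abs_nonneg _
      refine mul_le_mul_of_nonneg_right ?_ e3
      exact mul_le_mul (by linarith) (pow_le_pow_right₀ (by linarith) (by omega))
        (by positivity) (by positivity)
    have h2 : |curvature (F t) u * normalVel (F t) u| ≤ D := by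
      rw [hHeq t ht u]
      refine (hHb t ht X hX0 hXle u).trans ?_
      exact mul_le_mul (by linarith) (pow_le_pow_right₀ (by linarith) (by omega))
        (by positivity) (by positivity)
    set w := curvDev k (F t) (m + 1) u with hwdef
    set s := ∑ j ∈ Finset.range (m + 2), curvDev k (F t) j u ^ 2 with hs
    have hws : w ^ 2 ≤ s := Finset.single_le_sum (f := fun j => curvDev k (F t) j u ^ 2)
      (fun _ _ => sq_nonneg _) (Finset.mem_range.2 (by omega : m + 1 < m + 2))
    -- Young's inequality gives `m + 2` copies of `w²`, each at most `s`, plus `s` itself.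
    have h3 : 2 * |w| * ∑ j ∈ Finset.range (m + 2), |curvDev k (F t) j u| ≤ (m + 3) * s := by
      rw [Finset.mul_sum]
      have h4 : ∑ j ∈ Finset.range (m + 2), 2 * |w| * |curvDev k (F t) j u| ≤
          ∑ j ∈ Finset.range (m + 2), (w ^ 2 + curvDev k (F t) j u ^ 2) := by
        refine Finset.sum_le_sum fun j _ => ?_
        nlinarith [sq_nonneg (|w| - |curvDev k (F t) j u|), sq_abs w, sq_abs (curvDev k (F t) j u)]
      rw [Finset.sum_add_distrib, Finset.sum_const, Finset.card_range, nsmul_eq_mul, ← hs] at h4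
      push_cast at h4
      nlinarith [mul_le_mul_of_nonneg_left hws (by positivity : (0 : ℝ) ≤ m + 2)]
    have h5 : 2 * w * lowerOrder k (F t) (m + 1) u ≤ D * ((m + 3) * s) := by
      calc 2 * w * lowerOrder k (F t) (m + 1) u
          ≤ |2 * w * lowerOrder k (F t) (m + 1) u| := le_abs_self _
        _ = 2 * |w| * |lowerOrder k (F t) (m + 1) u| := by
          rw [abs_mul, abs_mul, abs_two]
        _ ≤ 2 * |w| * (D * ∑ j ∈ Finset.range (m + 2), |curvDev k (F t) j u|) := by gcongr
        _ = D * (2 * |w| * ∑ j ∈ Finset.range (m + 2), |curvDev k (F t) j u|) := by ring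
        _ ≤ _ := by gcongr
    have h6 : -(curvature (F t) u * normalVel (F t) u * w ^ 2) ≤ D * s := by
      have := (neg_le_abs _).trans h2
      nlinarith [mul_le_mul_of_nonneg_right this (sq_nonneg w),
        mul_le_mul_of_nonneg_left hws hD0]
    linarith
  have hint : ∫ u in (0 : ℝ)..1, (2 * curvDev k (F t) (m + 1) u * lowerOrder k (F t) (m + 1) u -
      curvature (F t) u * normalVel (F t) u * curvDev k (F t) (m + 1) u ^ 2) * ‖deriv (F t) u‖ ≤
      ∫ u in (0 : ℝ)..1, (m + 4) * D * ∑ j ∈ Finset.range (m + 2),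
        curvDev k (F t) j u ^ 2 * ‖deriv (F t) u‖ := by
    refine intervalIntegral.integral_mono_on zero_le_one
      (Continuous.intervalIntegrable (by fun_prop) _ _)
      (Continuous.intervalIntegrable (by fun_prop) _ _) fun u _ => ?_
    rw [← Finset.sum_mul, ← mul_assoc]
    exact mul_le_mul_of_nonneg_right (hpt u) (norm_nonneg _)
  rw [intervalIntegral.integral_const_mul, intervalIntegral.integral_finsetSum
    (fun j _ => Continuous.intervalIntegrable (by fun_prop) _ _)] at hint
  have hsum : ∑ j ∈ Finset.range (m + 2), ∫ u in (0 : ℝ)..1,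
      curvDev k (F t) j u ^ 2 * ‖deriv (F t) u‖ ≤ y + K * Real.exp (-lam * t) := by
    rw [Finset.sum_range_succ, add_comm]
    exact add_le_add le_rfl (he t ht.le)
  have hDB : D ≤ (C₁ + C₂) * (B ^ (N₁ + N₂) * (1 + y) ^ (N₁ + N₂)) := by
    rw [hD, ← mul_pow]
    gcongr
  have hz := hF.energy_nonneg (m + 2) ht.le
  have hfin : (m + 4) * D * ∑ j ∈ Finset.range (m + 2), ∫ u in (0 : ℝ)..1,
      curvDev k (F t) j u ^ 2 * ‖deriv (F t) u‖ ≤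
      (m + 4) * (C₁ + C₂) * B ^ (N₁ + N₂) * (1 + y) ^ (N₁ + N₂) *
        (y + K * Real.exp (-lam * t)) := by
    calc _ ≤ (m + 4) * D * (y + K * Real.exp (-lam * t)) := by gcongr
      _ ≤ (m + 4) * ((C₁ + C₂) * (B ^ (N₁ + N₂) * (1 + y) ^ (N₁ + N₂))) *
          (y + K * Real.exp (-lam * t)) := by gcongr
      _ = _ := by ring
  linarith

/-- The induction must also carry the window bound on the next energy. -/
lemma expDecay_energy (m : ℕ) : ExpDecayFrom 0 (energy F m) := by
  suffices h : ∀ m, (∀ j ≤ m, ExpDecayFrom 0 (energy F j)) ∧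
      ExpDecayFrom 0 (fun t => ∫ τ in t..t + 1, energy F (m + 1) τ) from (h m).1 m le_rfl
  intro m
  induction m with
  | zero =>
    have h := hF.energy_zero_step hrot
    exact ⟨fun j hj => by rw [Nat.le_zero.1 hj]; exact h.1, h.2⟩
  | succ m ih =>
    have h := hF.energy_succ_step hrot m ih.1 ih.2
    refine ⟨fun j hj => ?_, h.2⟩
    rcases hj.lt_or_eq with hj | rfl
    · exact ih.1 j (by omega)
    · exact h.1

/-- All arc length derivatives of the curvature deviation decay exponentially, uniformly on the
curve. -/
lemma exists_curvDev_bound (m : ℕ) : ∃ C > 0, ∃ lam > 0, ∀ t, 0 ≤ t → ∀ u,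
    |curvDev (meanCurv F) (F t) m u| ≤ C * Real.exp (-lam * t) := by
  obtain ⟨C, hC, lam, hlam, h⟩ := ((hF.expDecay_energy hrot (m + 1)).const_mul
    (hF.length_pos le_rfl).le).sqrt
  exact ⟨C, hC, lam, hlam, fun t ht u =>
    (Real.abs_le_sqrt (hF.sq_curvDev_le hrot m ht u)).trans (h t ht)⟩

end IsGlobalSolution

/-! ### Arc length parametrization -/

section ArcLength

variable {γ : ℝ → ℂ} (hγ : ContDiff ℝ ∞ γ) (hne : ∀ u, deriv γ u ≠ 0)
  (hper : Function.Periodic γ 1) (u₀ : ℝ)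

/-- The inverse of the arc length function. -/
def arcInv (γ : ℝ → ℂ) (u₀ : ℝ) : ℝ → ℝ := Function.invFun (arcLength γ u₀)

lemma length_pos_of_immersed {γ : ℝ → ℂ} (hγ : ContDiff ℝ ∞ γ) (hne : ∀ u, deriv γ u ≠ 0) :
    0 < length γ :=
  intervalIntegral.intervalIntegral_pos_of_pos
    ((contDiff_speed hγ hne).continuous.intervalIntegrable 0 1)
    (fun u => norm_pos_iff.2 (hne u)) one_pos

include hγ hne

lemma hasDerivAt_arcLength (u : ℝ) : HasDerivAt (arcLength γ u₀) ‖deriv γ u‖ u :=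
  intervalIntegral.integral_hasDerivAt_right
    ((contDiff_speed hγ hne).continuous.intervalIntegrable _ _)
    ((contDiff_speed hγ hne).continuous.stronglyMeasurableAtFilter _ _)
    (contDiff_speed hγ hne).continuous.continuousAt

lemma strictMono_arcLength : StrictMono (arcLength γ u₀) :=
  strictMono_of_deriv_pos fun u => by
    rw [(hasDerivAt_arcLength hγ hne u₀ u).deriv]
    exact norm_pos_iff.2 (hne u)

lemma continuous_arcLength : Continuous (arcLength γ u₀) :=
  continuous_iff_continuousAt.2 fun u => (hasDerivAt_arcLength hγ hne u₀ u).continuousAt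

include hper

lemma arcLength_add_one (u : ℝ) : arcLength γ u₀ (u + 1) = arcLength γ u₀ u + length γ := by
  have hv := (contDiff_speed hγ hne).continuous
  rw [arcLength, arcLength, length, ← intervalIntegral.integral_add_adjacent_intervals
    (hv.intervalIntegrable u₀ u) (hv.intervalIntegrable u (u + 1)),
    (periodic_speed hper).intervalIntegral_add_eq u 0, zero_add]

lemma arcLength_add_nat (n : ℕ) (u : ℝ) :
    arcLength γ u₀ (u + n) = arcLength γ u₀ u + n * length γ := by
  induction n with
  | zero => simp
  | succ n ih =>
    push_cast
    rw [← add_assoc, arcLength_add_one hγ hne hper, ih]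
    ring

lemma surjective_arcLength : Function.Surjective (arcLength γ u₀) := by
  have hL := length_pos_of_immersed hγ hne
  have h0 : arcLength γ u₀ u₀ = 0 := by simp [arcLength]
  intro s
  obtain ⟨n, hn⟩ := exists_nat_ge (|s| / length γ)
  rw [div_le_iff₀ hL] at hn
  have h1 := arcLength_add_nat hγ hne hper u₀ n u₀
  have h2 := arcLength_add_nat hγ hne hper u₀ n (u₀ - n)
  rw [sub_add_cancel, h0] at h2
  rw [h0] at h1
  exact mem_range_of_exists_le_of_exists_ge (continuous_arcLength hγ hne u₀)
    ⟨u₀ - n, by linarith [neg_abs_le s]⟩ ⟨u₀ + n, by linarith [le_abs_self s]⟩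

lemma arcLength_arcInv (s : ℝ) : arcLength γ u₀ (arcInv γ u₀ s) = s :=
  Function.rightInverse_invFun (surjective_arcLength hγ hne hper u₀) s

omit hper in
lemma arcInv_arcLength (u : ℝ) : arcInv γ u₀ (arcLength γ u₀ u) = u :=
  Function.leftInverse_invFun (strictMono_arcLength hγ hne u₀).injective u

omit hper in
lemma arcInv_zero : arcInv γ u₀ 0 = u₀ := by
  have h0 : arcLength γ u₀ u₀ = 0 := by simp [arcLength]
  rw [← h0, arcInv_arcLength hγ hne]

lemma arcInv_add_length (s : ℝ) : arcInv γ u₀ (s + length γ) = arcInv γ u₀ s + 1 := by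
  apply (strictMono_arcLength hγ hne u₀).injective
  rw [arcLength_arcInv hγ hne hper, arcLength_add_one hγ hne hper, arcLength_arcInv hγ hne hper]

lemma continuous_arcInv : Continuous (arcInv γ u₀) := by
  refine Monotone.continuous_of_surjective (fun a b hab => ?_)
    fun u => ⟨_, arcInv_arcLength hγ hne u₀ u⟩
  rw [← (strictMono_arcLength hγ hne u₀).le_iff_le, arcLength_arcInv hγ hne hper,
    arcLength_arcInv hγ hne hper]
  exact hab

lemma hasDerivAt_arcInv (s : ℝ) :
    HasDerivAt (arcInv γ u₀) ‖deriv γ (arcInv γ u₀ s)‖⁻¹ s :=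
  HasDerivAt.of_local_left_inverse (continuous_arcInv hγ hne hper u₀).continuousAt
    (hasDerivAt_arcLength hγ hne u₀ _) (norm_ne_zero_iff.2 (hne _))
    (Eventually.of_forall fun x => arcLength_arcInv hγ hne hper u₀ x)

/-- Bootstrapping: the derivative is a smooth function of `arcInv` itself, so each order of
regularity yields the next. -/
lemma contDiff_arcInv : ContDiff ℝ ∞ (arcInv γ u₀) := by
  rw [contDiff_infty]
  intro n
  induction n with
  | zero => exact contDiff_zero.2 (continuous_arcInv hγ hne hper u₀)
  | succ n ih =>
    have h : deriv (arcInv γ u₀) = fun s => ‖deriv γ (arcInv γ u₀ s)‖⁻¹ :=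
      funext fun s => (hasDerivAt_arcInv hγ hne hper u₀ s).deriv
    push_cast
    rw [contDiff_succ_iff_deriv]
    refine ⟨fun s => (hasDerivAt_arcInv hγ hne hper u₀ s).differentiableAt, by simp, ?_⟩
    rw [h]
    exact (((contDiff_speed hγ hne).inv fun u => norm_ne_zero_iff.2 (hne u)).of_le
      (by exact_mod_cast le_top)).comp ih

/-- Derivatives with respect to arc length. -/
lemma hasDerivAt_comp_arcInv {E : Type*} [NormedAddCommGroup E] [NormedSpace ℝ E] {g : ℝ → E}
    {g' : E} {s : ℝ} (hg : HasDerivAt g (‖deriv γ (arcInv γ u₀ s)‖ • g') (arcInv γ u₀ s)) :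
    HasDerivAt (fun s => g (arcInv γ u₀ s)) g' s := by
  refine (hg.scomp s (hasDerivAt_arcInv hγ hne hper u₀ s)).congr_deriv ?_
  rw [inv_smul_smul₀ (norm_ne_zero_iff.2 (hne _))]

end ArcLength

/-- A closed plane curve `f` of length `L` parametrized by arc length, with unit tangent `T`,
signed curvature `κ` and rotation number one. -/
structure IsUnitSpeedLoop (L : ℝ) (f T : ℝ → ℂ) (κ : ℝ → ℝ) : Prop where
  length_pos : 0 < L
  hasDerivAt : ∀ s, HasDerivAt f (T s) s
  hasDerivAt_tangent : ∀ s, HasDerivAt T (κ s • (Complex.I * T s)) s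
  norm_tangent : ∀ s, ‖T s‖ = 1
  periodic : Function.Periodic f L
  periodic_tangent : Function.Periodic T L
  periodic_curvature : Function.Periodic κ L
  continuous_curvature : Continuous κ
  integral_curvature : ∫ s in (0 : ℝ)..L, κ s = 2 * Real.pi

lemma isUnitSpeedLoop_arcParam {γ : ℝ → ℂ} (hγ : ContDiff ℝ ∞ γ) (hne : ∀ u, deriv γ u ≠ 0)
    (hper : Function.Periodic γ 1) (u₀ : ℝ)
    (hrot : ∫ u in (0 : ℝ)..1, curvature γ u * ‖deriv γ u‖ = 2 * Real.pi) :
    IsUnitSpeedLoop (length γ) (arcParam γ u₀) (fun s => tangent γ (arcInv γ u₀ s))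
      (fun s => curvature γ (arcInv γ u₀ s)) where
  length_pos := length_pos_of_immersed hγ hne
  hasDerivAt s := hasDerivAt_comp_arcInv hγ hne hper u₀ (hasDerivAt_curve hγ hne _)
  hasDerivAt_tangent s := hasDerivAt_comp_arcInv hγ hne hper u₀ (by
    rw [smul_smul]
    exact hasDerivAt_tangent hγ hne _)
  norm_tangent s := norm_tangent hne _
  periodic s := by
    have h := arcInv_add_length hγ hne hper u₀ s
    rw [arcInv] at h
    rw [arcParam, arcParam, h, hper]
  periodic_tangent s := by
    simp only [arcInv_add_length hγ hne hper u₀ s, periodic_tangent hper _]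
  periodic_curvature s := by
    simp only [arcInv_add_length hγ hne hper u₀ s, periodic_curvature hper _]
  continuous_curvature :=
    (contDiff_curvature hγ hne).continuous.comp (continuous_arcInv hγ hne hper u₀)
  integral_curvature := by
    have hκ := (contDiff_curvature hγ hne).continuous
    have hv := (contDiff_speed hγ hne).continuous
    have hU := continuous_arcInv hγ hne hper u₀
    have h1 : ∫ u in u₀..u₀ + 1, ‖deriv γ u‖ •
        ((fun s => curvature γ (arcInv γ u₀ s)) ∘ arcLength γ u₀) u =
        ∫ s in arcLength γ u₀ u₀..arcLength γ u₀ (u₀ + 1), curvature γ (arcInv γ u₀ s) :=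
      intervalIntegral.integral_deriv_smul_comp
        (fun u _ => hasDerivAt_arcLength hγ hne u₀ u) hv.continuousOn (hκ.comp hU)
    have h0 : arcLength γ u₀ u₀ = 0 := by simp [arcLength]
    rw [arcLength_add_one hγ hne hper, h0, zero_add] at h1
    rw [← h1, ← hrot]
    have hp : Function.Periodic (fun u => curvature γ u * ‖deriv γ u‖) 1 := fun u => by
      simp only [periodic_curvature hper u, periodic_speed hper u]
    have h2 := hp.intervalIntegral_add_eq u₀ 0
    rw [zero_add] at h2
    rw [← h2]
    refine intervalIntegral.integral_congr fun u _ => ?_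
    simp only [Function.comp, arcInv_arcLength hγ hne, smul_eq_mul, mul_comm]

/-! ### Curves of almost constant curvature -/

lemma hasDerivAt_exp_I_mul (k s : ℝ) : HasDerivAt (fun s : ℝ => Complex.exp (Complex.I * (k * s : ℝ)))
    ((k : ℂ) * Complex.I * Complex.exp (Complex.I * (k * s : ℝ))) s := by
  have h1 : HasDerivAt (fun s : ℝ => ((k * s : ℝ) : ℂ)) ((k * 1 : ℝ) : ℂ) s :=
    ((hasDerivAt_id s).const_mul k).ofReal_comp
  refine ((h1.const_mul Complex.I).cexp).congr_deriv ?_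
  push_cast
  ring

lemma norm_exp_I_mul (x : ℝ) : ‖Complex.exp (Complex.I * (x : ℝ))‖ = 1 := by
  rw [mul_comm, Complex.norm_exp_ofReal_mul_I]

lemma exp_I_mul_periodic {k L : ℝ} (hkL : k * L = 2 * Real.pi) (s : ℝ) :
    Complex.exp (Complex.I * (k * (s + L) : ℝ)) = Complex.exp (Complex.I * (k * s : ℝ)) := by
  have h : Complex.I * (k * (s + L) : ℝ) = Complex.I * (k * s : ℝ) + 2 * Real.pi * Complex.I := by
    rw [mul_add, hkL]
    push_cast
    ring
  rw [h, Complex.exp_add, Complex.exp_two_pi_mul_I, mul_one]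

lemma integral_exp_I_mul {k L : ℝ} (hk : k ≠ 0) (hkL : k * L = 2 * Real.pi) :
    ∫ s in (0 : ℝ)..L, Complex.exp (Complex.I * (k * s : ℝ)) = 0 := by
  have hkc : (k : ℂ) * Complex.I ≠ 0 := mul_ne_zero (by exact_mod_cast hk) Complex.I_ne_zero
  have h1 : ∀ s : ℝ, HasDerivAt
      (fun s : ℝ => ((k : ℂ) * Complex.I)⁻¹ * Complex.exp (Complex.I * (k * s : ℝ)))
      (Complex.exp (Complex.I * (k * s : ℝ))) s := fun s =>
    ((hasDerivAt_exp_I_mul k s).const_mul _).congr_deriv (inv_mul_cancel_left₀ hkc _)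
  rw [intervalIntegral.integral_eq_sub_of_hasDerivAt (fun s _ => h1 s)
    (Continuous.intervalIntegrable (by fun_prop) _ _), sub_eq_zero]
  congr 1
  simpa using exp_I_mul_periodic hkL 0

namespace IsUnitSpeedLoop

variable {L : ℝ} {f T : ℝ → ℂ} {κ : ℝ → ℝ} (h : IsUnitSpeedLoop L f T κ) {k ε : ℝ}

include h

lemma continuous : Continuous f :=
  continuous_iff_continuousAt.2 fun s => (h.hasDerivAt s).continuousAt

lemma continuous_tangent : Continuous T :=
  continuous_iff_continuousAt.2 fun s => (h.hasDerivAt_tangent s).continuousAt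

variable (hk : 0 < k) (hkL : k * L = 2 * Real.pi) (hε : ∀ s, |κ s - k| ≤ ε)

include hk hkL hε

omit hk in
-- `T e^{-iks}` has derivative `i(κ - k) T e^{-iks}`, of norm at most `ε`; periodicity reduces to
-- one period.
lemma norm_tangent_sub_le (s : ℝ) :
    ‖T s - T 0 * Complex.exp (Complex.I * (k * s : ℝ))‖ ≤ ε * L := by
  have hε0 : 0 ≤ ε := (abs_nonneg _).trans (hε 0)
  have hper : Function.Periodic
      (fun s : ℝ => T s - T 0 * Complex.exp (Complex.I * (k * s : ℝ))) L := fun s => by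
    simp only [h.periodic_tangent s, exp_I_mul_periodic hkL s]
  obtain ⟨x, hx, hxs⟩ := hper.exists_mem_Ico₀ h.length_pos s
  rw [hxs]
  have hQ : ∀ s ∈ univ, HasDerivWithinAt
      (fun s : ℝ => T s * Complex.exp (Complex.I * (-k * s : ℝ)))
      ((κ s - k : ℝ) * (Complex.I * (T s * Complex.exp (Complex.I * (-k * s : ℝ))))) univ s := by
    intro s _
    refine (((h.hasDerivAt_tangent s).mul
      (hasDerivAt_exp_I_mul (-k) s)).congr_deriv ?_).hasDerivWithinAt
    rw [Complex.real_smul]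
    push_cast
    ring
  have h1 := convex_univ.norm_image_sub_le_of_norm_hasDerivWithin_le hQ (C := ε) (fun s _ => by
    rw [norm_mul, Complex.norm_real, norm_I_mul, norm_mul, h.norm_tangent, norm_exp_I_mul, mul_one,
      mul_one]
    exact hε s) (mem_univ 0) (mem_univ x)
  have h2 : T x - T 0 * Complex.exp (Complex.I * (k * x : ℝ)) =
      (T x * Complex.exp (Complex.I * (-k * x : ℝ)) -
        T 0 * Complex.exp (Complex.I * (-k * 0 : ℝ))) * Complex.exp (Complex.I * (k * x : ℝ)) := by
    have e : Complex.exp (Complex.I * (-k * x : ℝ)) * Complex.exp (Complex.I * (k * x : ℝ)) = 1 := by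
      rw [← Complex.exp_add, ← Complex.exp_zero]
      congr 1
      push_cast
      ring
    rw [sub_mul, mul_assoc, e]
    simp
  rw [h2, norm_mul, norm_exp_I_mul, mul_one]
  refine h1.trans ?_
  rw [sub_zero, Real.norm_of_nonneg hx.1]
  exact mul_le_mul_of_nonneg_left hx.2.le hε0

/-- A curve of almost constant curvature is close to a circle. -/
lemma norm_sub_circle_le (s : ℝ) :
    ‖f s - (f 0 + (k : ℂ)⁻¹ * (Complex.I * T 0) -
      (k : ℂ)⁻¹ * (Complex.I * T 0) * Complex.exp (Complex.I * (k * s : ℝ)))‖ ≤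
      2 * ε * L / k := by
  have hε0 : 0 ≤ ε := (abs_nonneg _).trans (hε 0)
  have hkc : (k : ℂ) ≠ 0 := by exact_mod_cast hk.ne'
  have hper : Function.Periodic (fun s : ℝ => f s + (k : ℂ)⁻¹ * (Complex.I * T s)) L := fun s => by
    simp only [h.periodic s, h.periodic_tangent s]
  -- The center `f + k⁻¹ iT` moves with velocity `-k⁻¹(κ - k) T`, so it is constant up to `εL/k`.
  have hP : ∀ s ∈ univ, HasDerivWithinAt
      (fun s : ℝ => f s + (k : ℂ)⁻¹ * (Complex.I * T s))
      (-((k : ℂ)⁻¹ * ((κ s - k : ℝ) * T s))) univ s := by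
    intro s _
    refine ((h.hasDerivAt s).add (((h.hasDerivAt_tangent s).const_mul
      Complex.I).const_mul _)).congr_deriv ?_ |>.hasDerivWithinAt
    rw [Complex.real_smul]
    push_cast
    field_simp
    linear_combination (κ s : ℂ) * T s * Complex.I_sq
  have h1 : ‖(f s + (k : ℂ)⁻¹ * (Complex.I * T s)) - (f 0 + (k : ℂ)⁻¹ * (Complex.I * T 0))‖ ≤
      ε / k * L := by
    obtain ⟨x, hx, hxs⟩ := hper.exists_mem_Ico₀ h.length_pos s
    rw [hxs]
    refine (convex_univ.norm_image_sub_le_of_norm_hasDerivWithin_le hP (C := ε / k) (fun s _ => by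
      rw [norm_neg, norm_mul, norm_mul, Complex.norm_real, h.norm_tangent, mul_one, norm_inv,
        Complex.norm_real, Real.norm_of_nonneg hk.le, inv_mul_eq_div]
      exact div_le_div_of_nonneg_right (hε s) hk.le) (mem_univ 0) (mem_univ x)).trans ?_
    rw [sub_zero, Real.norm_of_nonneg hx.1]
    exact mul_le_mul_of_nonneg_left hx.2.le (by positivity)
  have h2 := h.norm_tangent_sub_le hkL hε s
  have h3 : f s - (f 0 + (k : ℂ)⁻¹ * (Complex.I * T 0) -
      (k : ℂ)⁻¹ * (Complex.I * T 0) * Complex.exp (Complex.I * (k * s : ℝ))) =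
      ((f s + (k : ℂ)⁻¹ * (Complex.I * T s)) - (f 0 + (k : ℂ)⁻¹ * (Complex.I * T 0))) -
      (k : ℂ)⁻¹ * (Complex.I * (T s - T 0 * Complex.exp (Complex.I * (k * s : ℝ)))) := by ring
  rw [h3]
  refine (norm_sub_le _ _).trans ?_
  rw [norm_mul, norm_I_mul, norm_inv, Complex.norm_real, Real.norm_of_nonneg hk.le]
  have h4 : k⁻¹ * ‖T s - T 0 * Complex.exp (Complex.I * (k * s : ℝ))‖ ≤ k⁻¹ * (ε * L) := by
    gcongr
  calc _ ≤ ε / k * L + k⁻¹ * (ε * L) := add_le_add h1 h4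
    _ = _ := by
      field_simp
      ring

/-- The mean of the curve against a character. -/
lemma norm_integral_sub_le (q : ℝ) (c : ℂ)
    (hc : ∫ s in (0 : ℝ)..L, (f 0 + (k : ℂ)⁻¹ * (Complex.I * T 0) -
      (k : ℂ)⁻¹ * (Complex.I * T 0) * Complex.exp (Complex.I * (k * s : ℝ))) *
        Complex.exp (Complex.I * (q * s : ℝ)) = c) :
    ‖(∫ s in (0 : ℝ)..L, f s * Complex.exp (Complex.I * (q * s : ℝ))) - c‖ ≤
      2 * ε * L / k * L := by
  have hf := h.continuous
  rw [← hc, ← intervalIntegral.integral_sub (Continuous.intervalIntegrable (by fun_prop) _ _)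
    (Continuous.intervalIntegrable (by fun_prop) _ _)]
  refine (intervalIntegral.norm_integral_le_of_norm_le_const (C := 2 * ε * L / k)
    fun s _ => ?_).trans (by rw [sub_zero, abs_of_pos h.length_pos])
  rw [← sub_mul, norm_mul, norm_exp_I_mul, mul_one]
  exact h.norm_sub_circle_le hk hkL hε s

end IsUnitSpeedLoop

/-! ### Fourier center and first Fourier mode of an almost circular loop -/

lemma fourierBasis_zero (L s : ℝ) : fourierBasis L 0 s = (Real.sqrt L : ℂ)⁻¹ := by
  simp [fourierBasis]

lemma conj_fourierBasis_one {k L : ℝ} (hL : L ≠ 0) (hkL : k * L = 2 * Real.pi) (s : ℝ) :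
    (starRingEnd ℂ) (fourierBasis L 1 s) =
      (Real.sqrt L : ℂ)⁻¹ * Complex.exp (Complex.I * (-k * s : ℝ)) := by
  have hk : k = 2 * Real.pi / L := by
    rw [← hkL]
    field_simp
  rw [fourierBasis, map_mul, map_inv₀, Complex.conj_ofReal, ← Complex.exp_conj]
  congr 2
  simp only [map_div₀, map_mul, Complex.conj_ofReal, Complex.conj_I, map_ofNat, hk, Int.cast_one,
    map_one]
  push_cast
  ring

section Fourier

variable {γ : ℝ → ℂ} {u₀ L k ε : ℝ} {T : ℝ → ℂ} {κ : ℝ → ℝ}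
  (h : IsUnitSpeedLoop L (arcParam γ u₀) T κ) (hlen : length γ = L) (hk : 0 < k)
  (hkL : k * L = 2 * Real.pi) (hε : ∀ s, |κ s - k| ≤ ε)

include h hlen hk hkL hε

lemma norm_center_sub_le :
    ‖center γ u₀ - (arcParam γ u₀ 0 + (k : ℂ)⁻¹ * (Complex.I * T 0))‖ ≤ 2 * ε * L / k := by
  have hL := h.length_pos
  have hs : (Real.sqrt L : ℂ)⁻¹ * (Real.sqrt L : ℂ)⁻¹ = (L : ℂ)⁻¹ := by
    rw [← mul_inv, ← Complex.ofReal_mul, Real.mul_self_sqrt hL.le]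
  have hLc : (L : ℂ) ≠ 0 := by exact_mod_cast hL.ne'
  have h1 := h.norm_integral_sub_le hk hkL hε 0
    (L * (arcParam γ u₀ 0 + (k : ℂ)⁻¹ * (Complex.I * T 0))) (by
      simp only [zero_mul, Complex.ofReal_zero, mul_zero, Complex.exp_zero, mul_one]
      rw [intervalIntegral.integral_sub (Continuous.intervalIntegrable (by fun_prop) _ _)
        (Continuous.intervalIntegrable (by fun_prop) _ _), intervalIntegral.integral_const_mul,
        integral_exp_I_mul hk.ne' hkL]
      simp only [intervalIntegral.integral_const, sub_zero, mul_zero, Complex.real_smul])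
  simp only [zero_mul, Complex.ofReal_zero, mul_zero, Complex.exp_zero, mul_one] at h1
  have h2 : center γ u₀ = (L : ℂ)⁻¹ * ∫ s in (0 : ℝ)..L, arcParam γ u₀ s := by
    rw [center, fourierHat, hlen]
    simp only [fourierBasis_zero, map_inv₀, Complex.conj_ofReal]
    rw [intervalIntegral.integral_mul_const, mul_comm _ (Real.sqrt L : ℂ)⁻¹, ← mul_assoc, hs]
  have h3 : center γ u₀ - (arcParam γ u₀ 0 + (k : ℂ)⁻¹ * (Complex.I * T 0)) =
      (L : ℂ)⁻¹ * ((∫ s in (0 : ℝ)..L, arcParam γ u₀ s) -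
        L * (arcParam γ u₀ 0 + (k : ℂ)⁻¹ * (Complex.I * T 0))) := by
    rw [h2, mul_sub, inv_mul_cancel_left₀ hLc]
  rw [h3, norm_mul, norm_inv, Complex.norm_real, Real.norm_of_nonneg hL.le, inv_mul_le_iff₀ hL,
    mul_comm L]
  exact h1

/-- The approximating circle has first mode exactly `-k⁻¹ iT(0)`, since its constant part integrates
to zero against `e^{-iks}`. -/
lemma norm_fourierHat_one_sub_le {z : ℂ} (hz : fourierHat γ u₀ 1 = (Real.sqrt L : ℂ) * z) :
    ‖z + (k : ℂ)⁻¹ * (Complex.I * T 0)‖ ≤ 2 * ε * L / k := by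
  have hL := h.length_pos
  have hLc : (L : ℂ) ≠ 0 := by exact_mod_cast hL.ne'
  have hsq : (Real.sqrt L : ℂ) * (Real.sqrt L : ℂ) = (L : ℂ) := by
    rw [← Complex.ofReal_mul, Real.mul_self_sqrt hL.le]
  have hs0 : (Real.sqrt L : ℂ) ≠ 0 := by exact_mod_cast (Real.sqrt_pos.2 hL).ne'
  have h1 := h.norm_integral_sub_le hk hkL hε (-k) (-(L * ((k : ℂ)⁻¹ * (Complex.I * T 0)))) (by
      have e : ∀ s : ℝ, (arcParam γ u₀ 0 + (k : ℂ)⁻¹ * (Complex.I * T 0) -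
          (k : ℂ)⁻¹ * (Complex.I * T 0) * Complex.exp (Complex.I * (k * s : ℝ))) *
          Complex.exp (Complex.I * (-k * s : ℝ)) =
          (arcParam γ u₀ 0 + (k : ℂ)⁻¹ * (Complex.I * T 0)) *
            Complex.exp (Complex.I * (-k * s : ℝ)) - (k : ℂ)⁻¹ * (Complex.I * T 0) := by
        intro s
        have e : Complex.exp (Complex.I * (k * s : ℝ)) *
            Complex.exp (Complex.I * (-k * s : ℝ)) = 1 := by
          rw [← Complex.exp_add, ← Complex.exp_zero]
          congr 1
          push_cast
          ring
        rw [sub_mul, mul_assoc _ (Complex.exp _), e, mul_one]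
      simp_rw [e]
      have hint : ∫ s in (0 : ℝ)..L, Complex.exp (Complex.I * (-k * s : ℝ)) = 0 := by
        have h4 := integral_exp_I_mul hk.ne' hkL
        have h5 := intervalIntegral.integral_comp_neg (a := 0) (b := L)
          (fun s : ℝ => Complex.exp (Complex.I * (k * s : ℝ)))
        simp only [mul_neg, neg_zero, ← neg_mul] at h5
        have h6 : ∫ s in (-L)..0, Complex.exp (Complex.I * (k * s : ℝ)) = 0 := by
          have hp : Function.Periodic
              (fun s : ℝ => Complex.exp (Complex.I * (k * s : ℝ))) L := exp_I_mul_periodic hkL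
          have h7 := hp.intervalIntegral_add_eq (-L) 0
          rw [neg_add_cancel, zero_add] at h7
          rw [h7, h4]
        rw [← h6, ← h5]
      rw [intervalIntegral.integral_sub (Continuous.intervalIntegrable (by fun_prop) _ _)
        (by simp), intervalIntegral.integral_const_mul, hint]
      simp only [intervalIntegral.integral_const, sub_zero, mul_zero, zero_sub,
        Complex.real_smul])
  have h2 : (Real.sqrt L : ℂ) * fourierHat γ u₀ 1 =
      ∫ s in (0 : ℝ)..L, arcParam γ u₀ s * Complex.exp (Complex.I * (-k * s : ℝ)) := by
    rw [fourierHat, hlen, ← intervalIntegral.integral_const_mul]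
    refine intervalIntegral.integral_congr fun s _ => ?_
    simp only [conj_fourierBasis_one hL.ne' hkL]
    field_simp
  rw [← h2, hz, ← mul_assoc, hsq, sub_neg_eq_add, ← mul_add, norm_mul, Complex.norm_real,
    Real.norm_of_nonneg hL.le, mul_comm L] at h1
  exact le_of_mul_le_mul_right h1 hL

end Fourier

/-! ### The convex domain bounded by a curve of positive curvature -/

/-- The intersection of the open half planes to the left of the tangent lines. -/
def leftRegion (f T : ℝ → ℂ) : Set ℂ := {x | ∀ s, 0 < inner ℝ (x - f s) (Complex.I * T s)}

lemma inner_mul_exp_I {z : ℂ} (hz : ‖z‖ = 1) (β : ℝ) :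
    inner ℝ (z * Complex.exp (Complex.I * β)) (Complex.I * z) = Real.sin β := by
  have h1 : z.re * z.re + z.im * z.im = 1 := by
    rw [← Complex.normSq_apply, Complex.normSq_eq_norm_sq, hz, one_pow]
  rw [mul_comm Complex.I (β : ℂ), Complex.exp_mul_I]
  simp only [Complex.inner, Complex.mul_re, Complex.mul_im, Complex.conj_re, Complex.conj_im,
    Complex.I_re, Complex.I_im, Complex.add_re, Complex.add_im, Complex.cos_ofReal_re,
    Complex.cos_ofReal_im, Complex.sin_ofReal_re, Complex.sin_ofReal_im]
  linear_combination Real.sin β * h1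

lemma abs_inner_I_mul_le {T : ℂ} (hT : ‖T‖ = 1) (z : ℂ) : |inner ℝ z (Complex.I * T)| ≤ ‖z‖ := by
  have h := abs_real_inner_le_norm z (Complex.I * T)
  rwa [norm_I_mul, hT, mul_one] at h

namespace IsUnitSpeedLoop

variable {L : ℝ} {f T : ℝ → ℂ} {κ : ℝ → ℝ} (h : IsUnitSpeedLoop L f T κ)

include h

lemma hasDerivAt_angle (s : ℝ) : HasDerivAt (fun s => ∫ x in (0 : ℝ)..s, κ x) (κ s) s :=
  intervalIntegral.integral_hasDerivAt_right (h.continuous_curvature.intervalIntegrable _ _)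
    (h.continuous_curvature.stronglyMeasurableAtFilter _ _) h.continuous_curvature.continuousAt

lemma tangent_eq (s s' : ℝ) :
    T s' = T s * Complex.exp (Complex.I * (∫ x in s..s', κ x : ℝ)) := by
  set α : ℝ → ℝ := fun s => ∫ x in (0 : ℝ)..s, κ x with hα
  have hd : ∀ s, HasDerivAt (fun s => T s * Complex.exp (Complex.I * (-α s : ℝ))) 0 s := by
    intro s
    have h1 : HasDerivAt (fun s => ((-α s : ℝ) : ℂ)) ((-κ s : ℝ) : ℂ) s :=
      (h.hasDerivAt_angle s).neg.ofReal_comp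
    refine ((h.hasDerivAt_tangent s).mul (h1.const_mul Complex.I).cexp).congr_deriv ?_
    rw [Complex.real_smul]
    push_cast
    ring
  have h1 := is_const_of_deriv_eq_zero (fun s => (hd s).differentiableAt)
    (fun s => (hd s).deriv) s' s
  have h2 : (∫ x in s..s', κ x) = α s' - α s :=
    (intervalIntegral.integral_interval_sub_left (h.continuous_curvature.intervalIntegrable _ _)
      (h.continuous_curvature.intervalIntegrable _ _)).symm
  have e : Complex.exp (Complex.I * (-α s' : ℝ)) * Complex.exp (Complex.I * (α s' : ℝ)) = 1 := by
    rw [← Complex.exp_add, ← Complex.exp_zero]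
    congr 1
    push_cast
    ring
  calc T s' = T s' * Complex.exp (Complex.I * (-α s' : ℝ)) *
        Complex.exp (Complex.I * (α s' : ℝ)) := by rw [mul_assoc, e, mul_one]
    _ = T s * (Complex.exp (Complex.I * (-α s : ℝ)) * Complex.exp (Complex.I * (α s' : ℝ))) := by
      rw [h1, mul_assoc]
    _ = _ := by
      rw [← Complex.exp_add, h2]
      congr 2
      push_cast
      ring

/-- The turning angle runs continuously from `0` to `2π`, so every direction is attained; no sign of
the curvature is needed. -/
lemma exists_tangent_eq {z : ℂ} (hz : ‖z‖ = 1) : ∃ s, T s = z := by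
  have hT0 : T 0 ≠ 0 := norm_ne_zero_iff.1 (by rw [h.norm_tangent]; exact one_ne_zero)
  set θ := toIcoMod Real.two_pi_pos 0 (z / T 0).arg with hθ
  have hmem := toIcoMod_mem_Ico Real.two_pi_pos 0 (z / T 0).arg
  have hα : Continuous (fun s => ∫ x in (0 : ℝ)..s, κ x) :=
    continuous_iff_continuousAt.2 fun s => (h.hasDerivAt_angle s).continuousAt
  obtain ⟨s, hs⟩ := mem_range_of_exists_le_of_exists_ge hα
    ⟨0, by simpa using hmem.1⟩ ⟨L, by rw [h.integral_curvature]; simpa using hmem.2.le⟩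
  refine ⟨s, ?_⟩
  simp only at hs
  rw [h.tangent_eq 0 s, hs, toIcoMod]
  have h1 : ‖z / T 0‖ = 1 := by rw [norm_div, hz, h.norm_tangent, div_one]
  have h2 := Complex.norm_mul_exp_arg_mul_I (z / T 0)
  rw [h1, Complex.ofReal_one, one_mul] at h2
  have h3 : Complex.I * (((z / T 0).arg - toIcoDiv Real.two_pi_pos 0 (z / T 0).arg •
      (2 * Real.pi) : ℝ) : ℂ) = (z / T 0).arg * Complex.I -
      (toIcoDiv Real.two_pi_pos 0 (z / T 0).arg : ℤ) * (2 * Real.pi * Complex.I) := by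
    rw [zsmul_eq_mul]
    push_cast
    ring
  rw [h3, Complex.exp_sub, Complex.exp_int_mul_two_pi_mul_I, div_one, h2, mul_div_cancel₀ _ hT0]

lemma exists_min_support (x : ℂ) : ∃ s₀, ∀ s,
    inner ℝ (x - f s₀) (Complex.I * T s₀) ≤ inner ℝ (x - f s) (Complex.I * T s) := by
  have hf := h.continuous
  have hT := h.continuous_tangent
  obtain ⟨s₀, -, hs₀⟩ := isCompact_Icc.exists_isMinOn (nonempty_Icc.2 h.length_pos.le)
    (f := fun s => inner ℝ (x - f s) (Complex.I * T s)) (by fun_prop)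
  refine ⟨s₀, fun s => ?_⟩
  have hper : Function.Periodic (fun s => inner ℝ (x - f s) (Complex.I * T s)) L := fun s => by
    simp only [h.periodic s, h.periodic_tangent s]
  obtain ⟨y, hy, hys⟩ := hper.exists_mem_Ico₀ h.length_pos s
  rw [hys]
  exact hs₀ ⟨hy.1, hy.2.le⟩

/-- Although infinitely many half planes are intersected, the least distance to the tangent lines is
attained over a period and serves as radius. -/
lemma isOpen_leftRegion : IsOpen (leftRegion f T) := by
  rw [Metric.isOpen_iff]
  intro x hx
  obtain ⟨s₀, hs₀⟩ := h.exists_min_support x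
  refine ⟨_, hx s₀, fun y hy s => ?_⟩
  have h1 := abs_inner_I_mul_le (h.norm_tangent s) (y - x)
  rw [Metric.mem_ball, dist_eq_norm] at hy
  have h2 : inner ℝ (y - f s) (Complex.I * T s) =
      inner ℝ (y - x) (Complex.I * T s) + inner ℝ (x - f s) (Complex.I * T s) := by
    rw [← inner_add_left, sub_add_sub_cancel]
  rw [h2]
  linarith [neg_abs_le (inner ℝ (y - x) (Complex.I * T s)), hs₀ s]

omit h in
lemma inner_combo {x y w z : ℂ} {a b : ℝ} (hab : a + b = 1) :
    inner ℝ (a • x + b • y - w) z = a * inner ℝ (x - w) z + b * inner ℝ (y - w) z := by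
  have h1 : a • x + b • y - w = a • (x - w) + b • (y - w) := by
    rw [smul_sub, smul_sub, sub_add_sub_comm, ← add_smul, hab, one_smul]
  rw [h1, inner_add_left, inner_smul_left, inner_smul_left]
  simp

omit h in
lemma convex_leftRegion : Convex ℝ (leftRegion f T) := by
  intro x hx y hy a b ha hb hab s
  rw [inner_combo hab]
  rcases ha.lt_or_eq with ha | rfl
  · exact add_pos_of_pos_of_nonneg (mul_pos ha (hx s)) (mul_nonneg hb (hy s).le)
  · rw [zero_add] at hab
    rw [hab, zero_mul, one_mul, zero_add]
    exact hy s

omit h in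
lemma closure_leftRegion_subset :
    closure (leftRegion f T) ⊆ {x | ∀ s, 0 ≤ inner ℝ (x - f s) (Complex.I * T s)} := by
  refine closure_minimal (fun x hx s => (hx s).le) ?_
  rw [Set.ofPred_forall]
  refine isClosed_iInter fun s => isClosed_le continuous_const (by fun_prop)

omit h in
lemma mem_closure_leftRegion {p x : ℂ} (hp : p ∈ leftRegion f T)
    (hx : ∀ s, 0 ≤ inner ℝ (x - f s) (Complex.I * T s)) : x ∈ closure (leftRegion f T) := by
  have h1 : Tendsto (fun ε : ℝ => (1 - ε) • x + ε • p) (𝓝[>] 0) (𝓝 x) := by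
    have h2 : Continuous (fun ε : ℝ => (1 - ε) • x + ε • p) := by fun_prop
    have h3 := h2.tendsto 0
    simp only [sub_zero, one_smul, zero_smul, add_zero] at h3
    exact h3.mono_left nhdsWithin_le_nhds
  refine mem_closure_of_tendsto h1 ?_
  filter_upwards [Ioo_mem_nhdsGT (zero_lt_one' ℝ)] with ε hε s
  rw [inner_combo (by ring)]
  exact add_pos_of_nonneg_of_pos (mul_nonneg (by linarith [hε.2]) (hx s)) (mul_pos hε.1 (hp s))

lemma ball_subset_leftRegion {c : ℂ} {R δ : ℝ}
    (hc : ∀ s, |inner ℝ (c - f s) (Complex.I * T s) - R| ≤ δ) :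
    Metric.ball c (R - δ) ⊆ leftRegion f T := by
  intro x hx s
  rw [Metric.mem_ball, dist_eq_norm] at hx
  have h1 := abs_inner_I_mul_le (h.norm_tangent s) (x - c)
  have h2 : inner ℝ (x - f s) (Complex.I * T s) =
      inner ℝ (x - c) (Complex.I * T s) + inner ℝ (c - f s) (Complex.I * T s) := by
    rw [← inner_add_left, sub_add_sub_cancel]
  rw [h2]
  linarith [neg_abs_le (inner ℝ (x - c) (Complex.I * T s)), abs_le.1 (hc s)]

/-- Test `x` against the tangent line whose inner normal is opposite to `x - c`; it exists by
`exists_tangent_eq`. -/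
lemma leftRegion_subset_closedBall {c : ℂ} {R δ : ℝ} (hRδ : 0 ≤ R + δ)
    (hc : ∀ s, |inner ℝ (c - f s) (Complex.I * T s) - R| ≤ δ) :
    leftRegion f T ⊆ Metric.closedBall c (R + δ) := by
  intro x hx
  rw [Metric.mem_closedBall, dist_eq_norm]
  rcases eq_or_ne x c with rfl | hne
  · simpa using hRδ
  have hn : ‖x - c‖ ≠ 0 := norm_ne_zero_iff.2 (sub_ne_zero.2 hne)
  have hnc : ((‖x - c‖ : ℝ) : ℂ) ≠ 0 := by exact_mod_cast hn
  obtain ⟨s, hs⟩ := h.exists_tangent_eq (z := Complex.I * ((‖x - c‖ : ℝ) : ℂ)⁻¹ * (x - c)) (by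
    rw [norm_mul, norm_mul, Complex.norm_I, norm_inv, Complex.norm_real, norm_norm, one_mul,
      inv_mul_cancel₀ hn])
  have h1 : Complex.I * T s = -(‖x - c‖⁻¹ • (x - c)) := by
    rw [hs, Complex.real_smul, ← mul_assoc, ← mul_assoc, Complex.I_mul_I]
    push_cast
    ring
  have h2 : inner ℝ (x - f s) (Complex.I * T s) =
      inner ℝ (x - c) (Complex.I * T s) + inner ℝ (c - f s) (Complex.I * T s) := by
    rw [← inner_add_left, sub_add_sub_cancel]
  have h3 : inner ℝ (x - c) (Complex.I * T s) = -‖x - c‖ := by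
    rw [h1, inner_neg_right, inner_smul_right, real_inner_self_eq_norm_sq]
    field_simp
  have h4 := hx s
  rw [h2, h3] at h4
  linarith [abs_le.1 (hc s)]

variable (hκ : ∀ s, 0 < κ s)

include hκ

/-- The distance to the tangent line is minimal at `s₀`, so its derivative `-κ ⟨x - f, T⟩` vanishes
there. As `κ > 0`, both components of `x - f s₀` are zero. -/
lemma eq_of_support_eq_zero {x : ℂ} (hx : ∀ s, 0 ≤ inner ℝ (x - f s) (Complex.I * T s)) {s₀ : ℝ}
    (hs₀ : inner ℝ (x - f s₀) (Complex.I * T s₀) = 0) : x = f s₀ := by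
  have hd : HasDerivAt (fun s => inner ℝ (x - f s) (Complex.I * T s))
      (inner ℝ (x - f s₀) (Complex.I * (κ s₀ • (Complex.I * T s₀))) +
        inner ℝ (-T s₀) (Complex.I * T s₀)) s₀ :=
    ((h.hasDerivAt s₀).const_sub x).inner ℝ ((h.hasDerivAt_tangent s₀).const_mul Complex.I)
  have hmin : IsLocalMin (fun s => inner ℝ (x - f s) (Complex.I * T s)) s₀ :=
    Eventually.of_forall fun s => by
      simp only [hs₀]
      exact hx s
  have h1 := hmin.hasDerivAt_eq_zero hd
  rw [inner_neg_left, inner_I_mul_self, neg_zero, add_zero, mul_smul_comm, ← mul_assoc,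
    Complex.I_mul_I, neg_one_mul, inner_smul_right, inner_neg_right, mul_neg, neg_eq_zero] at h1
  have h2 : inner ℝ (x - f s₀) (T s₀) = 0 := (mul_eq_zero.1 h1).resolve_left (hκ s₀).ne'
  have h3 := eq_inner_smul_add (h.norm_tangent s₀) (x - f s₀)
  rw [hs₀, real_inner_comm, h2, zero_smul, zero_smul, add_zero] at h3
  exact sub_eq_zero.1 h3

/-- The curve lies on the left of each of its tangent lines. -/
lemma support_nonneg (s s' : ℝ) : 0 ≤ inner ℝ (f s' - f s) (Complex.I * T s) := by
  have hL := h.length_pos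
  have hκc := h.continuous_curvature
  have hper : Function.Periodic (fun x => inner ℝ (f x - f s) (Complex.I * T s)) L := fun x => by
    simp only [h.periodic x]
  obtain ⟨x, hx, hxs⟩ := hper.exists_mem_Ico hL s' s
  rw [hxs]
  have hd : ∀ y, HasDerivAt (fun x => inner ℝ (f x - f s) (Complex.I * T s))
      (Real.sin (∫ z in s..y, κ z)) y := by
    intro y
    refine (((h.hasDerivAt y).sub_const (f s)).inner ℝ
      (hasDerivAt_const y (Complex.I * T s))).congr_deriv ?_
    rw [inner_zero_right, zero_add, h.tangent_eq s y, inner_mul_exp_I (h.norm_tangent s)]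
  have hc : Continuous (fun x => inner ℝ (f x - f s) (Complex.I * T s)) :=
    continuous_iff_continuousAt.2 fun y => (hd y).continuousAt
  have hint : ∀ a b, IntervalIntegrable κ volume a b := fun a b => hκc.intervalIntegrable a b
  have hmono : ∀ a b, s ≤ a → a ≤ b → ∫ z in s..a, κ z ≤ ∫ z in s..b, κ z := by
    intro a b ha hab
    exact intervalIntegral.integral_mono_interval le_rfl ha hab
      (Eventually.of_forall fun z => (hκ z).le) (hint _ _)
  have htot : ∫ z in s..s + L, κ z = 2 * Real.pi := by
    rw [h.periodic_curvature.intervalIntegral_add_eq s 0, zero_add, h.integral_curvature]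
  -- The height over the tangent line at `s` has derivative the sine of the turning angle, which
  -- increases from `0` to `2π`. The height rises until the angle is `π`, then falls back to zero,
  -- so one compares with the nearer end.
  rcases le_total (∫ z in s..x, κ z) Real.pi with hle | hle
  · have hm : MonotoneOn (fun x => inner ℝ (f x - f s) (Complex.I * T s)) (Icc s x) := by
      refine monotoneOn_of_deriv_nonneg (convex_Icc s x) hc.continuousOn
        (fun y _ => (hd y).differentiableAt.differentiableWithinAt) fun y hy => ?_
      rw [interior_Icc] at hy
      rw [(hd y).deriv]
      refine Real.sin_nonneg_of_nonneg_of_le_pi ?_ ((hmono y x hy.1.le hy.2.le).trans hle)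
      exact intervalIntegral.integral_nonneg hy.1.le fun z _ => (hκ z).le
    have h1 := hm (left_mem_Icc.2 hx.1) (right_mem_Icc.2 hx.1) hx.1
    simpa using h1
  · have hm : AntitoneOn (fun x => inner ℝ (f x - f s) (Complex.I * T s)) (Icc x (s + L)) := by
      refine antitoneOn_of_deriv_nonpos (convex_Icc x (s + L)) hc.continuousOn
        (fun y _ => (hd y).differentiableAt.differentiableWithinAt) fun y hy => ?_
      rw [interior_Icc] at hy
      rw [(hd y).deriv, ← Real.sin_sub_two_pi]
      have h1 := hmono x y hx.1 hy.1.le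
      have h2 := hmono y (s + L) (hx.1.trans hy.1.le) hy.2.le
      rw [htot] at h2
      exact Real.sin_nonpos_of_nonpos_of_neg_pi_le (by linarith) (by linarith)
    have h1 := hm (left_mem_Icc.2 hx.2.le) (right_mem_Icc.2 hx.2.le) hx.2.le
    simpa [h.periodic s] using h1

lemma frontier_leftRegion {p : ℂ} (hp : p ∈ leftRegion f T) :
    frontier (leftRegion f T) = range f := by
  rw [h.isOpen_leftRegion.frontier_eq]
  ext x
  constructor
  · rintro ⟨hx, hx'⟩
    have h1 := closure_leftRegion_subset hx
    rw [leftRegion, mem_ofPred_eq, not_forall] at hx'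
    obtain ⟨s, hs⟩ := hx'
    exact ⟨s, (h.eq_of_support_eq_zero hκ h1 (le_antisymm (not_lt.1 hs) (h1 s))).symm⟩
  · rintro ⟨s, rfl⟩
    refine ⟨mem_closure_leftRegion hp fun s' => h.support_nonneg hκ s' s, fun hx => ?_⟩
    have := hx s
    simp at this

/-- If a proper convex combination lay on a tangent line, both end points would lie on it too, and
each would be the point of contact. -/
lemma strictConvex_closure_leftRegion : StrictConvex ℝ (closure (leftRegion f T)) := by
  intro x hx y hy hxy a b ha hb hab
  refine interior_maximal subset_closure h.isOpen_leftRegion ?_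
  have hx' := closure_leftRegion_subset hx
  have hy' := closure_leftRegion_subset hy
  by_contra hm
  rw [leftRegion, mem_ofPred_eq, not_forall] at hm
  obtain ⟨s, hs⟩ := hm
  rw [inner_combo hab, not_lt] at hs
  have h1 := mul_nonneg ha.le (hx' s)
  have h2 := mul_nonneg hb.le (hy' s)
  have h3 : inner ℝ (x - f s) (Complex.I * T s) = 0 :=
    (mul_eq_zero.1 (by linarith : a * inner ℝ (x - f s) (Complex.I * T s) = 0)).resolve_left ha.ne'
  have h4 : inner ℝ (y - f s) (Complex.I * T s) = 0 :=
    (mul_eq_zero.1 (by linarith : b * inner ℝ (y - f s) (Complex.I * T s) = 0)).resolve_left hb.ne'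
  exact hxy ((h.eq_of_support_eq_zero hκ hx' h3).trans
    (h.eq_of_support_eq_zero hκ hy' h4).symm)

end IsUnitSpeedLoop

/-! ### Domains close to a disk -/

section Disk

variable {Ω : Set ℂ} {c : ℂ} {R δ : ℝ} (hδ : 0 ≤ δ) (hδR : δ < R)
  (hin : Metric.ball c (R - δ) ⊆ Ω) (hout : Ω ⊆ Metric.closedBall c (R + δ))

include hδ hδR hin hout

/-- Radial scaling about `c` by `R/(R+δ)`, respectively `(R-δ)/R`, moves points by at most `δ` into
the other set. -/
lemma hausdorffDist_closure_closedBall_le :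
    Metric.hausdorffDist (closure Ω) (Metric.closedBall c R) ≤ δ := by
  have hR : 0 < R := hδ.trans_lt hδR
  refine Metric.hausdorffDist_le_of_mem_dist hδ (fun x hx => ?_) (fun y hy => ?_)
  · have hx' := closure_minimal hout Metric.isClosed_closedBall hx
    rw [Metric.mem_closedBall, dist_eq_norm] at hx'
    refine ⟨c + (R / (R + δ)) • (x - c), ?_, ?_⟩
    · rw [Metric.mem_closedBall, dist_eq_norm, add_sub_cancel_left, norm_smul,
        Real.norm_of_nonneg (by positivity)]
      calc R / (R + δ) * ‖x - c‖ ≤ R / (R + δ) * (R + δ) := by gcongr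
        _ = R := div_mul_cancel₀ _ (by positivity)
    · rw [dist_eq_norm]
      have h1 : x - (c + (R / (R + δ)) • (x - c)) = (δ / (R + δ)) • (x - c) := by
        have h2 : δ / (R + δ) = 1 - R / (R + δ) := by
          field_simp
          ring
        rw [h2, sub_smul, one_smul]
        abel
      rw [h1, norm_smul, Real.norm_of_nonneg (by positivity)]
      calc δ / (R + δ) * ‖x - c‖ ≤ δ / (R + δ) * (R + δ) := by gcongr
        _ = δ := div_mul_cancel₀ _ (by positivity)
  · rw [Metric.mem_closedBall, dist_eq_norm] at hy
    have hRδ : 0 < R - δ := by linarith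
    refine ⟨c + ((R - δ) / R) • (y - c), closure_mono hin ?_, ?_⟩
    · rw [closure_ball _ hRδ.ne', Metric.mem_closedBall, dist_eq_norm, add_sub_cancel_left,
        norm_smul, Real.norm_of_nonneg (by positivity)]
      calc (R - δ) / R * ‖y - c‖ ≤ (R - δ) / R * R := by gcongr
        _ = R - δ := div_mul_cancel₀ _ hR.ne'
    · rw [dist_eq_norm]
      have h1 : y - (c + ((R - δ) / R) • (y - c)) = (δ / R) • (y - c) := by
        have h2 : δ / R = 1 - (R - δ) / R := by
          field_simp
          ring
        rw [h2, sub_smul, one_smul]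
        abel
      rw [h1, norm_smul, Real.norm_of_nonneg (by positivity)]
      calc δ / R * ‖y - c‖ ≤ δ / R * R := by gcongr
        _ = δ := div_mul_cancel₀ _ hR.ne'

omit hδ hδR hin hout in
-- The reflection `x ↦ 2c - x` preserves the ball and the measure and reverses the integrand.
lemma integral_ball_sub_center (c : ℂ) (ρ : ℝ) : ∫ x in Metric.ball c ρ, (x - c) = 0 := by
  rw [← integral_indicator Metric.isOpen_ball.measurableSet]
  have h1 := integral_sub_left_eq_self (fun x => (Metric.ball c ρ).indicator (fun x => x - c) x)
    volume (2 * c)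
  have h2 : ∀ x, (Metric.ball c ρ).indicator (fun x => x - c) (2 * c - x) =
      -(Metric.ball c ρ).indicator (fun x => x - c) x := by
    intro x
    have h3 : 2 * c - x - c = -(x - c) := by ring
    have h4 : 2 * c - x ∈ Metric.ball c ρ ↔ x ∈ Metric.ball c ρ := by
      rw [Metric.mem_ball, Metric.mem_ball, dist_eq_norm, dist_eq_norm, h3, norm_neg]
    by_cases hx : x ∈ Metric.ball c ρ
    · rw [indicator_of_mem hx, indicator_of_mem (h4.2 hx), h3]
    · rw [indicator_of_notMem hx, indicator_of_notMem (fun h => hx (h4.1 h)), neg_zero]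
  simp_rw [h2] at h1
  rw [integral_neg] at h1
  exact self_eq_neg.1 h1.symm

omit hδ hδR hin hout in
lemma volume_real_ball (c : ℂ) {ρ : ℝ} (hρ : 0 ≤ ρ) :
    volume.real (Metric.ball c ρ) = Real.pi * ρ ^ 2 := by
  rw [measureReal_def, Complex.volume_ball, ENNReal.toReal_mul, ENNReal.toReal_pow,
    ENNReal.toReal_ofReal hρ]
  simp [mul_comm]

omit hδ hδR hin hout in
lemma volume_real_closedBall (c : ℂ) {ρ : ℝ} (hρ : 0 ≤ ρ) :
    volume.real (Metric.closedBall c ρ) = Real.pi * ρ ^ 2 := by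
  rw [measureReal_def, Complex.volume_closedBall, ENNReal.toReal_mul, ENNReal.toReal_pow,
    ENNReal.toReal_ofReal hρ]
  simp [mul_comm]

/-- The first moment about `c` comes only from `Ω` outside the inner ball, a set of area at most
`4πRδ`; the area itself differs from `πR²` by at most `3πRδ`. -/
lemma norm_integral_sub_le :
    ‖(∫ x in Ω, x) - (Real.pi * R ^ 2) • c‖ ≤
      (8 * Real.pi * R ^ 2 + 3 * Real.pi * R * ‖c‖) * δ := by
  have hR : 0 < R := hδ.trans_lt hδR
  have hpi := Real.pi_pos
  set B := Metric.ball c (R - δ) with hB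
  set D := Metric.closedBall c (R + δ) with hD
  have hBm : MeasurableSet B := Metric.isOpen_ball.measurableSet
  have hDfin : volume D ≠ ⊤ := (isCompact_closedBall c (R + δ)).measure_lt_top.ne
  have hΩfin : volume Ω ≠ ⊤ := measure_ne_top_of_subset hout hDfin
  have hint : IntegrableOn (fun x : ℂ => x - c) Ω :=
    ((continuous_id.sub continuous_const).continuousOn.integrableOn_compact
      (isCompact_closedBall c (R + δ))).mono_set hout
  have hconst : IntegrableOn (fun _ : ℂ => c) Ω := integrableOn_const hΩfin
  have hvB : volume.real B = Real.pi * (R - δ) ^ 2 := volume_real_ball c (by linarith)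
  have hvD : volume.real D = Real.pi * (R + δ) ^ 2 := volume_real_closedBall c (by linarith)
  have hlo : volume.real B ≤ volume.real Ω := measureReal_mono hin hΩfin
  have hhi : volume.real Ω ≤ volume.real D := measureReal_mono hout hDfin
  have h1 : ∫ x in Ω, x = (∫ x in Ω, (x - c)) + volume.real Ω • c := by
    rw [← setIntegral_const, ← integral_add hint hconst]
    simp
  have h2 : ∫ x in Ω, (x - c) = ∫ x in Ω \ B, (x - c) := by
    rw [setIntegral_sdiff hBm hint hin, integral_ball_sub_center, sub_zero]
  have h3 : ‖∫ x in Ω \ B, (x - c)‖ ≤ (R + δ) * volume.real (Ω \ B) := by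
    refine norm_setIntegral_le_of_norm_le_const
      ((measure_mono sdiff_subset).trans_lt hΩfin.lt_top) fun x hx => ?_
    have := hout hx.1
    rwa [hD, Metric.mem_closedBall, dist_eq_norm] at this
  have h4 : volume.real (Ω \ B) ≤ Real.pi * (4 * R * δ) := by
    rw [measureReal_sdiff hin hBm]
    nlinarith
  have h5 : |volume.real Ω - Real.pi * R ^ 2| ≤ 3 * Real.pi * R * δ := by
    have : Real.pi * δ ^ 2 ≤ Real.pi * (R * δ) := by
      rw [sq]
      gcongr
    rw [abs_le]
    constructor <;> nlinarith
  have h6 : (∫ x in Ω, x) - (Real.pi * R ^ 2) • c =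
      (∫ x in Ω \ B, (x - c)) + (volume.real Ω - Real.pi * R ^ 2) • c := by
    rw [h1, h2, sub_smul]
    abel
  rw [h6]
  refine (norm_add_le _ _).trans ?_
  rw [norm_smul, Real.norm_eq_abs]
  have h7 : (R + δ) * volume.real (Ω \ B) ≤ (2 * R) * (Real.pi * (4 * R * δ)) := by
    gcongr
    linarith
  have h8 := mul_le_mul_of_nonneg_right h5 (norm_nonneg c)
  linarith

end Disk

/-! ### Limits -/

/-- A curve whose velocity decays exponentially converges exponentially. -/
lemma exists_limit_of_expDecay {g g' : ℝ → ℂ} (hc : ContinuousOn g (Ici 0))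
    (hd : ∀ t, 0 < t → HasDerivAt g (g' t) t) (hg' : ExpDecayFrom 0 (fun t => ‖g' t‖)) :
    ∃ l, ExpDecayFrom 0 (fun t => ‖g t - l‖) := by
  obtain ⟨C, hC, lam, hlam, hle⟩ := hg'
  have hB : ∀ x : ℝ, HasDerivAt (fun x => -(C / lam) * Real.exp (-lam * x))
      (C * Real.exp (-lam * x)) x := by
    intro x
    refine ((((hasDerivAt_id x).const_mul (-lam)).exp).const_mul (-(C / lam))).congr_deriv ?_
    simp only [id]
    field_simp
  have key : ∀ a b, 0 < a → a ≤ b → ‖g b - g a‖ ≤ C / lam * Real.exp (-lam * a) := by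
    intro a b ha hab
    -- The majorant vanishes at `a`, has derivative `C e^{-λx}` and never exceeds `(C/λ) e^{-λa}`.
    have h1 := image_norm_le_of_norm_deriv_right_le_deriv_boundary' (a := a) (b := b)
      (f := fun x => g x - g a) (f' := g')
      (B := fun x => C / lam * Real.exp (-lam * a) + -(C / lam) * Real.exp (-lam * x))
      (B' := fun x => C * Real.exp (-lam * x))
      ((hc.mono (Icc_subset_Ici_self.trans (Ici_subset_Ici.2 ha.le))).sub continuousOn_const)
      (fun x hx => ((hd x (ha.trans_le hx.1)).sub_const _).hasDerivWithinAt)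
      (by simp) (by fun_prop)
      (fun x _ => ((hB x).const_add _).hasDerivWithinAt)
      (fun x hx => hle x (ha.le.trans hx.1)) (right_mem_Icc.2 hab)
    have h2 : 0 ≤ C / lam * Real.exp (-lam * b) := by positivity
    linarith
  have hexp : Tendsto (fun t : ℝ => C / lam * Real.exp (-lam * t)) atTop (𝓝 0) := by
    have h1 : Tendsto (fun t : ℝ => Real.exp (-lam * t)) atTop (𝓝 0) :=
      Real.tendsto_exp_atBot.comp (tendsto_id.const_mul_atTop_of_neg (by linarith))
    simpa using h1.const_mul (C / lam)
  have hseq : Tendsto (fun n : ℕ => (n : ℝ) + 1) atTop atTop :=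
    tendsto_atTop_add_const_right _ _ tendsto_natCast_atTop_atTop
  have hcauchy : CauchySeq (fun n : ℕ => g (n + 1)) := by
    refine cauchySeq_of_le_tendsto_0' (fun n : ℕ => C / lam * Real.exp (-lam * (n + 1)))
      (fun n m hnm => ?_) (hexp.comp hseq)
    rw [dist_comm, dist_eq_norm]
    exact key _ _ (by positivity) (by gcongr)
  obtain ⟨l, hl⟩ := cauchySeq_tendsto_of_complete hcauchy
  -- The derivative is available for positive times only, so the estimate starts at `1` and
  -- continuity covers `[0, 1]`.
  refine ⟨l, ExpDecayFrom.extend_of_continuousOn (T := 1)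
    ⟨C / lam, by positivity, lam, hlam, fun t ht => ?_⟩ (hc.sub continuousOn_const).norm⟩
  have h1 : Tendsto (fun n : ℕ => ‖g t - g (n + 1)‖) atTop (𝓝 ‖g t - l‖) :=
    (hl.const_sub (g t)).norm
  refine le_of_tendsto h1 ?_
  filter_upwards [hseq.eventually_ge_atTop t] with n hn
  rw [norm_sub_rev]
  exact key t _ (by linarith) hn

namespace IsGlobalSolution

variable {F : ℝ → ℝ → ℂ} (hF : IsGlobalSolution F) (hrot : rotationNumber (F 0) = 1)

include hF hrot

lemma expDecay_curvDev (m : ℕ) (u : ℝ) :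
    ExpDecayFrom 0 (fun t => |curvDev (meanCurv F) (F t) m u|) := by
  obtain ⟨C, hC, lam, hlam, h⟩ := hF.exists_curvDev_bound hrot m
  exact ⟨C, hC, lam, hlam, fun t ht => h t ht u⟩

/-- The base point, the tangent at the base point, and the curvature converge exponentially. -/
lemma exists_asymptotics (u₀ : ℝ) : ∃ (ε : ℝ → ℝ) (p τ : ℂ), ExpDecayFrom 0 ε ∧ ‖τ‖ = 1 ∧
    ∀ t, 0 ≤ t → (∀ u, |curvature (F t) u - meanCurv F| ≤ ε t) ∧
      ‖F t u₀ + (meanCurv F : ℂ)⁻¹ * (Complex.I * tangent (F t) u₀) - p‖ ≤ ε t ∧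
      ‖tangent (F t) u₀ - τ‖ ≤ ε t := by
  have hk := hF.meanCurv_pos
  have hpi := Real.pi_gt_three
  obtain ⟨a, ha⟩ := exists_limit_of_expDecay (hF.slab.continuousOn_time u₀)
    (fun t ht => hF.hasDerivAt_flow ht u₀) (by
      refine ((hF.expDecay_curvDev hrot 0 u₀).add (hF.expDecay_energy hrot 0)).mono fun t ht => ?_
      rw [norm_smul, norm_normal (hF.immersed t ht), mul_one, hF.normalVel_eq hrot ht,
        Real.norm_eq_abs]
      refine (abs_sub _ _).trans (add_le_add le_rfl ?_)
      have h0 := hF.energy_nonneg 0 ht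
      rw [abs_of_nonneg (by positivity)]
      exact div_le_self h0 (by linarith))
  obtain ⟨τ, hτ⟩ := exists_limit_of_expDecay (hF.slab_tangent.continuousOn_time u₀)
    (fun t ht => hF.hasDerivAt_time_tangent ht (meanCurv F) u₀) (by
      refine (hF.expDecay_curvDev hrot 1 u₀).mono fun t ht => ?_
      rw [norm_smul, norm_normal (hF.immersed t ht), mul_one, Real.norm_eq_abs])
  obtain ⟨C, hC, lam, hlam, hw⟩ := hF.exists_curvDev_bound hrot 0
  -- One error function dominating all three quantities; the limit center is that of the circle of
  -- radius `1/k` through `a` with tangent `τ`.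
  refine ⟨fun t => C * Real.exp (-lam * t) + (‖F t u₀ - a‖ +
    ((meanCurv F)⁻¹ * ‖tangent (F t) u₀ - τ‖ + ‖tangent (F t) u₀ - τ‖)),
    a + (meanCurv F : ℂ)⁻¹ * (Complex.I * τ), τ,
    (ExpDecayFrom.of_exp hC.le hlam).add (ha.add ((hτ.const_mul (by positivity)).add hτ)), ?_,
    fun t ht => ?_⟩
  · refine le_antisymm (le_of_forall_pos_le_add fun e he => ?_)
      (le_of_forall_pos_le_add fun e he => ?_)
    all_goals
      obtain ⟨T₁, hT₁, h⟩ := hτ.exists_le he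
      have h1 := h T₁ le_rfl
      have h2 := norm_tangent (hF.immersed T₁ hT₁) u₀
    · have h3 := norm_sub_norm_le τ (tangent (F T₁) u₀)
      rw [norm_sub_rev] at h3
      linarith
    · have h3 := norm_sub_norm_le (tangent (F T₁) u₀) τ
      linarith
  · have e0 : 0 ≤ C * Real.exp (-lam * t) := by positivity
    have e1 := norm_nonneg (F t u₀ - a)
    have e2 := norm_nonneg (tangent (F t) u₀ - τ)
    have e3 : 0 ≤ (meanCurv F)⁻¹ * ‖tangent (F t) u₀ - τ‖ := by positivity
    refine ⟨fun u => (hw t ht u).trans (by linarith), ?_, by linarith⟩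
    have h1 : F t u₀ + (meanCurv F : ℂ)⁻¹ * (Complex.I * tangent (F t) u₀) -
        (a + (meanCurv F : ℂ)⁻¹ * (Complex.I * τ)) =
        (F t u₀ - a) + (meanCurv F : ℂ)⁻¹ * (Complex.I * (tangent (F t) u₀ - τ)) := by ring
    rw [h1]
    refine (norm_add_le _ _).trans ?_
    rw [norm_mul, norm_I_mul, norm_inv, Complex.norm_real, Real.norm_of_nonneg hk.le]
    linarith

lemma isUnitSpeedLoop (u₀ : ℝ) {t : ℝ} (ht : 0 ≤ t) :
    IsUnitSpeedLoop (length (F 0)) (arcParam (F t) u₀)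
      (fun s => tangent (F t) (arcInv (F t) u₀ s))
      (fun s => curvature (F t) (arcInv (F t) u₀ s)) := by
  rw [← hF.length_eq hrot ht]
  exact isUnitSpeedLoop_arcParam (hF.contDiff ht) (hF.immersed t ht) (hF.periodic t ht) u₀
    (hF.integral_curvature hrot ht)

end IsGlobalSolution

/-! ### The phase -/

/-- Arc against chord: the representative `d` of `x - y` with `|d| ≤ L/2` has `|kd/2| ≤ π/2`, where
`|sin a| ≥ (2/π)|a|`. -/
lemma norm_addCircle_sub_le {k L : ℝ} (hL : 0 < L) (hk : 0 < k) (hkL : k * L = 2 * Real.pi)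
    (x y : ℝ) : ‖(x : AddCircle L) - (y : AddCircle L)‖ ≤
      Real.pi / (2 * k) * ‖Complex.exp (Complex.I * (k * x : ℝ)) -
        Complex.exp (Complex.I * (k * y : ℝ))‖ := by
  have hpi := Real.pi_pos
  set n := round (L⁻¹ * (x - y)) with hn
  set d := x - y - n * L with hd
  have h1 : ‖(x : AddCircle L) - (y : AddCircle L)‖ = |d| := by
    rw [← AddCircle.coe_sub, AddCircle.norm_eq]
  have hdL : |d| ≤ L / 2 := by
    have h2 := abs_sub_round (L⁻¹ * (x - y))
    rw [← hn] at h2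
    have h3 : d = L * (L⁻¹ * (x - y) - n) := by
      rw [hd]
      field_simp
    rw [h3, abs_mul, abs_of_pos hL]
    nlinarith
  have h4 : Complex.exp (Complex.I * (k * x : ℝ)) - Complex.exp (Complex.I * (k * y : ℝ)) =
      (Complex.exp (Complex.I * (k * d : ℝ)) - 1) * Complex.exp (Complex.I * (k * y : ℝ)) := by
    have h5 : Complex.I * (k * x : ℝ) = Complex.I * (k * d : ℝ) + Complex.I * (k * y : ℝ) +
        n * (2 * Real.pi * Complex.I) := by
      have h6 : ((k * x : ℝ) : ℂ) = ((k * d + k * y + n * (2 * Real.pi) : ℝ) : ℂ) := by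
        congr 1
        rw [hd, ← hkL]
        ring
      rw [h6]
      push_cast
      ring
    rw [h5, Complex.exp_add, Complex.exp_int_mul_two_pi_mul_I, mul_one, Complex.exp_add]
    ring
  rw [h1, h4, norm_mul, norm_exp_I_mul, mul_one, Complex.norm_exp_I_mul_ofReal_sub_one, norm_mul,
    Real.norm_eq_abs, Real.norm_eq_abs, abs_two]
  have h7 : |k * d / 2| ≤ Real.pi / 2 := by
    rw [abs_div, abs_mul, abs_of_pos hk, abs_two]
    nlinarith
  have h8 := Real.mul_abs_le_abs_sin h7
  rw [abs_div, abs_mul, abs_of_pos hk, abs_two] at h8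
  have h9 : |d| = Real.pi / (2 * k) * (2 * (2 / Real.pi * (k * |d| / 2))) := by
    field_simp
  rw [h9]
  gcongr

section FixedTime

variable {L k ε : ℝ} {f T : ℝ → ℂ} {κ : ℝ → ℝ} (h : IsUnitSpeedLoop L f T κ) (hk : 0 < k)
  (hkL : k * L = 2 * Real.pi) (hε : ∀ s, |κ s - k| ≤ ε)

include h hk hkL hε

/-- On the circle, `p - f = k⁻¹ iT`; the three error terms are the shift of the center and the
deviations of position and tangent. -/
lemma abs_support_sub_le {p : ℂ} (hp : ‖f 0 + (k : ℂ)⁻¹ * (Complex.I * T 0) - p‖ ≤ ε) (s : ℝ) :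
    |inner ℝ (p - f s) (Complex.I * T s) - k⁻¹| ≤ (1 + 3 * L / k) * ε := by
  set P := f 0 + (k : ℂ)⁻¹ * (Complex.I * T 0) with hP
  set E := Complex.exp (Complex.I * (k * s : ℝ)) with hE
  have h1 : p - f s = k⁻¹ • (Complex.I * T s) - ((P - p) +
      (f s - (P - (k : ℂ)⁻¹ * (Complex.I * T 0) * E)) +
      (k : ℂ)⁻¹ * (Complex.I * (T s - T 0 * E))) := by
    rw [Complex.real_smul]
    push_cast
    ring
  have h2 : inner ℝ (k⁻¹ • (Complex.I * T s)) (Complex.I * T s) = k⁻¹ := by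
    rw [inner_smul_left, real_inner_self_eq_norm_sq, norm_I_mul, h.norm_tangent]
    simp
  rw [h1, inner_sub_left, h2, sub_sub_cancel_left, abs_neg]
  refine (abs_inner_I_mul_le (h.norm_tangent s) _).trans ((norm_add₃_le).trans ?_)
  have e1 := h.norm_sub_circle_le hk hkL hε s
  have e2 := h.norm_tangent_sub_le hkL hε s
  have e3 : ‖(k : ℂ)⁻¹ * (Complex.I * (T s - T 0 * E))‖ ≤ k⁻¹ * (ε * L) := by
    rw [norm_mul, norm_I_mul, norm_inv, Complex.norm_real, Real.norm_of_nonneg hk.le]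
    gcongr
  calc _ ≤ ε + 2 * ε * L / k + k⁻¹ * (ε * L) := by gcongr
    _ = _ := by
      field_simp
      ring

variable {ρ σ : ℝ} (hz : ‖(ρ : ℂ) * Complex.exp (Complex.I * (k * σ : ℝ)) +
  (k : ℂ)⁻¹ * (Complex.I * T 0)‖ ≤ 2 * ε * L / k) (hρ : 0 ≤ ρ)

omit hkL hε

include hz hρ

lemma abs_radius_sub_le : |ρ - k⁻¹| ≤ 2 * ε * L / k := by
  have h1 := abs_norm_sub_norm_le ((ρ : ℂ) * Complex.exp (Complex.I * (k * σ : ℝ)))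
    (-((k : ℂ)⁻¹ * (Complex.I * T 0)))
  rw [sub_neg_eq_add, norm_neg, norm_mul, norm_mul, norm_exp_I_mul, norm_I_mul, h.norm_tangent,
    norm_inv, Complex.norm_real, Complex.norm_real, Real.norm_of_nonneg hρ,
    Real.norm_of_nonneg hk.le, mul_one, mul_one] at h1
  exact h1.trans hz

/-- Once the radius is known to be near `1/k`, dividing the first mode by it shows that `e^{ikσ}` is
near `-iT(0)`. -/
lemma norm_phase_add_le :
    ‖Complex.exp (Complex.I * (k * σ : ℝ)) + Complex.I * T 0‖ ≤ 4 * L * ε := by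
  have hkc : (k : ℂ) ≠ 0 := by exact_mod_cast hk.ne'
  set E := Complex.exp (Complex.I * (k * σ : ℝ)) with hE
  have h1 : E + Complex.I * T 0 = (k : ℂ) * ((ρ : ℂ) * E + (k : ℂ)⁻¹ * (Complex.I * T 0)) -
      (k : ℂ) * ((ρ - k⁻¹ : ℝ) : ℂ) * E := by
    push_cast
    field_simp
    ring
  have h2 := abs_radius_sub_le h hk hz hρ
  rw [h1]
  refine (norm_sub_le _ _).trans ?_
  rw [norm_mul, norm_mul, norm_mul, hE, norm_exp_I_mul, Complex.norm_real, Complex.norm_real,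
    Real.norm_of_nonneg hk.le, mul_one, Real.norm_eq_abs]
  calc _ ≤ k * (2 * ε * L / k) + k * (2 * ε * L / k) := by gcongr
    _ = _ := by
      field_simp
      ring

omit h hk hz hρ in
-- The shift by `-σ` in the reparametrization exactly undoes the phase of the first mode.
lemma mul_affine_eq (hkL : k * L = 2 * Real.pi) (θ : ℝ) :
    Complex.exp (Complex.I * (k * (L * θ - σ) : ℝ)) * Complex.exp (Complex.I * (k * σ : ℝ)) =
      Complex.exp (Complex.I * (2 * Real.pi * θ : ℝ)) := by
  rw [← Complex.exp_add, ← hkL]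
  congr 1
  push_cast
  ring

include hkL hε

lemma norm_tangent_sub_circle_le (θ : ℝ) :
    ‖T (L * θ - σ) - Complex.I * Complex.exp (Complex.I * (2 * Real.pi * θ : ℝ))‖ ≤
      5 * L * ε := by
  have h1 := h.norm_tangent_sub_le hkL hε (L * θ - σ)
  have h2 := norm_phase_add_le h hk hz hρ
  rw [← mul_affine_eq (σ := σ) hkL]
  set E₁ := Complex.exp (Complex.I * (k * (L * θ - σ) : ℝ)) with hE₁
  set E := Complex.exp (Complex.I * (k * σ : ℝ)) with hE
  have h3 : T (L * θ - σ) - Complex.I * (E₁ * E) = (T (L * θ - σ) - T 0 * E₁) -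
      E₁ * (Complex.I * (E + Complex.I * T 0)) := by
    linear_combination E₁ * T 0 * Complex.I_sq
  rw [h3]
  refine (norm_sub_le _ _).trans ?_
  rw [norm_mul, norm_I_mul, hE₁, norm_exp_I_mul, one_mul]
  linarith

lemma norm_reparam_sub_circle_le {p : ℂ}
    (hp : ‖f 0 + (k : ℂ)⁻¹ * (Complex.I * T 0) - p‖ ≤ ε) (θ : ℝ) :
    ‖f (L * θ - σ) - (p + (k : ℂ)⁻¹ * Complex.exp (Complex.I * (2 * Real.pi * θ : ℝ)))‖ ≤
      (1 + 6 * L / k) * ε := by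
  have h1 := h.norm_sub_circle_le hk hkL hε (L * θ - σ)
  have h2 := norm_phase_add_le h hk hz hρ
  rw [← mul_affine_eq (σ := σ) hkL]
  set P := f 0 + (k : ℂ)⁻¹ * (Complex.I * T 0) with hP
  set E₁ := Complex.exp (Complex.I * (k * (L * θ - σ) : ℝ)) with hE₁
  set E := Complex.exp (Complex.I * (k * σ : ℝ)) with hE
  have h3 : f (L * θ - σ) - (p + (k : ℂ)⁻¹ * (E₁ * E)) =
      (f (L * θ - σ) - (P - (k : ℂ)⁻¹ * (Complex.I * T 0) * E₁)) + (P - p) +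
      -((k : ℂ)⁻¹ * (E₁ * (E + Complex.I * T 0))) := by ring
  rw [h3]
  refine norm_add₃_le.trans ?_
  rw [norm_neg, norm_mul, norm_mul, norm_inv, Complex.norm_real, Real.norm_of_nonneg hk.le, hE₁,
    norm_exp_I_mul, one_mul]
  calc _ ≤ 2 * ε * L / k + ε + k⁻¹ * (4 * L * ε) := by gcongr
    _ = _ := by
      field_simp
      ring

end FixedTime

/-! ### Convergence of all derivatives -/

/-- `G t` decays exponentially, uniformly on the line. -/
def UnifDecay (G : ℝ → ℝ → ℂ) : Prop :=
  ∃ e, ExpDecayFrom 0 e ∧ ∀ t, 0 ≤ t → ∀ θ, ‖G t θ‖ ≤ e t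

lemma iteratedDeriv_eq_of_hasDerivAt {G : ℕ → ℝ → ℂ}
    (hG : ∀ m x, HasDerivAt (G m) (G (m + 1) x) x) (m : ℕ) : iteratedDeriv m (G 0) = G m := by
  induction m with
  | zero => exact iteratedDeriv_zero
  | succ m ih =>
    rw [iteratedDeriv_succ, ih]
    exact funext fun x => (hG m x).deriv

/-- If `A' = a A + b w B` where `B` differs from `A` by a function with bounded derivatives, and
`w` decays with all derivatives, then so does `A` as soon as it decays itself. -/
lemma unifDecay_iteratedDeriv {A B w : ℝ → ℝ → ℂ} {E : ℝ → ℂ} {a b : ℂ} {M : ℕ → ℝ}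
    (hA : ∀ t, 0 ≤ t → ContDiff ℝ ∞ (A t)) (hw : ∀ t, 0 ≤ t → ContDiff ℝ ∞ (w t))
    (hE : ContDiff ℝ ∞ E) (hEM : ∀ n θ, ‖iteratedDeriv n E θ‖ ≤ M n)
    (hB : ∀ t, B t = fun θ => A t θ + E θ)
    (hd : ∀ t, 0 ≤ t → ∀ θ, HasDerivAt (A t) (a * A t θ + b * (w t θ * B t θ)) θ)
    (hwd : ∀ n, UnifDecay (fun t => iteratedDeriv n (w t))) (hA0 : UnifDecay A) (n : ℕ) :
    UnifDecay (fun t => iteratedDeriv n (A t)) := by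
  induction n using Nat.strong_induction_on with
  | _ n ih =>
  rcases n with _ | n
  · simpa only [iteratedDeriv_zero] using hA0
  have hBc : ∀ t, 0 ≤ t → ContDiff ℝ ∞ (B t) := fun t ht => by
    rw [hB]
    exact (hA t ht).add hE
  have hn : ∀ n : ℕ, ((n : ℕ) : WithTop ℕ∞) ≤ ∞ := fun n => by exact_mod_cast le_top
  -- The derivatives of `B` up to order `n` need only be bounded: in the Leibniz expansion of `w B`,
  -- each term has a decaying derivative of `w`.
  have hBbd : ∀ j ≤ n, ∃ K, 0 ≤ K ∧ ∀ t, 0 ≤ t → ∀ θ, ‖iteratedDeriv j (B t) θ‖ ≤ K := by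
    intro j hj
    obtain ⟨e, he, hle⟩ := ih j (by omega)
    obtain ⟨K, hK, hKle⟩ := he.exists_bound
    have hM : 0 ≤ M j := (norm_nonneg _).trans (hEM j 0)
    refine ⟨K + M j, by positivity, fun t ht θ => ?_⟩
    have h1 : iteratedDeriv j (B t) θ = iteratedDeriv j (A t) θ + iteratedDeriv j E θ := by
      rw [hB]
      exact iteratedDeriv_fun_add ((hA t ht).contDiffAt.of_le (hn j)) (hE.contDiffAt.of_le (hn j))
    rw [h1]
    exact (norm_add_le _ _).trans (add_le_add ((hle t ht θ).trans (hKle t ht)) (hEM j θ))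
  choose! K hK hKle using hBbd
  choose ew hew hewle using hwd
  obtain ⟨eA, heA, heAle⟩ := ih n (by omega)
  refine ⟨fun t => ‖a‖ * eA t + ‖b‖ * ∑ i ∈ Finset.range (n + 1), (n.choose i * K (n - i)) * ew i t,
    (heA.const_mul (norm_nonneg a)).add ((ExpDecayFrom.sum _ fun i hi =>
      (hew i).const_mul (mul_nonneg (Nat.cast_nonneg _) (hK (n - i) (by omega)))).const_mul
        (norm_nonneg b)), fun t ht θ => ?_⟩
  have h1 : deriv (A t) = fun θ => a * A t θ + b * (w t θ * B t θ) :=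
    funext fun θ => (hd t ht θ).deriv
  have hAn := (hA t ht).contDiffAt (x := θ) |>.of_le (hn n)
  have hwn := (hw t ht).contDiffAt (x := θ) |>.of_le (hn n)
  have hBn := (hBc t ht).contDiffAt (x := θ) |>.of_le (hn n)
  change ‖iteratedDeriv (n + 1) (A t) θ‖ ≤ _
  rw [iteratedDeriv_succ', h1, iteratedDeriv_fun_add (contDiffAt_const.mul hAn)
    (contDiffAt_const.mul (hwn.mul hBn)), iteratedDeriv_const_mul_field,
    iteratedDeriv_const_mul_field, iteratedDeriv_fun_mul hwn hBn]
  refine (norm_add_le _ _).trans ?_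
  rw [norm_mul, norm_mul]
  refine add_le_add (mul_le_mul_of_nonneg_left (heAle t ht θ) (norm_nonneg a))
    (mul_le_mul_of_nonneg_left ((norm_sum_le _ _).trans (Finset.sum_le_sum fun i hi => ?_))
      (norm_nonneg b))
  rw [norm_mul, norm_mul, Complex.norm_natCast, mul_assoc, mul_assoc, mul_comm (K (n - i))]
  refine mul_le_mul_of_nonneg_left ?_ (Nat.cast_nonneg _)
  exact mul_le_mul (hewle i t ht θ) (hKle (n - i) (by omega) t ht θ) (norm_nonneg _)
    ((norm_nonneg _).trans (hewle i t ht θ))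

lemma hasDerivAt_comp_affine {E : Type*} [NormedAddCommGroup E] [NormedSpace ℝ E] {g : ℝ → E}
    {g' : E} {L σ θ : ℝ} (hg : HasDerivAt g g' (L * θ - σ)) :
    HasDerivAt (fun θ => g (L * θ - σ)) (L • g') θ := by
  have h1 : HasDerivAt (fun θ : ℝ => L * θ - σ) L θ :=
    (((hasDerivAt_id θ).const_mul L).sub_const σ).congr_deriv (mul_one L)
  exact hg.scomp θ h1

lemma roundCircle_eq (c : ℂ) (R θ : ℝ) :
    roundCircle c R θ = c + R * Complex.exp (Complex.I * (2 * Real.pi * θ : ℝ)) := by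
  rw [roundCircle, mul_comm Complex.I, Complex.exp_mul_I]
  push_cast
  rfl

/-- Decay of all derivatives amounts to decay in every `C^k` norm. -/
lemma exists_ckNormLE {D : ℝ → ℝ → ℂ} (hper : ∀ t, 0 ≤ t → Function.Periodic (D t) 1)
    (hD : ∀ t, 0 ≤ t → ContDiff ℝ ∞ (D t))
    (hdec : ∀ j, UnifDecay (fun t => iteratedDeriv j (D t))) (k : ℕ) :
    ∃ C > 0, ∃ lam > 0, ∀ t : ℝ, 0 ≤ t → CkNormLE k (D t) (C * Real.exp (-lam * t)) := by
  choose e he hle using hdec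
  obtain ⟨C, hC, lam, hlam, h⟩ := ExpDecayFrom.sum (Finset.range (k + 1)) fun i _ => he i
  refine ⟨C, hC, lam, hlam, fun t ht => ⟨hper t ht,
    (hD t ht).of_le (by exact_mod_cast le_top), fun j hj θ => ?_⟩⟩
  refine (hle j t ht θ).trans (le_trans ?_ (h t ht))
  exact Finset.single_le_sum (f := fun i => e i t)
    (fun i _ => (norm_nonneg _).trans (hle i t ht 0)) (Finset.mem_range.2 (by omega))

namespace IsGlobalSolution

variable {F : ℝ → ℝ → ℂ} (hF : IsGlobalSolution F) (hrot : rotationNumber (F 0) = 1)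

include hF

lemma contDiff_comp_arcInv {E : Type*} [NormedAddCommGroup E] [NormedSpace ℝ E] {g : ℝ → E}
    (hg : ContDiff ℝ ∞ g) (u₀ : ℝ) {t : ℝ} (ht : 0 ≤ t) (L σ : ℝ) :
    ContDiff ℝ ∞ (fun θ => g (arcInv (F t) u₀ (L * θ - σ))) :=
  hg.comp ((contDiff_arcInv (hF.contDiff ht) (hF.immersed t ht) (hF.periodic t ht) u₀).comp
    ((contDiff_const.mul contDiff_id).sub contDiff_const))

include hrot

omit hrot in
lemma iteratedDeriv_curvDev (u₀ : ℝ) {t : ℝ} (ht : 0 ≤ t) (L σ : ℝ) (m : ℕ) :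
    iteratedDeriv m
      (fun θ => ((curvDev (meanCurv F) (F t) 0 (arcInv (F t) u₀ (L * θ - σ)) : ℝ) : ℂ)) =
      fun θ => ((L ^ m * curvDev (meanCurv F) (F t) m (arcInv (F t) u₀ (L * θ - σ)) : ℝ) : ℂ) := by
  rw [← iteratedDeriv_eq_of_hasDerivAt (G := fun m θ =>
    ((L ^ m * curvDev (meanCurv F) (F t) m (arcInv (F t) u₀ (L * θ - σ)) : ℝ) : ℂ)) ?_ m]
  · simp only [pow_zero, one_mul]
  intro m θ
  have h1 := hasDerivAt_comp_affine (σ := σ) (hasDerivAt_comp_arcInv (hF.contDiff ht)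
    (hF.immersed t ht) (hF.periodic t ht) u₀ (s := L * θ - σ)
    (hasDerivAt_curvDev (meanCurv F) (hF.contDiff ht) (hF.immersed t ht) m _))
  refine (h1.const_mul (L ^ m)).ofReal_comp.congr_deriv ?_
  rw [smul_eq_mul, pow_succ, mul_assoc]

section Convergence

variable {u₀ : ℝ} {r σ ε : ℝ → ℝ} {p τ : ℂ}
  (hr : ∀ t, 0 ≤ t → 0 ≤ r t)
  (hσ : ∀ t, 0 ≤ t → fourierHat (F t) u₀ 1 = (Real.sqrt (length (F t)) : ℂ) * (r t : ℂ) *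
    Complex.exp (Complex.I * ((2 * Real.pi * σ t / length (F t) : ℝ) : ℂ)))
  (hε : ExpDecayFrom 0 ε)
  (hasy : ∀ t, 0 ≤ t → (∀ u, |curvature (F t) u - meanCurv F| ≤ ε t) ∧
    ‖F t u₀ + (meanCurv F : ℂ)⁻¹ * (Complex.I * tangent (F t) u₀) - p‖ ≤ ε t ∧
    ‖tangent (F t) u₀ - τ‖ ≤ ε t)

include hasy

omit hrot in
lemma norm_arcParam_zero_sub_le {t : ℝ} (ht : 0 ≤ t) :
    ‖arcParam (F t) u₀ 0 + (meanCurv F : ℂ)⁻¹ *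
      (Complex.I * tangent (F t) (arcInv (F t) u₀ 0)) - p‖ ≤ ε t := by
  have h := (hasy t ht).2.1
  rw [arcInv_zero (hF.contDiff ht) (hF.immersed t ht) u₀]
  have h0 : arcParam (F t) u₀ 0 = F t u₀ := by
    rw [← congrArg (F t) (arcInv_zero (hF.contDiff ht) (hF.immersed t ht) u₀)]
    rfl
  rw [h0]
  exact h

include hσ in
lemma norm_mode_one_add_le {t : ℝ} (ht : 0 ≤ t) :
    ‖(r t : ℂ) * Complex.exp (Complex.I * (meanCurv F * σ t : ℝ)) + (meanCurv F : ℂ)⁻¹ *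
      (Complex.I * tangent (F t) (arcInv (F t) u₀ 0))‖ ≤
      2 * ε t * length (F 0) / meanCurv F := by
  refine norm_fourierHat_one_sub_le (hF.isUnitSpeedLoop hrot u₀ ht) (hF.length_eq hrot ht)
    hF.meanCurv_pos (hF.meanCurv_mul_length hrot le_rfl) (fun s => (hasy t ht).1 _) ?_
  rw [hσ t ht, hF.length_eq hrot ht, mul_assoc]
  congr 5
  rw [meanCurv]
  ring

include hε

lemma expDecay_center_sub : ExpDecayFrom 0 (fun t => ‖center (F t) u₀ - p‖) := by
  have hk := hF.meanCurv_pos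
  have hL := hF.length_pos le_rfl
  refine (hε.const_mul (c := 2 * length (F 0) / meanCurv F + 1) (by positivity)).mono
    fun t ht => ?_
  have h1 := norm_center_sub_le (hF.isUnitSpeedLoop hrot u₀ ht) (hF.length_eq hrot ht)
    hk (hF.meanCurv_mul_length hrot le_rfl) (fun s => (hasy t ht).1 _)
  refine (norm_sub_le_norm_sub_add_norm_sub _ _ _).trans
    ((add_le_add h1 (hF.norm_arcParam_zero_sub_le hasy ht)).trans (le_of_eq ?_))
  ring

include hr hσ

lemma expDecay_radius_sub : ExpDecayFrom 0 (fun t => |r t - (meanCurv F)⁻¹|) := by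
  have hk := hF.meanCurv_pos
  have hL := hF.length_pos le_rfl
  refine (hε.const_mul (c := 2 * length (F 0) / meanCurv F) (by positivity)).mono fun t ht => ?_
  refine (abs_radius_sub_le (hF.isUnitSpeedLoop hrot u₀ ht) hk
    (hF.norm_mode_one_add_le hrot hσ hasy ht) (hr t ht)).trans (le_of_eq ?_)
  ring

lemma exists_expDecay_phase_sub (hτ : ‖τ‖ = 1) : ∃ σ_lim : AddCircle (length (F 0)),
    ExpDecayFrom 0 (fun t => ‖(σ t : AddCircle (length (F 0))) - σ_lim‖) := by
  have hk := hF.meanCurv_pos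
  have hL := hF.length_pos le_rfl
  have hpi := Real.pi_pos
  -- The limit phase solves `e^{ikσ} = -iτ`.
  refine ⟨((meanCurv F)⁻¹ * (-(Complex.I * τ)).arg : ℝ), ?_⟩
  refine (hε.const_mul (c := Real.pi / (2 * meanCurv F) * (4 * length (F 0) + 1))
    (by positivity)).mono fun t ht => ?_
  refine (norm_addCircle_sub_le hL hk (hF.meanCurv_mul_length hrot le_rfl) _ _).trans ?_
  rw [mul_assoc]
  refine mul_le_mul_of_nonneg_left ?_ (by positivity)
  have h1 : Complex.exp (Complex.I *
      (meanCurv F * ((meanCurv F)⁻¹ * (-(Complex.I * τ)).arg) : ℝ)) = -(Complex.I * τ) := by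
    have h2 := Complex.norm_mul_exp_arg_mul_I (-(Complex.I * τ))
    rw [norm_neg, norm_I_mul, hτ, Complex.ofReal_one, one_mul] at h2
    rw [mul_inv_cancel_left₀ hk.ne', mul_comm, h2]
  have h3 := norm_phase_add_le (hF.isUnitSpeedLoop hrot u₀ ht) hk
    (hF.norm_mode_one_add_le hrot hσ hasy ht) (hr t ht)
  have h4 := (hasy t ht).2.2
  simp only [arcInv_zero (hF.contDiff ht) (hF.immersed t ht) u₀] at h3
  have h5 : Complex.exp (Complex.I * (meanCurv F * σ t : ℝ)) - -(Complex.I * τ) =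
      (Complex.exp (Complex.I * (meanCurv F * σ t : ℝ)) + Complex.I * tangent (F t) u₀) -
      Complex.I * (tangent (F t) u₀ - τ) := by ring
  rw [h1, h5]
  refine (norm_sub_le _ _).trans ?_
  rw [norm_I_mul]
  linarith

lemma unifDecay_iteratedDeriv_tangent (j : ℕ) : UnifDecay (fun t => iteratedDeriv j (fun θ =>
    (length (F 0) : ℂ) * tangent (F t) (arcInv (F t) u₀ (length (F 0) * θ - σ t)) -
      length (F 0) * (Complex.I * Complex.exp (Complex.I * (2 * Real.pi * θ : ℝ))))) := by
  have hk := hF.meanCurv_pos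
  have hL := hF.length_pos le_rfl
  have hpi := Real.pi_pos
  have hkL := hF.meanCurv_mul_length hrot le_rfl
  set L := length (F 0) with hLdef
  have hEd : ∀ (n : ℕ) (θ : ℝ), HasDerivAt (fun θ : ℝ => (2 * Real.pi * Complex.I : ℂ) ^ n *
      (L * (Complex.I * Complex.exp (Complex.I * (2 * Real.pi * θ : ℝ)))))
      ((2 * Real.pi * Complex.I : ℂ) ^ (n + 1) *
      (L * (Complex.I * Complex.exp (Complex.I * (2 * Real.pi * θ : ℝ))))) θ := by
    intro n θ
    refine ((((hasDerivAt_exp_I_mul (2 * Real.pi) θ).const_mul Complex.I).const_mul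
      (L : ℂ)).const_mul _).congr_deriv ?_
    push_cast
    ring
  have hE : ContDiff ℝ ∞ (fun θ : ℝ =>
      (L : ℂ) * (Complex.I * Complex.exp (Complex.I * (2 * Real.pi * θ : ℝ)))) := by
    have h1 : ContDiff ℝ ∞ (fun θ : ℝ => ((2 * Real.pi * θ : ℝ) : ℂ)) :=
      Complex.ofRealCLM.contDiff.comp (contDiff_const.mul contDiff_id)
    exact contDiff_const.mul (contDiff_const.mul (contDiff_const.mul h1).cexp)
  -- For `B = L T(Lθ - σ)` and `E = L i e^{2πiθ}`, the relations `B' = iLκ B` and `E' = 2πi E` give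
  -- `(B - E)' = 2πi (B - E) + iL w B`, because `kL = 2π`.
  refine unifDecay_iteratedDeriv
    (E := fun θ : ℝ => (L : ℂ) * (Complex.I * Complex.exp (Complex.I * (2 * Real.pi * θ : ℝ))))
    (w := fun t θ => ((curvDev (meanCurv F) (F t) 0 (arcInv (F t) u₀ (L * θ - σ t)) : ℝ) : ℂ))
    (a := 2 * Real.pi * Complex.I) (b := L * Complex.I) (M := fun n => (2 * Real.pi) ^ n * L)
    (fun t ht => ?_) (fun t ht => ?_) hE (fun n θ => ?_) (fun t => rfl) (fun t ht θ => ?_)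
    (fun n => ?_) ?_ j
  · exact (contDiff_const.mul (hF.contDiff_comp_arcInv
      (contDiff_tangent (hF.contDiff ht) (hF.immersed t ht)) u₀ ht L (σ t))).sub hE
  · exact Complex.ofRealCLM.contDiff.comp (hF.contDiff_comp_arcInv
      (contDiff_curvDev _ (hF.contDiff ht) (hF.immersed t ht) 0) u₀ ht L (σ t))
  · have h1 := iteratedDeriv_eq_of_hasDerivAt hEd n
    simp only [pow_zero, one_mul] at h1
    have h2 : ‖(2 * Real.pi * Complex.I : ℂ)‖ = 2 * Real.pi := by
      simp [abs_of_pos hpi]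
    rw [h1, norm_mul, norm_pow, h2, norm_mul, norm_I_mul, norm_exp_I_mul, Complex.norm_real,
      Real.norm_of_nonneg hL.le, mul_one]
  · have h1 := (hasDerivAt_comp_affine (σ := σ t) ((hF.isUnitSpeedLoop hrot u₀ ht).hasDerivAt_tangent
      (L * θ - σ t))).const_mul (L : ℂ)
    have h2 := hEd 0 θ
    simp only [pow_zero, one_mul, zero_add, pow_one] at h2
    refine (h1.sub h2).congr_deriv ?_
    have h3 : (meanCurv F : ℂ) * L = 2 * Real.pi := by exact_mod_cast hkL
    simp only [curvDev, Complex.real_smul, ← h3]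
    push_cast
    ring
  · obtain ⟨C, hC, lam, hlam, h⟩ := hF.exists_curvDev_bound hrot n
    refine ⟨fun t => L ^ n * (C * Real.exp (-lam * t)),
      (ExpDecayFrom.of_exp hC.le hlam).const_mul (by positivity), fun t ht θ => ?_⟩
    change ‖iteratedDeriv n (fun θ => _) θ‖ ≤ _
    rw [hF.iteratedDeriv_curvDev u₀ ht, Complex.norm_real, Real.norm_eq_abs, abs_mul,
      abs_of_pos (by positivity : 0 < L ^ n)]
    exact mul_le_mul_of_nonneg_left (h t ht _) (by positivity)
  · refine ⟨fun t => 5 * L ^ 2 * ε t, hε.const_mul (by positivity), fun t ht θ => ?_⟩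
    have h1 := norm_tangent_sub_circle_le (hF.isUnitSpeedLoop hrot u₀ ht) hk hkL
      (fun s => (hasy t ht).1 _) (hF.norm_mode_one_add_le hrot hσ hasy ht) (hr t ht) θ
    simp only [← mul_sub]
    rw [norm_mul, Complex.norm_real, Real.norm_of_nonneg hL.le]
    refine (mul_le_mul_of_nonneg_left h1 hL.le).trans (le_of_eq ?_)
    ring

lemma exists_ckNormLE_reparam_sub (k : ℕ) : ∃ C > 0, ∃ lam > 0, ∀ t : ℝ, 0 ≤ t →
    CkNormLE k (fun θ => reparam (F t) u₀ (σ t) θ - roundCircle p (meanCurv F)⁻¹ θ)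
      (C * Real.exp (-lam * t)) := by
  have hk := hF.meanCurv_pos
  have hL := hF.length_pos le_rfl
  have hkL := hF.meanCurv_mul_length hrot le_rfl
  have hkc : (meanCurv F : ℂ) ≠ 0 := by exact_mod_cast hk.ne'
  have hkLc : (meanCurv F : ℂ) * length (F 0) = 2 * Real.pi := by exact_mod_cast hkL
  have hD : ∀ t, 0 ≤ t → (fun θ => reparam (F t) u₀ (σ t) θ - roundCircle p (meanCurv F)⁻¹ θ) =
      fun θ => arcParam (F t) u₀ (length (F 0) * θ - σ t) -
        (p + (meanCurv F : ℂ)⁻¹ * Complex.exp (Complex.I * (2 * Real.pi * θ : ℝ))) := by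
    intro t ht
    funext θ
    rw [roundCircle_eq, reparam, hF.length_eq hrot ht, Complex.ofReal_inv]
  refine exists_ckNormLE (D := fun t θ => reparam (F t) u₀ (σ t) θ -
    roundCircle p (meanCurv F)⁻¹ θ) (fun t ht => ?_) (fun t ht => ?_) (fun j => ?_) k
  · rw [hD t ht]
    intro θ
    have h1 := (hF.isUnitSpeedLoop hrot u₀ ht).periodic (length (F 0) * θ - σ t)
    have h2 := exp_I_mul_periodic (L := 1) (mul_one (2 * Real.pi)) θ
    simp only [h2]
    rw [← h1]
    congr 2
    ring
  · rw [hD t ht]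
    refine (hF.contDiff_comp_arcInv (hF.contDiff ht) u₀ ht _ _).sub
      (contDiff_const.add (contDiff_const.mul (contDiff_const.mul ?_).cexp))
    exact Complex.ofRealCLM.contDiff.comp (contDiff_const.mul contDiff_id)
  -- Order zero is closeness to the circle; one derivative turns the difference into the tangent
  -- error, whose derivatives are already controlled.
  · rcases j with _ | j
    · refine ⟨fun t => (1 + 6 * length (F 0) / meanCurv F) * ε t,
        hε.const_mul (by positivity), fun t ht θ => ?_⟩
      change ‖iteratedDeriv 0 (fun θ => _) θ‖ ≤ _
      rw [hD t ht, iteratedDeriv_zero]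
      exact norm_reparam_sub_circle_le (hF.isUnitSpeedLoop hrot u₀ ht) hk hkL
        (fun s => (hasy t ht).1 _) (hF.norm_mode_one_add_le hrot hσ hasy ht) (hr t ht)
        (hF.norm_arcParam_zero_sub_le hasy ht) θ
    · obtain ⟨e, he, hle⟩ := hF.unifDecay_iteratedDeriv_tangent hrot hr hσ hε hasy j
      refine ⟨e, he, fun t ht θ => (le_of_eq ?_).trans (hle t ht θ)⟩
      change ‖iteratedDeriv (j + 1) (fun θ => _) θ‖ = _
      rw [hD t ht, iteratedDeriv_succ']
      congr 3
      funext x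
      refine ((hasDerivAt_comp_affine (σ := σ t) ((hF.isUnitSpeedLoop hrot u₀ ht).hasDerivAt
        (length (F 0) * x - σ t))).sub (((hasDerivAt_exp_I_mul (2 * Real.pi) x).const_mul
          (meanCurv F : ℂ)⁻¹).const_add p)).deriv.trans ?_
      rw [Complex.real_smul]
      congr 1
      push_cast
      rw [← hkLc]
      field_simp

/-! ### The enclosed domain and its barycenter -/

omit hr hσ

/-- The domain to the left of the curve. -/
def enclosedDomain (F : ℝ → ℝ → ℂ) (u₀ t : ℝ) : Set ℂ :=
  leftRegion (arcParam (F t) u₀) (fun s => tangent (F t) (arcInv (F t) u₀ s))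

omit hε in
lemma abs_support_arcParam_sub_le {t : ℝ} (ht : 0 ≤ t) (s : ℝ) :
    |inner ℝ (p - arcParam (F t) u₀ s) (Complex.I * tangent (F t) (arcInv (F t) u₀ s)) -
      (meanCurv F)⁻¹| ≤ (1 + 3 * length (F 0) / meanCurv F) * ε t :=
  abs_support_sub_le (hF.isUnitSpeedLoop hrot u₀ ht) hF.meanCurv_pos
    (hF.meanCurv_mul_length hrot le_rfl) (fun _ => (hasy t ht).1 _)
    (hF.norm_arcParam_zero_sub_le hasy ht) s

omit hrot hε hasy in
lemma range_reparam {t : ℝ} (ht : 0 ≤ t) (a : ℝ) :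
    range (reparam (F t) u₀ a) = range (arcParam (F t) u₀) := by
  have hL := (hF.length_pos ht).ne'
  refine Subset.antisymm (range_subset_iff.2 fun θ => ⟨_, rfl⟩) (range_subset_iff.2 fun s => ?_)
  refine ⟨(length (F t))⁻¹ * (s + a), ?_⟩
  rw [reparam, mul_inv_cancel_left₀ hL, add_sub_cancel_right]

omit hF hrot hε hasy in
-- Multiplying by the area cancels the denominator of the barycenter. The errors are those of the
-- first moment, the area and the center; for zero area the left side vanishes.
lemma norm_area_smul_barycenter_sub_le (γ : ℝ → ℂ) (Ω : Set ℂ) (c q : ℂ) (R : ℝ) :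
    ‖signedArea γ • (barycenter γ Ω - c)‖ ≤ ‖(∫ x in Ω, x) - (Real.pi * R ^ 2) • q‖ +
      (|Real.pi * R ^ 2 - signedArea γ| * ‖q‖ + |signedArea γ| * ‖c - q‖) := by
  rcases eq_or_ne (signedArea γ) 0 with h0 | h0
  · rw [h0, zero_smul, norm_zero]
    positivity
  have h1 : signedArea γ • (barycenter γ Ω - c) = ((∫ x in Ω, x) - (Real.pi * R ^ 2) • q) +
      ((Real.pi * R ^ 2 - signedArea γ) • q - signedArea γ • (c - q)) := by
    rw [smul_sub, barycenter, smul_inv_smul₀ h0]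
    module
  rw [h1]
  refine (norm_add_le _ _).trans (add_le_add le_rfl ((norm_sub_le _ _).trans ?_))
  rw [norm_smul, norm_smul, Real.norm_eq_abs, Real.norm_eq_abs]

omit hrot hasy hε in
lemma area_disk_sub {t : ℝ} : Real.pi * (meanCurv F)⁻¹ ^ 2 - signedArea (F t) =
    (4 * Real.pi)⁻¹ * deficit F t := by
  have hL := hF.length_pos le_rfl
  have hpi := Real.pi_pos
  rw [meanCurv, deficit]
  field_simp
  ring

/-- From some time on, the flow consists of convex curves close to the limit circle. -/
lemma exists_convex_domain : ∃ T₀ : ℝ, 0 ≤ T₀ ∧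
    (∀ t, T₀ ≤ t → IsBoundedDomain (enclosedDomain F u₀ t) ∧
      frontier (enclosedDomain F u₀ t) = range (arcParam (F t) u₀)) ∧
    (∀ t, T₀ ≤ t → StrictConvex ℝ (closure (enclosedDomain F u₀ t)) ∧
      ∀ u, 0 < curvature (F t) u) ∧
    ExpDecayFrom T₀ (fun t => Metric.hausdorffDist (closure (enclosedDomain F u₀ t))
      (Metric.closedBall p (meanCurv F)⁻¹)) ∧
    ExpDecayFrom T₀ (fun t => ‖signedArea (F t) •
      (barycenter (F t) (enclosedDomain F u₀ t) - center (F t) u₀)‖) := by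
  have hk := hF.meanCurv_pos
  have hL := hF.length_pos le_rfl
  have hpi := Real.pi_pos
  set R := (meanCurv F)⁻¹ with hR
  have hR0 : 0 < R := inv_pos.2 hk
  set q := 1 + 3 * length (F 0) / meanCurv F with hq
  have hq0 : 0 < q := by positivity
  have hδ : ExpDecayFrom 0 (fun t => q * ε t) := hε.const_mul hq0.le
  -- After `T₁` the curvature is at least `k/2`; after `T₂` the inner disk has radius at least
  -- `R/2`, so the domain is nonempty.
  obtain ⟨T₁, hT₁, h₁⟩ := hε.exists_le (half_pos hk)
  obtain ⟨T₂, hT₂, h₂⟩ := hδ.exists_le (half_pos hR0)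
  have hκ : ∀ t, T₁ ≤ t → ∀ u, 0 < curvature (F t) u := fun t ht u => by
    have h3 := (abs_le.1 ((hasy t (hT₁.trans ht)).1 u)).1
    have h4 := h₁ t ht
    linarith
  have hsup := fun t ht => hF.abs_support_arcParam_sub_le hrot hasy (t := t) ht
  have hδ0 : ∀ t, 0 ≤ t → 0 ≤ q * ε t := fun t ht => (abs_nonneg _).trans (hsup t ht 0)
  have hδR : ∀ t, T₂ ≤ t → q * ε t < R := fun t ht => (h₂ t ht).trans_lt (half_lt_self hR0)
  have hin : ∀ t, 0 ≤ t → Metric.ball p (R - q * ε t) ⊆ enclosedDomain F u₀ t := fun t ht =>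
    (hF.isUnitSpeedLoop hrot u₀ ht).ball_subset_leftRegion (hsup t ht)
  have hout : ∀ t, 0 ≤ t → enclosedDomain F u₀ t ⊆ Metric.closedBall p (R + q * ε t) :=
    fun t ht => (hF.isUnitSpeedLoop hrot u₀ ht).leftRegion_subset_closedBall
      (add_nonneg hR0.le (hδ0 t ht)) (hsup t ht)
  have hmem : ∀ t, 0 ≤ t → T₂ ≤ t → p ∈ enclosedDomain F u₀ t := fun t ht ht' =>
    hin t ht (Metric.mem_ball_self (sub_pos.2 (hδR t ht')))
  refine ⟨max T₁ T₂, hT₁.trans (le_max_left _ _), fun t ht => ?_, fun t ht => ?_, ?_, ?_⟩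
  · have ht₁ := (le_max_left _ _).trans ht
    have ht₂ := (le_max_right _ _).trans ht
    have ht0 := hT₁.trans ht₁
    have hloop := hF.isUnitSpeedLoop hrot u₀ ht0
    exact ⟨⟨hloop.isOpen_leftRegion,
      (IsUnitSpeedLoop.convex_leftRegion).isConnected ⟨p, hmem t ht0 ht₂⟩,
      Metric.isBounded_closedBall.subset (hout t ht0)⟩,
      hloop.frontier_leftRegion (fun _ => hκ t ht₁ _) (hmem t ht0 ht₂)⟩
  · have ht₁ := (le_max_left _ _).trans ht
    exact ⟨(hF.isUnitSpeedLoop hrot u₀ (hT₁.trans ht₁)).strictConvex_closure_leftRegion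
      (fun _ => hκ t ht₁ _), hκ t ht₁⟩
  · refine (hδ.mono_left (hT₁.trans (le_max_left _ _))).mono fun t ht => ?_
    have ht0 := hT₂.trans ((le_max_right _ _).trans ht)
    exact hausdorffDist_closure_closedBall_le (hδ0 t ht0) (hδR t ((le_max_right _ _).trans ht))
      (hin t ht0) (hout t ht0)
  · have hdef := hF.expDecay_deficit hrot
    obtain ⟨M, hM, hMle⟩ := hdef.exists_bound
    -- A bound for `|A|`, from `A = πR² - D/4π` and `D ≤ M`.
    set K := Real.pi * R ^ 2 + (4 * Real.pi)⁻¹ * M with hK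
    refine (((hδ.const_mul (c := 8 * Real.pi * R ^ 2 + 3 * Real.pi * R * ‖p‖)
      (by positivity)).add ((hdef.const_mul (c := (4 * Real.pi)⁻¹ * ‖p‖) (by positivity)).add
      ((hF.expDecay_center_sub hrot hε hasy).const_mul (c := K) (by positivity)))).mono_left
      (hT₁.trans (le_max_left _ _))).mono fun t ht => ?_
    have ht₂ := (le_max_right _ _).trans ht
    have ht0 := hT₂.trans ht₂
    have hd0 := hF.deficit_nonneg hrot ht0
    have hA := hF.area_disk_sub (t := t)
    rw [← hR] at hA
    have hA1 : |Real.pi * R ^ 2 - signedArea (F t)| = (4 * Real.pi)⁻¹ * deficit F t := by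
      rw [hA, abs_of_nonneg (by positivity)]
    have hA2 : |signedArea (F t)| ≤ K := by
      have h3 : signedArea (F t) = Real.pi * R ^ 2 - (4 * Real.pi)⁻¹ * deficit F t := by
        rw [← hA, sub_sub_cancel]
      rw [h3]
      refine (abs_sub _ _).trans ?_
      rw [abs_of_nonneg (by positivity), abs_of_nonneg (by positivity)]
      rw [hK]
      have := hMle t ht0
      gcongr
    refine (norm_area_smul_barycenter_sub_le _ _ _ p R).trans ?_
    rw [hA1, mul_right_comm]
    exact add_le_add (norm_integral_sub_le (hδ0 t ht0) (hδR t ht₂) (hin t ht0) (hout t ht0))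
      (add_le_add le_rfl (mul_le_mul_of_nonneg_right hA2 (norm_nonneg _)))

end Convergence

end IsGlobalSolution

end LengthPreservingFlow

end

/-! ### Convergence of the length-preserving flow -/

theorem theorem12 (F : ℝ → ℝ → ℂ) (hF : LengthPreservingFlow.IsGlobalSolution F)
    (hrot : LengthPreservingFlow.rotationNumber (F 0) = 1)
    (harea : 0 < LengthPreservingFlow.signedArea (F 0))
    (u₀ : ℝ) (r σ : ℝ → ℝ) (hr : ∀ t, 0 ≤ t → 0 ≤ r t)
    (hσ : ∀ t, 0 ≤ t → LengthPreservingFlow.fourierHat (F t) u₀ 1 =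
      (Real.sqrt (LengthPreservingFlow.length (F t)) : ℂ) * (r t : ℂ) *
        Complex.exp (Complex.I *
          ((2 * Real.pi * σ t / LengthPreservingFlow.length (F t) : ℝ) : ℂ))) :
    ∃ L : ℝ, 0 < L ∧ (∀ t, 0 ≤ t → LengthPreservingFlow.length (F t) = L) ∧
    ∃ c : ℂ,
      -- (1) the Fourier center
      LengthPreservingFlow.ExpDecayFrom 0
        (fun t => ‖LengthPreservingFlow.center (F t) u₀ - c‖) ∧
      -- (2) the radius
      LengthPreservingFlow.ExpDecayFrom 0 (fun t => |r t - L / (2 * Real.pi)|) ∧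
      -- (3) the phase, as an element of `ℝ/Lℤ`
      (∃ σ_lim : AddCircle L,
        LengthPreservingFlow.ExpDecayFrom 0 (fun t => ‖(σ t : AddCircle L) - σ_lim‖)) ∧
      -- (4) convergence to the round circle in every `C^k` norm
      (∀ k : ℕ, ∃ C > 0, ∃ lam > 0, ∀ t : ℝ, 0 ≤ t →
        LengthPreservingFlow.CkNormLE k
          (fun θ => LengthPreservingFlow.reparam (F t) u₀ (σ t) θ -
            LengthPreservingFlow.roundCircle c (L / (2 * Real.pi)) θ)
          (C * Real.exp (-lam * t))) ∧
      ∃ (T₀ : ℝ) (Ω : ℝ → Set ℂ), 0 ≤ T₀ ∧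
        -- (5) the curve bounds a domain, which is eventually strictly convex
        (∀ t, T₀ ≤ t → LengthPreservingFlow.IsBoundedDomain (Ω t) ∧
          frontier (Ω t) = Set.range (LengthPreservingFlow.reparam (F t) u₀ (σ t))) ∧
        (∃ T₁, T₀ ≤ T₁ ∧ ∀ t, T₁ ≤ t → StrictConvex ℝ (closure (Ω t)) ∧
          ∀ u, 0 < LengthPreservingFlow.curvature (F t) u) ∧
        -- (6) convergence to the closed disk in the Hausdorff distance
        LengthPreservingFlow.ExpDecayFrom T₀ (fun t =>
          Metric.hausdorffDist (closure (Ω t)) (Metric.closedBall c (L / (2 * Real.pi)))) ∧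
        -- (7) the barycenter
        LengthPreservingFlow.ExpDecayFrom T₀ (fun t =>
          ‖LengthPreservingFlow.signedArea (F t) •
            (LengthPreservingFlow.barycenter (F t) (Ω t) -
              LengthPreservingFlow.center (F t) u₀)‖) := by
  obtain ⟨ε, p, τ, hε, hτ, hasy⟩ := hF.exists_asymptotics hrot u₀
  have hR : LengthPreservingFlow.length (F 0) / (2 * Real.pi) =
      (LengthPreservingFlow.meanCurv F)⁻¹ := (inv_div _ _).symm
  obtain ⟨T₀, hT₀, hdom, hconv, hdist, hbary⟩ := hF.exists_convex_domain hrot hε hasy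
  refine ⟨LengthPreservingFlow.length (F 0), hF.length_pos le_rfl, fun t ht => hF.length_eq hrot ht, p,
    hF.expDecay_center_sub hrot hε hasy, ?_, hF.exists_expDecay_phase_sub hrot hr hσ hε hasy hτ,
    ?_, T₀,
    LengthPreservingFlow.IsGlobalSolution.enclosedDomain F u₀, hT₀, fun t ht => ⟨(hdom t ht).1, ?_⟩,
    -- The domain is built as a convex region, so the time of strict convexity may be taken equal to
    -- `T₀`.
    ⟨T₀, le_rfl, hconv⟩, ?_, hbary⟩
  · rw [hR]
    exact hF.expDecay_radius_sub hrot hr hσ hε hasy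
  · rw [hR]
    exact hF.exists_ckNormLE_reparam_sub hrot hr hσ hε hasy
  · rw [hF.range_reparam (hT₀.trans ht)]
    exact (hdom t ht).2
  · rw [hR]
    exact hdist
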